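/- Let $n>0$ and $\lambda>0$. Work with functions of $p=(p_x,p_r)$, $p_x\in\mathbb R$, $p_r>0$, i.e. cylindrically symmetric functions on $\mathbb R^3$ with $|p|^2=p_x^2+p_r^2$. Write $\int dp=\int_{|p|\ge\lambda}2\pi p_r\,dp_x\,dp_r$ and $P(p)=\frac1{e^{|p|^2}-1}$, $P_i=P(p_i)$, $f_i=f(p_i)$. Set $$\nu(p)= n\!\int\!\delta(p_x= p_{2x}+p_{3x},\,|p|^2=|p_2|^2+|p_3|^2)(1+P_2+P_3)\,dp_2dp_3+ 2n\!\int\!\delta(p_{1x}= p_x+p_{3x},\,|p_1|^2= |p|^2+|p_3|^2)(P_3-P_1)\,dp_1dp_3,$$ $$Kf(p)=\frac{2n}{P(p)}\Big(\int\!\delta(p_x= p_{2x}+p_{3x},\,|p|^2=|p_2|^2+|p_3|^2)(P_3-P)P_2f_2\,dp_2dp_3+\int\!\delta(p_{1x}= p_x+p_{3x},\,|p_1|^2= |p|^2+|p_3|^2)\big[(1+P+P_3)P_1f_1+(P_1-P)P_3f_3\big]dp_1dp_3\Big),$$ where all momenta are cut off at modulus $\ge\lambda$ and the Dirac measures are those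 of $\mathbb R^3$, i.e. $\int\delta(q_x=a,|q|^2=b)H(q)\,dq=\pi H(a,\sqrt{b-a^2})$ if $b>a^2$ and $b\ge\lambda^2$, and $0$ otherwise. Let $L=K-\nu$ be the linearized collision operator, let $(\cdot,\cdot)$ be the scalar product of $L^2_{\frac{P}{1+P}}$, i.e. $(f,g)=\int fg\,\frac{P}{1+P}\,dp$, let $\ker L=\{f\in L^2_{\frac P{1+P}}: Lf=0 \text{ a.e.}\}$, and let $\tilde P$ be the orthogonal projection of $L^2_{\frac P{1+P}}$ onto $\ker L$. Then $\ker L=\mathrm{span}\{|p|^2(1+P),\,p_x(1+P)\}$, and there is a constant $\nu_0>0$, depending only on $n$ and $\lambda$, such that $\nu(p)\ge\nu_0(1+|p|)^3$ for all $p=(p_x,p_r)\in\mathbb R\times[0,\infty)$ with $|p|\ge\lambda$, and $$-(Lf,f)\ \ge\ \nu_0\big((1+|p|)^3(I-\tilde P)f,(I-\tilde P)f\big)\qquad\text{for all } f\in L^2_{(1+|p|)^3\frac{P}{1+P}},$$ the integrals defining both sides being absolutely convergent. -/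

import Mathlib

open MeasureTheory Filter Topology

/- Momenta of cylindrically symmetric functions on `ℝ³` are pairs `p = (p_x, p_r)` with
`p_r = √(p_y² + p_z²)`; `p.1` is `p_x` and `p.2` is `p_r`. -/

namespace Milne

/-- `|p|² = p_x² + p_r²`. -/
noncomputable def sqNorm (p : ℝ × ℝ) : ℝ := p.1 ^ 2 + p.2 ^ 2

/-- `|p|`. -/
noncomputable def modulus (p : ℝ × ℝ) : ℝ := Real.sqrt (sqNorm p)

/-- The Planckian `P(p) = 1 / (exp(|p|²) - 1)`. -/
noncomputable def planck (p : ℝ × ℝ) : ℝ := 1 / (Real.exp (sqNorm p) - 1)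

/-- The momenta kept by the cut-off: `p_r > 0` and `|p| ≥ lam`. -/
def cutDomain (lam : ℝ) : Set (ℝ × ℝ) := {p | 0 < p.2 ∧ lam ≤ modulus p}

/-- Lebesgue measure `dp` of `ℝ³`, restricted to `|p| ≥ lam`, in cylindrical coordinates:
`2π p_r dp_x dp_r`. -/
noncomputable def dp (lam : ℝ) : Measure (ℝ × ℝ) :=
  (volume.restrict (cutDomain lam)).withDensity (fun p => ENNReal.ofReal (2 * Real.pi * p.2))

/-- The measure `P/(1+P) dp`, so that `Lp ℝ 2 (mu lam)` is the space `L²_{P/(1+P)}` of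
cylindrically symmetric functions. -/
noncomputable def mu (lam : ℝ) : Measure (ℝ × ℝ) :=
  (dp lam).withDensity (fun p => ENNReal.ofReal (planck p / (1 + planck p)))

/-- The integral `∫_{|q| ≥ lam} δ(q_x = a) δ(|q|² = b) H(q) dq` over `ℝ³` for a cylindrically
symmetric `H`. As `dq = 2π q_r dq_x dq_r = π dq_x d(q_r²)` and `q_r² = |q|² - q_x²`, it equals
`π H(a, √(b - a²))` if `b > a²` and `b ≥ lam²`, and vanishes otherwise. -/
noncomputable def deltaInt (lam a b : ℝ) (H : ℝ × ℝ → ℝ) : ℝ :=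
  open Classical in
  if a ^ 2 < b ∧ lam ^ 2 ≤ b then Real.pi * H (a, Real.sqrt (b - a ^ 2)) else 0

/-- `∫ χ̃ δ(p_x = p_{2x} + p_{3x}, p² = p_2² + p_3²) G(p_2, p_3) dp_2 dp_3`,
the delta being resolved in `p_3`. -/
noncomputable def decayInt (lam : ℝ) (p : ℝ × ℝ) (G : ℝ × ℝ → ℝ × ℝ → ℝ) : ℝ :=
  ∫ p2, deltaInt lam (p.1 - p2.1) (sqNorm p - sqNorm p2) (fun p3 => G p2 p3) ∂(dp lam)

/-- `∫ χ̃ δ(p_{1x} = p_x + p_{3x}, p_1² = p² + p_3²) G(p_1, p_3) dp_1 dp_3`,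
the delta being resolved in `p_3`. -/
noncomputable def mergeInt₁ (lam : ℝ) (p : ℝ × ℝ) (G : ℝ × ℝ → ℝ × ℝ → ℝ) : ℝ :=
  ∫ p1, deltaInt lam (p1.1 - p.1) (sqNorm p1 - sqNorm p) (fun p3 => G p1 p3) ∂(dp lam)

/-- `∫ χ̃ δ(p_{1x} = p_x + p_{3x}, p_1² = p² + p_3²) G(p_1, p_3) dp_1 dp_3`,
the delta being resolved in `p_1`. -/
noncomputable def mergeInt₃ (lam : ℝ) (p : ℝ × ℝ) (G : ℝ × ℝ → ℝ × ℝ → ℝ) : ℝ :=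
  ∫ p3, deltaInt lam (p.1 + p3.1) (sqNorm p + sqNorm p3) (fun p1 => G p1 p3) ∂(dp lam)

/-- The collision frequency `ν`. -/
noncomputable def nu (n lam : ℝ) (p : ℝ × ℝ) : ℝ :=
  n * decayInt lam p (fun p2 p3 => 1 + planck p2 + planck p3)
    + 2 * n * mergeInt₃ lam p (fun p1 p3 => planck p3 - planck p1)

/-- The operator `K`. -/
noncomputable def opK (n lam : ℝ) (f : ℝ × ℝ → ℝ) (p : ℝ × ℝ) : ℝ :=
  2 * n / planck p *
    (decayInt lam p (fun p2 p3 => (planck p3 - planck p) * planck p2 * f p2)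
      + mergeInt₁ lam p (fun p1 p3 => (1 + planck p + planck p3) * planck p1 * f p1)
      + mergeInt₃ lam p (fun p1 p3 => (planck p1 - planck p) * planck p3 * f p3))

/-- The linearized collision operator `L = K - ν`. -/
noncomputable def opL (n lam : ℝ) (f : ℝ × ℝ → ℝ) (p : ℝ × ℝ) : ℝ :=
  opK n lam f p - nu n lam p * f p

/- Facts needed to see that `ker L` is a closed subspace of `L²_{P/(1+P)}`. -/

theorem measurable_sqNorm : Measurable sqNorm := by
  unfold sqNorm; fun_prop

theorem measurable_planck : Measurable planck := by
  have := measurable_sqNorm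
  unfold planck; fun_prop

theorem measurableSet_cutDomain (lam : ℝ) : MeasurableSet (cutDomain lam) := by
  have := measurable_sqNorm
  have h : Measurable modulus := by unfold modulus; fun_prop
  exact (measurableSet_lt measurable_const measurable_snd).inter
    (measurableSet_le measurable_const h)

theorem ae_dp (lam : ℝ) : ∀ᵐ p ∂(dp lam), p ∈ cutDomain lam :=
  (withDensity_absolutelyContinuous _ _).ae_le
    (ae_restrict_mem (measurableSet_cutDomain lam))

theorem sq_le_sqNorm {lam : ℝ} (hlam : 0 < lam) {p : ℝ × ℝ} (hp : p ∈ cutDomain lam) :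
    lam ^ 2 ≤ sqNorm p := by
  have h0 : 0 ≤ sqNorm p := by unfold sqNorm; positivity
  exact (Real.le_sqrt hlam.le h0).1 hp.2

theorem planck_bounds {lam : ℝ} (hlam : 0 < lam) {p : ℝ × ℝ} (hp : lam ^ 2 ≤ sqNorm p) :
    0 < planck p ∧ planck p ≤ 1 / (Real.exp (lam ^ 2) - 1) := by
  have h1 : 1 < Real.exp (lam ^ 2) := Real.one_lt_exp_iff.2 (by positivity)
  have h2 : Real.exp (lam ^ 2) ≤ Real.exp (sqNorm p) := Real.exp_le_exp.2 hp
  refine ⟨one_div_pos.2 (by linarith), ?_⟩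
  exact one_div_le_one_div_of_le (by linarith) (by linarith)

theorem ratio_eq {lam : ℝ} (hlam : 0 < lam) {p : ℝ × ℝ} (hp : lam ^ 2 ≤ sqNorm p) :
    planck p / (1 + planck p) = Real.exp (-sqNorm p) := by
  have h1 : 1 < Real.exp (sqNorm p) :=
    Real.one_lt_exp_iff.2 (lt_of_lt_of_le (by positivity) hp)
  have h2 : Real.exp (sqNorm p) - 1 ≠ 0 := by linarith
  have h3 : Real.exp (sqNorm p) ≠ 0 := (Real.exp_pos _).ne'
  rw [Real.exp_neg]
  unfold planck
  have h4 : 1 + 1 / (Real.exp (sqNorm p) - 1) =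
      Real.exp (sqNorm p) / (Real.exp (sqNorm p) - 1) := by field_simp; ring
  rw [h4]
  field_simp

theorem isFiniteMeasure_mu {lam : ℝ} (hlam : 0 < lam) : IsFiniteMeasure (mu lam) := by
  have hx : Integrable (fun x : ℝ => Real.exp (-x ^ 2)) := by
    simpa using integrable_exp_neg_mul_sq (b := 1) one_pos
  have hr : Integrable (fun r : ℝ => 2 * Real.pi * (r * Real.exp (-r ^ 2))) := by
    have := (integrable_mul_exp_neg_mul_sq (b := 1) one_pos).const_mul (2 * Real.pi)
    simpa using this
  have hprod : Integrable (fun p : ℝ × ℝ =>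
      Real.exp (-p.1 ^ 2) * (2 * Real.pi * (p.2 * Real.exp (-p.2 ^ 2)))) := hx.mul_prod hr
  have hm : Measurable (fun p : ℝ × ℝ => ENNReal.ofReal (2 * Real.pi * p.2)) := by fun_prop
  constructor
  unfold mu
  rw [withDensity_apply _ MeasurableSet.univ, Measure.restrict_univ]
  have hae : (fun p => ENNReal.ofReal (planck p / (1 + planck p))) =ᵐ[dp lam]
      (fun p => ENNReal.ofReal (Real.exp (-sqNorm p))) := by
    filter_upwards [ae_dp lam] with p hp
    rw [ratio_eq hlam (sq_le_sqNorm hlam hp)]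
  rw [lintegral_congr_ae hae]
  have hm2 : Measurable (fun p : ℝ × ℝ => ENNReal.ofReal (Real.exp (-sqNorm p))) := by
    have := measurable_sqNorm
    fun_prop
  unfold dp
  rw [lintegral_withDensity_eq_lintegral_mul _ hm hm2]
  refine lt_of_le_of_lt (lintegral_mono' Measure.restrict_le_self ?_)
    hprod.hasFiniteIntegral
  intro p
  simp only [Pi.mul_apply]
  rw [← ENNReal.ofReal_mul' (Real.exp_pos _).le, ← ofReal_norm]
  apply ENNReal.ofReal_le_ofReal
  refine le_trans (le_of_eq ?_) (le_abs_self _)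
  have : -sqNorm p = -p.1 ^ 2 + -p.2 ^ 2 := by unfold sqNorm; ring
  rw [this, Real.exp_add]
  ring

/-- `P f dp = (1 + P) f P/(1+P) dp`. -/
theorem integral_planck_mul {lam : ℝ} (hlam : 0 < lam) (c f : ℝ × ℝ → ℝ) :
    ∫ q, c q * (planck q * f q) ∂(dp lam)
      = ∫ q, (c q * (1 + planck q)) * f q ∂(mu lam) := by
  have hm : Measurable (fun q : ℝ × ℝ => (planck q / (1 + planck q)).toNNReal) := by
    have := measurable_planck
    fun_prop
  have h := integral_withDensity_eq_integral_smul (μ := dp lam) hm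
    (fun q => (c q * (1 + planck q)) * f q)
  refine Eq.trans (integral_congr_ae ?_) h.symm
  filter_upwards [ae_dp lam] with q hq
  have hp := (planck_bounds hlam (sq_le_sqNorm hlam hq)).1
  have h1 : (1 + planck q) ≠ 0 := by positivity
  rw [NNReal.smul_def, Real.coe_toNNReal _ (by positivity), smul_eq_mul]
  field_simp

theorem deltaInt_mul (lam a b : ℝ) (c : ℝ × ℝ → ℝ) (y z : ℝ) :
    deltaInt lam a b (fun r => c r * y * z) = deltaInt lam a b c * (y * z) := by
  unfold deltaInt
  split_ifs <;> ring

theorem measurable_deltaInt (lam : ℝ) {a b : ℝ × ℝ → ℝ} {c : ℝ × ℝ → ℝ}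
    (ha : Measurable a) (hb : Measurable b) (hc : Measurable c) :
    Measurable (fun q => deltaInt lam (a q) (b q) c) := by
  unfold deltaInt
  refine Measurable.ite ?_ ?_ measurable_const
  · exact (measurableSet_lt (by fun_prop) hb).inter (measurableSet_le measurable_const hb)
  · fun_prop

theorem abs_deltaInt_le (lam a b : ℝ) {c : ℝ × ℝ → ℝ} {C : ℝ} (hC : 0 ≤ C)
    (hc : ∀ r, lam ^ 2 ≤ sqNorm r → |c r| ≤ C) :
    |deltaInt lam a b c| ≤ Real.pi * C := by
  unfold deltaInt
  split_ifs with h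
  · rw [abs_mul, abs_of_pos Real.pi_pos]
    refine mul_le_mul_of_nonneg_left (hc _ ?_) Real.pi_pos.le
    have : sqNorm (a, Real.sqrt (b - a ^ 2)) = b := by
      unfold sqNorm
      rw [Real.sq_sqrt (by linarith [h.1])]
      ring
    rw [this]
    exact h.2
  · simpa using mul_nonneg Real.pi_pos.le hC

/-- The three integral kernels of `K`, with respect to `mu`. -/
noncomputable def kernelAux (lam : ℝ) (p : ℝ × ℝ) (q : ℝ × ℝ) : ℝ :=
  (deltaInt lam (p.1 - q.1) (sqNorm p - sqNorm q) (fun r => planck r - planck p)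
    + deltaInt lam (q.1 - p.1) (sqNorm q - sqNorm p) (fun r => 1 + planck p + planck r)
    + deltaInt lam (p.1 + q.1) (sqNorm p + sqNorm q) (fun r => planck r - planck p))
    * (1 + planck q)

theorem bdd_aux {lam : ℝ} (hlam : 0 < lam) {a b c : ℝ × ℝ → ℝ} (ha : Measurable a)
    (hb : Measurable b) (hc : Measurable c) {C : ℝ} (hC : 0 ≤ C)
    (hcC : ∀ r, lam ^ 2 ≤ sqNorm r → |c r| ≤ C) :
    Measurable (fun q => deltaInt lam (a q) (b q) c * (1 + planck q)) ∧
    ∀ᵐ q ∂(mu lam), ‖deltaInt lam (a q) (b q) c * (1 + planck q)‖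
      ≤ Real.pi * C * (1 + 1 / (Real.exp (lam ^ 2) - 1)) := by
  refine ⟨(measurable_deltaInt lam ha hb hc).mul (measurable_planck.const_add 1), ?_⟩
  have hae : ∀ᵐ q ∂(mu lam), q ∈ cutDomain lam :=
    (withDensity_absolutelyContinuous _ _).ae_le (ae_dp lam)
  filter_upwards [hae] with q hq
  obtain ⟨h1, h2⟩ := planck_bounds hlam (sq_le_sqNorm hlam hq)
  rw [norm_mul, Real.norm_eq_abs, Real.norm_eq_abs, abs_of_pos (by linarith : 0 < 1 + planck q)]
  exact mul_le_mul (abs_deltaInt_le lam _ _ hC hcC) (by linarith) (by linarith)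
    (mul_nonneg Real.pi_pos.le hC)

/-- `K f(p) = (2n / P(p)) ∫ k(p,q) f(q) P/(1+P)(q) dq` with a kernel that is bounded in `q`. -/
theorem opK_eq {lam : ℝ} (hlam : 0 < lam) (p : ℝ × ℝ) :
    (∃ C, AEStronglyMeasurable (kernelAux lam p) (mu lam) ∧
      ∀ᵐ q ∂(mu lam), ‖kernelAux lam p q‖ ≤ C) ∧
    ∀ (n : ℝ) (f : ℝ × ℝ → ℝ), Integrable f (mu lam) →
      opK n lam f p = 2 * n / planck p * ∫ q, kernelAux lam p q * f q ∂(mu lam) := by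
  set B := 1 / (Real.exp (lam ^ 2) - 1) with hB
  have hB0 : 0 ≤ B := by
    have := Real.one_lt_exp_iff.2 (by positivity : 0 < lam ^ 2)
    exact one_div_nonneg.2 (by linarith)
  have hP : ∀ r, lam ^ 2 ≤ sqNorm r → |planck r| ≤ B := by
    intro r hr
    obtain ⟨h1, h2⟩ := planck_bounds hlam hr
    rw [abs_of_pos h1]
    exact h2
  have hs := measurable_sqNorm
  have hpl := measurable_planck
  have hC0 : 0 ≤ 1 + |planck p| + B := by positivity
  have hc1 : ∀ r, lam ^ 2 ≤ sqNorm r → |planck r - planck p| ≤ 1 + |planck p| + B := by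
    intro r hr
    have := abs_sub (planck r) (planck p)
    linarith [hP r hr]
  have hc2 : ∀ r, lam ^ 2 ≤ sqNorm r → |1 + planck p + planck r| ≤ 1 + |planck p| + B := by
    intro r hr
    have h1 := abs_add_le (1 + planck p) (planck r)
    have h2 := abs_add_le 1 (planck p)
    rw [abs_one] at h2
    linarith [hP r hr]
  have b1 := bdd_aux hlam (a := fun q => p.1 - q.1) (b := fun q => sqNorm p - sqNorm q)
    (c := fun r => planck r - planck p) (by fun_prop) (by fun_prop) (by fun_prop) hC0 hc1
  have b2 := bdd_aux hlam (a := fun q => q.1 - p.1) (b := fun q => sqNorm q - sqNorm p)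
    (c := fun r => 1 + planck p + planck r) (by fun_prop) (by fun_prop) (by fun_prop) hC0 hc2
  have b3 := bdd_aux hlam (a := fun q => p.1 + q.1) (b := fun q => sqNorm p + sqNorm q)
    (c := fun r => planck r - planck p) (by fun_prop) (by fun_prop) (by fun_prop) hC0 hc1
  have hk : kernelAux lam p = fun q =>
      deltaInt lam (p.1 - q.1) (sqNorm p - sqNorm q) (fun r => planck r - planck p)
        * (1 + planck q)
      + deltaInt lam (q.1 - p.1) (sqNorm q - sqNorm p) (fun r => 1 + planck p + planck r)
        * (1 + planck q)
      + deltaInt lam (p.1 + q.1) (sqNorm p + sqNorm q) (fun r => planck r - planck p)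
        * (1 + planck q) := by
    funext q
    unfold kernelAux
    ring
  refine ⟨⟨Real.pi * (1 + |planck p| + B) * (1 + B) + Real.pi * (1 + |planck p| + B) * (1 + B)
      + Real.pi * (1 + |planck p| + B) * (1 + B), ?_, ?_⟩, ?_⟩
  · rw [hk]
    exact ((b1.1.add b2.1).add b3.1).aestronglyMeasurable
  · filter_upwards [b1.2, b2.2, b3.2] with q h1 h2 h3
    rw [hk]
    exact (norm_add₃_le).trans (add_le_add (add_le_add h1 h2) h3)
  · intro n f hf
    have i1 := hf.bdd_mul b1.1.aestronglyMeasurable b1.2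
    have i2 := hf.bdd_mul b2.1.aestronglyMeasurable b2.2
    have i3 := hf.bdd_mul b3.1.aestronglyMeasurable b3.2
    unfold opK decayInt mergeInt₁ mergeInt₃ kernelAux
    simp only [deltaInt_mul, integral_planck_mul hlam]
    have e := integral_add (i1.add i2) i3
    simp only [Pi.add_apply] at e
    rw [← integral_add i1 i2, ← e]
    congr 2
    funext q
    ring

theorem opL_congr {n lam : ℝ} (hlam : 0 < lam) {f g : ℝ × ℝ → ℝ}
    (hf : Integrable f (mu lam)) (hg : Integrable g (mu lam)) (hfg : f =ᵐ[mu lam] g) :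
    opL n lam f =ᵐ[mu lam] opL n lam g := by
  filter_upwards [hfg] with p hp
  unfold opL
  rw [(opK_eq hlam p).2 n f hf, (opK_eq hlam p).2 n g hg, hp]
  congr 2
  refine integral_congr_ae ?_
  filter_upwards [hfg] with q hq
  rw [hq]

theorem opL_add {n lam : ℝ} (hlam : 0 < lam) {f g : ℝ × ℝ → ℝ}
    (hf : Integrable f (mu lam)) (hg : Integrable g (mu lam)) (p : ℝ × ℝ) :
    opL n lam (f + g) p = opL n lam f p + opL n lam g p := by
  obtain ⟨⟨C, hm, hC⟩, h⟩ := opK_eq hlam p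
  unfold opL
  rw [h n f hf, h n g hg, h n (f + g) (hf.add hg)]
  simp only [Pi.add_apply, mul_add]
  rw [integral_add (hf.bdd_mul hm hC) (hg.bdd_mul hm hC)]
  ring

theorem opL_smul {n lam : ℝ} (hlam : 0 < lam) (c : ℝ) {f : ℝ × ℝ → ℝ}
    (hf : Integrable f (mu lam)) (p : ℝ × ℝ) :
    opL n lam (c • f) p = c * opL n lam f p := by
  obtain ⟨-, h⟩ := opK_eq hlam p
  unfold opL
  rw [h n f hf, h n (c • f) (hf.smul c)]
  have : (fun q => kernelAux lam p q * (c • f) q) = fun q => c * (kernelAux lam p q * f q) := by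
    funext q
    simp only [Pi.smul_apply, smul_eq_mul]
    ring
  rw [this, integral_const_mul, Pi.smul_apply, smul_eq_mul]
  ring

theorem integrable_Lp {lam : ℝ} (hlam : 0 < lam) (f : Lp ℝ 2 (mu lam)) :
    Integrable f (mu lam) := by
  have := isFiniteMeasure_mu hlam
  exact (Lp.memLp f).integrable (by norm_num)

/-- The kernel of `L` in `L²_{P/(1+P)}`: all `f` with `L f = 0` almost everywhere. -/
noncomputable def kerL (n lam : ℝ) (hlam : 0 < lam) : Submodule ℝ (Lp ℝ 2 (mu lam)) where
  carrier := {f | ∀ᵐ p ∂(mu lam), opL n lam f p = 0}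
  zero_mem' := by
    have h0 := opL_smul (n := n) hlam 0 (integrable_Lp hlam 0)
    have h1 := opL_congr (n := n) hlam (integrable_Lp hlam 0)
      ((integrable_Lp hlam 0).smul (0 : ℝ))
      (by filter_upwards [Lp.coeFn_zero ℝ 2 (mu lam)] with p hp; rw [Pi.smul_apply, zero_smul]; exact hp)
    filter_upwards [h1] with p hp
    rw [hp, h0, zero_mul]
  add_mem' := by
    intro f g hf hg
    filter_upwards [hf, hg, opL_congr (n := n) hlam (integrable_Lp hlam (f + g))
      ((integrable_Lp hlam f).add (integrable_Lp hlam g)) (Lp.coeFn_add f g)] with p h1 h2 h3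
    rw [h3, opL_add hlam (integrable_Lp hlam f) (integrable_Lp hlam g), h1, h2, add_zero]
  smul_mem' := by
    intro c f hf
    filter_upwards [hf, opL_congr (n := n) hlam (integrable_Lp hlam (c • f))
      ((integrable_Lp hlam f).smul c) (Lp.coeFn_smul c f)] with p h1 h2
    rw [h2, opL_smul hlam c (integrable_Lp hlam f), h1, mul_zero]

theorem isClosed_kerL (n lam : ℝ) (hlam : 0 < lam) :
    IsClosed (kerL n lam hlam : Set (Lp ℝ 2 (mu lam))) := by
  have := isFiniteMeasure_mu hlam
  refine IsSeqClosed.isClosed ?_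
  intro u f hu huf
  have hL2 : Tendsto (fun k => eLpNorm (⇑(u k) - ⇑f) 2 (mu lam)) atTop (𝓝 0) :=
    (Lp.tendsto_Lp_iff_tendsto_eLpNorm' u f).1 huf
  have hL1 : Tendsto (fun k => eLpNorm (⇑(u k) - ⇑f) 1 (mu lam)) atTop (𝓝 0) := by
    have hb : ∀ k, eLpNorm (⇑(u k) - ⇑f) 1 (mu lam) ≤
        eLpNorm (⇑(u k) - ⇑f) 2 (mu lam) * (mu lam Set.univ) ^ (1 / 2 : ℝ) := by
      intro k
      have := eLpNorm_le_eLpNorm_mul_rpow_measure_univ (μ := mu lam) (p := 1) (q := 2)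
        (f := ⇑(u k) - ⇑f) (by norm_num)
        ((Lp.aestronglyMeasurable (u k)).sub (Lp.aestronglyMeasurable f))
      refine this.trans (le_of_eq ?_)
      norm_num
    have ht := ENNReal.Tendsto.mul_const (b := (mu lam Set.univ) ^ (1 / 2 : ℝ)) hL2
      (Or.inr (ENNReal.rpow_ne_top_of_nonneg (by norm_num) (measure_ne_top _ _)))
    rw [zero_mul] at ht
    exact tendsto_of_tendsto_of_tendsto_of_le_of_le tendsto_const_nhds ht
      (fun _ => zero_le) hb
  obtain ⟨ns, hns, hae⟩ := (tendstoInMeasure_of_tendsto_eLpNorm (p := 2) (by norm_num)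
    (fun k => Lp.aestronglyMeasurable (u k)) (Lp.aestronglyMeasurable f)
    hL2).exists_seq_tendsto_ae
  have hzero : ∀ᵐ p ∂(mu lam), ∀ k, opL n lam (u k) p = 0 := ae_all_iff.2 hu
  change ∀ᵐ p ∂(mu lam), opL n lam f p = 0
  filter_upwards [hae, hzero] with p hp hz
  obtain ⟨⟨C, hm, hC⟩, h⟩ := opK_eq hlam p
  have hK : Tendsto (fun k => ∫ q, kernelAux lam p q * u (ns k) q ∂(mu lam)) atTop
      (𝓝 (∫ q, kernelAux lam p q * f q ∂(mu lam))) := by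
    have hd : Tendsto (fun k => C * (eLpNorm (⇑(u (ns k)) - ⇑f) 1 (mu lam)).toReal) atTop
        (𝓝 0) := by
      have := (ENNReal.tendsto_toReal ENNReal.zero_ne_top).comp (hL1.comp hns.tendsto_atTop)
      simpa using this.const_mul C
    rw [tendsto_iff_norm_sub_tendsto_zero]
    refine squeeze_zero (fun _ => norm_nonneg _) (fun k => ?_) hd
    have i1 := (integrable_Lp hlam (u (ns k))).bdd_mul hm hC
    have i2 := (integrable_Lp hlam f).bdd_mul hm hC
    have i3 := (integrable_Lp hlam (u (ns k))).sub (integrable_Lp hlam f)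
    rw [← integral_sub i1 i2, eLpNorm_one_eq_lintegral_enorm,
      ← integral_norm_eq_lintegral_enorm i3.1, ← integral_const_mul]
    refine norm_integral_le_of_norm_le (i3.norm.const_mul C) ?_
    filter_upwards [hC] with q hq
    rw [← mul_sub, norm_mul]
    exact mul_le_mul_of_nonneg_right hq (norm_nonneg _)
  have hlim : Tendsto (fun k => opL n lam (u (ns k)) p) atTop (𝓝 (opL n lam f p)) := by
    unfold opL
    simp only [h n _ (integrable_Lp hlam _)]
    exact (hK.const_mul _).sub (hp.const_mul _)
  simp only [hz] at hlim
  exact tendsto_nhds_unique hlim tendsto_const_nhds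

instance completeSpace_kerL (n lam : ℝ) (hlam : 0 < lam) :
    CompleteSpace (kerL n lam hlam) :=
  (isClosed_kerL n lam hlam).completeSpace_coe

/-- The orthogonal projection `P̃` of `L²_{P/(1+P)}` onto `ker L`. -/
noncomputable def projKer (n lam : ℝ) (hlam : 0 < lam) :
    Lp ℝ 2 (mu lam) →L[ℝ] Lp ℝ 2 (mu lam) :=
  (kerL n lam hlam).starProjection

end Milne

/-! The proof works in the coordinates `z = (p_x, E)`, `E = |p|²`, in which `dp` is `π` times the
Lebesgue measure on `region lam = {p_x² < E, lam² ≤ E}` (`measurePreserving_flat`) and a collision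
`p = p₂ + p₃` is the addition of vectors of the plane. With `f = (1 + P) g` and the symmetric weight
`b(p₂, p₃) = (1 + P(p₂ + p₃)) P(p₂) P(p₃)` (`bker`), the identities satisfied by the Planckian turn
`-(Lf, f)` into a multiple of the entropy dissipation
`∫∫ b(p₂, p₃) (g(p₂ + p₃) - g(p₂) - g(p₃))²` (`collForm_eq`, `integral_opL_mul`), which is
nonnegative and does not change when a combination of `|p|²` and `p_x` is added to `g`.

*Kernel.* If `Lf = 0`, then `ν f² = (Kf) f` is integrable, since `K` is bounded on `L²`; hence the
dissipation is finite and vanishes, and `g` is additive under almost every collision. Averaging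
this relation over one collision partner of large energy makes `g` smooth
(`AEAdditive.exists_smooth`), and differentiating it makes the gradient of `g` constant, so that
`g = a |p|² + b p_x` (`AEAdditive.exists_eq_linear`). That these functions are in the kernel is a
change of variables in the integrals (`kap_invariant`).

*Spectral gap.* Explicit boxes of collision partners give `ν ≥ c (1 + |p|)³` (`exists_le_freq`).
In the normalization `u = √ν f` the form is `‖u‖² - (Tu, u)`. Up to a
product kernel, `T` is dominated by the convolution with `exp(-E/2)` on `region lam` and its
transpose, times `ν(p)^(-1/2) ν(q)^(-1/2)`; the growth of `ν` makes this square integrable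
(`integrable_symKernel_sq`). So `u ↦ (Tu, u)` is weakly sequentially continuous
(`tendsto_kernelForm`), and a sequence of unit vectors orthogonal to the kernel along which the form
tends to zero would have as weak limit a unit vector of the kernel orthogonal to the kernel
(`exists_gap_of_sq_integrable_kernel`). -/

namespace Milne

/-! ### Coercivity of identity minus a square integrable kernel -/

section Gap

open scoped RealInnerProductSpace

variable {X : Type*} [MeasurableSpace X] {m : Measure X}

/-- Bounded sequences of a separable real Hilbert space have weakly convergent subsequences. -/
theorem exists_weak_limit {H : Type*} [NormedAddCommGroup H] [InnerProductSpace ℝ H]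
    [CompleteSpace H] [TopologicalSpace.SeparableSpace H] (v : ℕ → H) (hv : ∀ k, ‖v k‖ ≤ 1) :
    ∃ V : H, ‖V‖ ≤ 1 ∧ ∃ φ : ℕ → ℕ, StrictMono φ ∧
      ∀ y : H, Tendsto (fun k => ⟪v (φ k), y⟫) atTop (𝓝 ⟪V, y⟫) := by
  have hc := WeakDual.isSeqCompact_closedBall ℝ H 0 1
  have hmem : ∀ k, StrongDual.toWeakDual (InnerProductSpace.toDual ℝ H (v k)) ∈
      (WeakDual.toStrongDual ⁻¹' Metric.closedBall (0 : StrongDual ℝ H) 1) := by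
    intro k
    simpa using hv k
  obtain ⟨a, ha, φ, hφ, hlim⟩ := hc hmem
  refine ⟨(InnerProductSpace.toDual ℝ H).symm (WeakDual.toStrongDual a), ?_, φ, hφ, ?_⟩
  · simpa using ha
  · intro y
    have h := ((WeakDual.eval_continuous (𝕜 := ℝ) y).tendsto a).comp hlim
    rw [InnerProductSpace.toDual_symm_apply]
    refine Tendsto.congr (fun k => ?_) h
    exact InnerProductSpace.toDual_apply_apply

/-- `∫ t(x,y) u(y) dy`. -/
noncomputable def kernelMap (m : Measure X) (t : X × X → ℝ) (u : X → ℝ) (x : X) : ℝ :=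
  ∫ y, t (x, y) * u y ∂m

/-- `∫∫ t(x,y) u(x) u(y) dx dy`. -/
noncomputable def kernelForm (m : Measure X) (t : X × X → ℝ) (u : X → ℝ) : ℝ :=
  ∫ z, t z * (u z.1 * u z.2) ∂(m.prod m)

variable {t : X × X → ℝ}

theorem integrable_kernelForm (htm : Measurable t)
    (ht : Integrable (fun z => t z ^ 2) (m.prod m)) {u v : X → ℝ} (hu : MemLp u 2 m)
    (hv : MemLp v 2 m) : Integrable (fun z : X × X => t z * (u z.1 * v z.2)) (m.prod m) := by
  have h1 : MemLp t 2 (m.prod m) :=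
    (memLp_two_iff_integrable_sq htm.aestronglyMeasurable).2 ht
  have h2 : MemLp (fun z : X × X => u z.1 * v z.2) 2 (m.prod m) := by
    refine (memLp_two_iff_integrable_sq (hu.1.comp_fst.mul hv.1.comp_snd)).2 ?_
    have := hu.integrable_sq.mul_prod hv.integrable_sq
    simpa [mul_pow] using this
  exact h1.integrable_mul h2

theorem sq_integral_mul_le {a u : X → ℝ} (ha : MemLp a 2 m) (hu : MemLp u 2 m) :
    (∫ y, a y * u y ∂m) ^ 2 ≤ (∫ y, a y ^ 2 ∂m) * ∫ y, u y ^ 2 ∂m := by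
  have h := real_inner_mul_inner_self_le (ha.toLp a) (hu.toLp u)
  simp only [L2.inner_def] at h
  have e : ∀ {b c : X → ℝ} (hb : MemLp b 2 m) (hc : MemLp c 2 m),
      ∫ y, inner ℝ (hb.toLp b y) (hc.toLp c y) ∂m = ∫ y, b y * c y ∂m := by
    intro b c hb hc
    refine integral_congr_ae ?_
    filter_upwards [hb.coeFn_toLp, hc.coeFn_toLp] with y h1 h2
    rw [h1, h2]
    simp [mul_comm]
  rw [e, e, e] at h
  simpa [sq] using h

theorem inner_eq_integral (U V : Lp ℝ 2 m) : ⟪U, V⟫ = ∫ y, V y * U y ∂m := by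
  rw [L2.inner_def]
  simp

theorem norm_sq_eq_integral (U : Lp ℝ 2 m) : ‖U‖ ^ 2 = ∫ y, U y ^ 2 ∂m := by
  rw [← real_inner_self_eq_norm_sq, inner_eq_integral]
  simp [sq]

theorem kernelForm_congr {u v : X → ℝ} (h : u =ᵐ[m] v) :
    kernelForm m t u = kernelForm m t v := by
  refine integral_congr_ae ?_
  filter_upwards [Measure.quasiMeasurePreserving_fst.ae h,
    Measure.quasiMeasurePreserving_snd.ae h] with z h1 h2
  rw [h1, h2]

variable [SigmaFinite m]

theorem ae_memLp_section (htm : Measurable t)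
    (ht : Integrable (fun z => t z ^ 2) (m.prod m)) :
    ∀ᵐ x ∂m, MemLp (fun y => t (x, y)) 2 m := by
  filter_upwards [ht.prod_right_ae] with x hx
  exact (memLp_two_iff_integrable_sq
    (htm.comp measurable_prodMk_left).aestronglyMeasurable).2 hx

theorem memLp_kernelMap (htm : Measurable t)
    (ht : Integrable (fun z => t z ^ 2) (m.prod m)) {u : X → ℝ} (hu : MemLp u 2 m) :
    MemLp (kernelMap m t u) 2 m ∧
      ∀ᵐ x ∂m, kernelMap m t u x ^ 2 ≤ (∫ y, t (x, y) ^ 2 ∂m) * ∫ y, u y ^ 2 ∂m := by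
  have hb : ∀ᵐ x ∂m, kernelMap m t u x ^ 2 ≤ (∫ y, t (x, y) ^ 2 ∂m) * ∫ y, u y ^ 2 ∂m := by
    filter_upwards [ae_memLp_section htm ht] with x hx
    exact sq_integral_mul_le hx hu
  refine ⟨?_, hb⟩
  have hmeas : AEStronglyMeasurable (kernelMap m t u) m :=
    (htm.aestronglyMeasurable.mul hu.1.comp_snd).integral_prod_right'
  refine (memLp_two_iff_integrable_sq hmeas).2 ?_
  refine (ht.integral_prod_left.mul_const (∫ y, u y ^ 2 ∂m)).mono' (hmeas.pow 2) ?_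
  filter_upwards [hb] with x hx
  rwa [Real.norm_eq_abs, abs_of_nonneg (sq_nonneg _)]

theorem kernelForm_eq (htm : Measurable t)
    (ht : Integrable (fun z => t z ^ 2) (m.prod m)) {u : X → ℝ} (hu : MemLp u 2 m) :
    kernelForm m t u = ∫ x, kernelMap m t u x * u x ∂m := by
  unfold kernelForm
  rw [integral_prod _ (integrable_kernelForm htm ht hu hu)]
  refine integral_congr_ae (Eventually.of_forall fun x => ?_)
  simp only [kernelMap]
  rw [← integral_mul_const]
  congr 1
  funext y
  ring

/-- A square integrable kernel turns weak convergence into strong convergence, so its quadratic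
form is weakly sequentially continuous. -/
theorem tendsto_kernelForm (htm : Measurable t)
    (ht : Integrable (fun z => t z ^ 2) (m.prod m)) {v : ℕ → Lp ℝ 2 m} {V : Lp ℝ 2 m}
    (hv : ∀ k, ‖v k‖ ≤ 1) (hV : ‖V‖ ≤ 1)
    (hw : ∀ y, Tendsto (fun k => ⟪v k, y⟫) atTop (𝓝 ⟪V, y⟫)) :
    Tendsto (fun k => kernelForm m t (v k)) atTop (𝓝 (kernelForm m t V)) := by
  have hT : ∀ U : Lp ℝ 2 m, MemLp (kernelMap m t U) 2 m := fun U =>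
    (memLp_kernelMap htm ht (Lp.memLp U)).1
  have hform : ∀ U : Lp ℝ 2 m, kernelForm m t U = ⟪U, (hT U).toLp _⟫ := by
    intro U
    rw [kernelForm_eq htm ht (Lp.memLp U), inner_eq_integral]
    refine integral_congr_ae ?_
    filter_upwards [(hT U).coeFn_toLp] with x hx
    rw [hx]
  have hpt : ∀ᵐ x ∂m, Tendsto (fun k => kernelMap m t (v k) x) atTop
      (𝓝 (kernelMap m t V x)) := by
    filter_upwards [ae_memLp_section htm ht] with x hx
    have e : ∀ U : Lp ℝ 2 m, kernelMap m t U x = ⟪U, hx.toLp _⟫ := by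
      intro U
      rw [inner_eq_integral]
      refine integral_congr_ae ?_
      filter_upwards [hx.coeFn_toLp] with y hy
      rw [hy]
    simp only [e]
    exact hw _
  have hle : ∀ U : Lp ℝ 2 m, ‖U‖ ≤ 1 →
      ∀ᵐ x ∂m, kernelMap m t U x ^ 2 ≤ ∫ y, t (x, y) ^ 2 ∂m := by
    intro U hU
    filter_upwards [(memLp_kernelMap htm ht (Lp.memLp U)).2] with x hx
    refine hx.trans (mul_le_of_le_one_right (integral_nonneg fun _ => sq_nonneg _) ?_)
    rw [← norm_sq_eq_integral]
    exact pow_le_one₀ (norm_nonneg _) hU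
  have hdiff : Tendsto (fun k => ‖(hT (v k)).toLp _ - (hT V).toLp _‖ ^ 2) atTop (𝓝 0) := by
    have e : ∀ k, ‖(hT (v k)).toLp _ - (hT V).toLp _‖ ^ 2
        = ∫ x, (kernelMap m t (v k) x - kernelMap m t V x) ^ 2 ∂m := by
      intro k
      rw [norm_sq_eq_integral]
      refine integral_congr_ae ?_
      filter_upwards [Lp.coeFn_sub ((hT (v k)).toLp _) ((hT V).toLp _), (hT (v k)).coeFn_toLp,
        (hT V).coeFn_toLp] with x h1 h2 h3
      rw [h1, Pi.sub_apply, h2, h3]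
    simp only [e]
    have h0 : (0 : ℝ) = ∫ _x : X, (0 : ℝ) ∂m := by simp
    rw [h0]
    refine tendsto_integral_of_dominated_convergence (fun x => 4 * ∫ y, t (x, y) ^ 2 ∂m)
      (fun k => (((hT (v k)).1.sub (hT V).1).pow 2)) (ht.integral_prod_left.const_mul 4) ?_ ?_
    · intro k
      filter_upwards [hle _ (hv k), hle _ hV] with x h1 h2
      rw [Real.norm_eq_abs, abs_of_nonneg (sq_nonneg _)]
      nlinarith [sq_nonneg (kernelMap m t (v k) x + kernelMap m t V x)]
    · filter_upwards [hpt] with x hx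
      have := (hx.sub_const (kernelMap m t V x)).pow 2
      simpa using this
  have hdiff' : Tendsto (fun k => ‖(hT (v k)).toLp _ - (hT V).toLp _‖) atTop (𝓝 0) := by
    have := hdiff.sqrt
    simpa [Real.sqrt_sq] using this
  simp only [hform]
  have h1 : Tendsto (fun k => ⟪v k, (hT (v k)).toLp _ - (hT V).toLp _⟫) atTop (𝓝 0) := by
    refine squeeze_zero_norm (fun k => ?_) hdiff'
    refine (norm_inner_le_norm _ _).trans ?_
    exact mul_le_of_le_one_left (norm_nonneg _) (hv k)
  have h2 := h1.add (hw ((hT V).toLp _))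
  rw [zero_add] at h2
  refine h2.congr fun k => ?_
  rw [← inner_add_right, sub_add_cancel]

/-- Let `q(u) = ∫ u² - ∫∫ t u u` with a square integrable kernel `t`. If `q ≥ 0` and `q` is
strictly positive on the nonzero vectors orthogonal to the `e i`, then `q` is coercive on these
vectors. -/
theorem exists_gap_of_sq_integrable_kernel [MeasurableSpace.CountablyGenerated X]
    (htm : Measurable t)
    (ht : Integrable (fun z => t z ^ 2) (m.prod m)) {ι : Type*} {e : ι → X → ℝ}
    (he : ∀ i, MemLp (e i) 2 m)
    (hnn : ∀ u : X → ℝ, Measurable u → MemLp u 2 m → kernelForm m t u ≤ ∫ x, u x ^ 2 ∂m)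
    (hpos : ∀ u : X → ℝ, Measurable u → MemLp u 2 m → (∀ i, ∫ x, e i x * u x ∂m = 0) →
      kernelForm m t u = ∫ x, u x ^ 2 ∂m → ∫ x, u x ^ 2 ∂m = 0) :
    ∃ c : ℝ, 0 < c ∧ ∀ u : X → ℝ, MemLp u 2 m → (∀ i, ∫ x, e i x * u x ∂m = 0) →
      c * ∫ x, u x ^ 2 ∂m ≤ ∫ x, u x ^ 2 ∂m - kernelForm m t u := by
  by_contra! hcon
  have hcon' : ∀ k : ℕ, ∃ U : Lp ℝ 2 m, ‖U‖ ≤ 1 ∧ 1 - 1 / ((k : ℝ) + 1) ≤ kernelForm m t U ∧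
      ∀ i, ⟪U, (he i).toLp _⟫ = 0 := by
    intro k
    obtain ⟨u, hu, hue, huq⟩ := hcon (1 / ((k : ℝ) + 1)) (by positivity)
    have hN : ∫ x, u x ^ 2 ∂m ≠ 0 := by
      intro h0
      have hz : u =ᵐ[m] 0 := by
        have := (integral_eq_zero_iff_of_nonneg (fun x => sq_nonneg (u x))
          hu.integrable_sq).1 h0
        filter_upwards [this] with x hx
        simpa using hx
      rw [kernelForm_congr hz, h0] at huq
      simp [kernelForm] at huq
    have hN0 : 0 < ∫ x, u x ^ 2 ∂m :=
      lt_of_le_of_ne (integral_nonneg fun _ => sq_nonneg _) (Ne.symm hN)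
    set N := ∫ x, u x ^ 2 ∂m with hNdef
    have hs : 0 < Real.sqrt N := Real.sqrt_pos.2 hN0
    have hu' : MemLp (fun x => (Real.sqrt N)⁻¹ * u x) 2 m := hu.const_mul _
    have hform : kernelForm m t (fun x => (Real.sqrt N)⁻¹ * u x) = N⁻¹ * kernelForm m t u := by
      unfold kernelForm
      rw [← integral_const_mul]
      congr 1
      funext z
      have : N⁻¹ = (Real.sqrt N)⁻¹ * (Real.sqrt N)⁻¹ := by
        rw [← mul_inv, Real.mul_self_sqrt hN0.le]
      rw [this]
      ring
    refine ⟨hu'.toLp _, ?_, ?_, ?_⟩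
    · have h1 : ‖hu'.toLp _‖ ^ 2 = 1 := by
        rw [norm_sq_eq_integral]
        calc ∫ y, (hu'.toLp _ y) ^ 2 ∂m = ∫ y, N⁻¹ * u y ^ 2 ∂m := by
              refine integral_congr_ae ?_
              filter_upwards [hu'.coeFn_toLp] with x hx
              rw [hx, mul_pow, inv_pow, Real.sq_sqrt hN0.le]
          _ = 1 := by rw [integral_const_mul]; exact inv_mul_cancel₀ hN
      exact (pow_le_one_iff_of_nonneg (norm_nonneg _) two_ne_zero).1 h1.le
    · rw [kernelForm_congr hu'.coeFn_toLp, hform]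
      have h2 : N * (1 - 1 / ((k : ℝ) + 1)) ≤ kernelForm m t u := by linarith
      rw [inv_mul_eq_div, le_div_iff₀ hN0]
      linarith
    · intro i
      rw [inner_eq_integral]
      calc ∫ y, (he i).toLp _ y * hu'.toLp _ y ∂m
          = ∫ y, (Real.sqrt N)⁻¹ * (e i y * u y) ∂m := by
            refine integral_congr_ae ?_
            filter_upwards [hu'.coeFn_toLp, (he i).coeFn_toLp] with x h1 h2
            rw [h1, h2]
            ring
        _ = 0 := by rw [integral_const_mul, hue i, mul_zero]
  choose v hv1 hvq hve using hcon'
  have : Fact ((2 : ENNReal) ≠ ⊤) := ⟨by norm_num⟩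
  obtain ⟨V, hV, φ, hφ, hw⟩ := exists_weak_limit v hv1
  have hlim := tendsto_kernelForm htm ht (fun k => hv1 (φ k)) hV hw
  have hge : 1 ≤ kernelForm m t V := by
    have h1 : Tendsto (fun k : ℕ => 1 - 1 / (((φ k : ℕ) : ℝ) + 1)) atTop (𝓝 (1 - 0)) :=
      (tendsto_one_div_add_atTop_nhds_zero_nat.comp hφ.tendsto_atTop).const_sub 1
    rw [sub_zero] at h1
    exact le_of_tendsto_of_tendsto' h1 hlim fun k => hvq (φ k)
  have hVe : ∀ i, ⟪V, (he i).toLp _⟫ = 0 := by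
    intro i
    have h1 := hw ((he i).toLp _)
    simp only [hve] at h1
    exact tendsto_nhds_unique h1 tendsto_const_nhds
  have hVm : Measurable V := (Lp.stronglyMeasurable V).measurable
  have hle := hnn V hVm (Lp.memLp V)
  have hV1 : ∫ x, V x ^ 2 ∂m ≤ 1 := by
    rw [← norm_sq_eq_integral]
    exact pow_le_one₀ (norm_nonneg _) hV
  have h0 := hpos V hVm (Lp.memLp V) (fun i => by
    rw [← hVe i, inner_eq_integral]
    refine integral_congr_ae ?_
    filter_upwards [(he i).coeFn_toLp] with x hx
    rw [hx]) (le_antisymm hle (hV1.trans hge))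
  linarith

end Gap

/-! ### Additive coordinates for collisions -/

/-- The Planckian as a function of the energy `E = |p|²`. -/
noncomputable def pl (E : ℝ) : ℝ := 1 / (Real.exp E - 1)

/-- The coordinates `(p_x, |p|²)`, in which the two conservation laws of a collision are
additive. -/
noncomputable def flat (p : ℝ × ℝ) : ℝ × ℝ := (p.1, sqNorm p)

/-- The inverse of `flat` on `p_r > 0`. -/
noncomputable def unflat (z : ℝ × ℝ) : ℝ × ℝ := (z.1, Real.sqrt (z.2 - z.1 ^ 2))

/-- The image of `cutDomain` under `flat`. -/
def region (lam : ℝ) : Set (ℝ × ℝ) := {z | z.1 ^ 2 < z.2 ∧ lam ^ 2 ≤ z.2}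

theorem planck_eq (p : ℝ × ℝ) : planck p = pl (sqNorm p) := rfl

theorem measurable_pl : Measurable pl := by
  unfold pl; fun_prop

theorem measurable_flat : Measurable flat := by
  have := measurable_sqNorm
  unfold flat; fun_prop

theorem measurable_unflat : Measurable unflat := by
  unfold unflat; fun_prop

theorem measurableSet_region (lam : ℝ) : MeasurableSet (region lam) :=
  have h1 : MeasurableSet {z : ℝ × ℝ | z.1 ^ 2 < z.2} :=
    measurableSet_lt (by fun_prop) (by fun_prop)
  have h2 : MeasurableSet {z : ℝ × ℝ | lam ^ 2 ≤ z.2} :=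
    measurableSet_le (by fun_prop) (by fun_prop)
  h1.inter h2

theorem sqNorm_unflat {z : ℝ × ℝ} (hz : z.1 ^ 2 ≤ z.2) : sqNorm (unflat z) = z.2 := by
  unfold sqNorm unflat
  rw [Real.sq_sqrt (by linarith)]
  ring

theorem unflat_flat {p : ℝ × ℝ} (hp : 0 ≤ p.2) : unflat (flat p) = p := by
  unfold unflat flat sqNorm
  ext
  · rfl
  · simp [Real.sqrt_sq hp]

theorem flat_mem_region {lam : ℝ} (hlam : 0 < lam) {p : ℝ × ℝ} (hp : p ∈ cutDomain lam) :
    flat p ∈ region lam := by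
  refine ⟨?_, sq_le_sqNorm hlam hp⟩
  have := hp.1
  simp only [flat, sqNorm]
  have := sq_pos_of_pos this
  linarith

theorem flat_image {lam : ℝ} (hlam : 0 < lam) : flat '' cutDomain lam = region lam := by
  ext z
  constructor
  · rintro ⟨p, hp, rfl⟩
    exact flat_mem_region hlam hp
  · rintro ⟨h1, h2⟩
    refine ⟨unflat z, ⟨Real.sqrt_pos.2 (by linarith), ?_⟩, ?_⟩
    · unfold modulus
      rw [sqNorm_unflat h1.le]
      exact Real.le_sqrt_of_sq_le h2
    · unfold flat
      rw [sqNorm_unflat h1.le]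
      rfl

theorem flat_injOn (lam : ℝ) : Set.InjOn flat (cutDomain lam) := by
  intro p hp q hq h
  rw [← unflat_flat hp.1.le, h, unflat_flat hq.1.le]

theorem hasFDerivAt_flat (p : ℝ × ℝ) :
    HasFDerivAt flat (LinearMap.toContinuousLinearMap (Matrix.toLin (Module.Basis.finTwoProd ℝ)
      (Module.Basis.finTwoProd ℝ) !![1, 0; 2 * p.1, 2 * p.2])) p := by
  rw [Matrix.toLin_finTwoProd_toContinuousLinearMap]
  have h1 : HasFDerivAt (fun q : ℝ × ℝ => q.1) (ContinuousLinearMap.fst ℝ ℝ ℝ) p :=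
    hasFDerivAt_fst
  have h2 : HasFDerivAt (fun q : ℝ × ℝ => q.2) (ContinuousLinearMap.snd ℝ ℝ ℝ) p :=
    hasFDerivAt_snd
  refine HasFDerivAt.congr_fderiv (h1.prodMk ((h1.pow 2).add (h2.pow 2))) ?_
  ext <;> simp

/-- `dp = 2π p_r dp_x dp_r = π dp_x d|p|²`. -/
theorem measurePreserving_flat {lam : ℝ} (hlam : 0 < lam) :
    MeasurePreserving flat (dp lam)
      (ENNReal.ofReal Real.pi • volume.restrict (region lam)) := by
  refine ⟨measurable_flat, ?_⟩
  ext s hs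
  rw [Measure.map_apply measurable_flat hs]
  unfold dp
  rw [withDensity_apply _ (measurable_flat hs), ← lintegral_indicator (measurable_flat hs)]
  have h := lintegral_image_eq_lintegral_abs_det_fderiv_mul volume (measurableSet_cutDomain lam)
    (fun p _ => (hasFDerivAt_flat p).hasFDerivWithinAt) (flat_injOn lam)
    (fun z => ENNReal.ofReal Real.pi * s.indicator 1 z)
  rw [flat_image hlam, lintegral_const_mul _ (measurable_one.indicator hs),
    lintegral_indicator_one hs] at h
  rw [Measure.smul_apply, smul_eq_mul, h]
  refine setLIntegral_congr_fun (measurableSet_cutDomain lam) fun p hp => ?_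
  have hdet : (LinearMap.toContinuousLinearMap (Matrix.toLin (Module.Basis.finTwoProd ℝ)
      (Module.Basis.finTwoProd ℝ) !![1, 0; 2 * p.1, 2 * p.2])).det = 2 * p.2 := by
    rw [LinearMap.det_toContinuousLinearMap, LinearMap.det_toLin]
    simp
  rw [hdet, abs_of_pos (by linarith [hp.1])]
  by_cases hps : flat p ∈ s
  · rw [Set.indicator_of_mem (by exact hps), Set.indicator_of_mem hps, Pi.one_apply, mul_one,
      ← ENNReal.ofReal_mul (by linarith [hp.1])]
    congr 1
    ring
  · rw [Set.indicator_of_notMem (by exact hps), Set.indicator_of_notMem hps]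
    simp

theorem integral_dp {lam : ℝ} (hlam : 0 < lam) {H G : ℝ × ℝ → ℝ}
    (hHG : ∀ p ∈ cutDomain lam, H p = G (flat p))
    (hG : AEStronglyMeasurable G (volume.restrict (region lam))) :
    ∫ p, H p ∂(dp lam) = Real.pi * ∫ z in region lam, G z := by
  have h1 : ∫ p, H p ∂(dp lam) = ∫ p, G (flat p) ∂(dp lam) :=
    integral_congr_ae ((ae_dp lam).mono fun p hp => hHG p hp)
  have h2 := integral_map (μ := dp lam) (f := G) measurable_flat.aemeasurable (by
    rw [(measurePreserving_flat hlam).map_eq]; exact hG.smul_measure _)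
  rw [h1, ← h2, (measurePreserving_flat hlam).map_eq, integral_smul_measure,
    ENNReal.toReal_ofReal Real.pi_pos.le, smul_eq_mul]

theorem mu_eq {lam : ℝ} (hlam : 0 < lam) :
    mu lam = (dp lam).withDensity (fun p => ((Real.exp (-sqNorm p)).toNNReal : ENNReal)) := by
  unfold mu
  refine withDensity_congr_ae ?_
  filter_upwards [ae_dp lam] with p hp
  rw [ratio_eq hlam (sq_le_sqNorm hlam hp)]
  rfl

theorem ae_mu {lam : ℝ} : ∀ᵐ p ∂(mu lam), p ∈ cutDomain lam :=
  (withDensity_absolutelyContinuous _ _).ae_le (ae_dp lam)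

theorem measurable_exp_sqNorm : Measurable fun p => (Real.exp (-sqNorm p)).toNNReal := by
  have := measurable_sqNorm
  fun_prop

theorem integral_mu {lam : ℝ} (hlam : 0 < lam) {H G : ℝ × ℝ → ℝ}
    (hHG : ∀ p ∈ cutDomain lam, H p = G (flat p))
    (hG : AEStronglyMeasurable G (volume.restrict (region lam))) :
    ∫ p, H p ∂(mu lam) = Real.pi * ∫ z in region lam, Real.exp (-z.2) * G z := by
  rw [mu_eq hlam, integral_withDensity_eq_integral_smul measurable_exp_sqNorm]
  refine integral_dp hlam (fun p hp => ?_) ?_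
  · rw [NNReal.smul_def, Real.coe_toNNReal _ (Real.exp_pos _).le, smul_eq_mul, hHG p hp]
    rfl
  · exact (Measurable.aestronglyMeasurable (by fun_prop)).mul hG

theorem integrable_mu {lam : ℝ} (hlam : 0 < lam) {H G : ℝ × ℝ → ℝ}
    (hHG : ∀ p ∈ cutDomain lam, H p = G (flat p))
    (hG : AEStronglyMeasurable G (volume.restrict (region lam))) :
    Integrable H (mu lam) ↔
      IntegrableOn (fun z => Real.exp (-z.2) * G z) (region lam) := by
  rw [mu_eq hlam, integrable_withDensity_iff_integrable_smul measurable_exp_sqNorm]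
  have h1 : Integrable (fun p => (Real.exp (-sqNorm p)).toNNReal • H p) (dp lam) ↔
      Integrable ((fun z : ℝ × ℝ => Real.exp (-z.2) * G z) ∘ flat) (dp lam) := by
    refine integrable_congr ((ae_dp lam).mono fun p hp => ?_)
    simp only [Function.comp]
    rw [NNReal.smul_def, Real.coe_toNNReal _ (Real.exp_pos _).le, smul_eq_mul, hHG p hp]
    rfl
  have h2 : AEStronglyMeasurable (fun z : ℝ × ℝ => Real.exp (-z.2) * G z)
      (volume.restrict (region lam)) :=
    (Measurable.aestronglyMeasurable (by fun_prop)).mul hG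
  rw [h1, (measurePreserving_flat hlam).integrable_comp (h2.smul_measure _),
    integrable_smul_measure (by simpa using Real.pi_pos) ENNReal.ofReal_ne_top]
  rfl

theorem ae_mu_iff {lam : ℝ} (hlam : 0 < lam) {p : ℝ × ℝ → Prop}
    (hp : MeasurableSet {z | p z}) :
    (∀ᵐ q ∂(mu lam), p (flat q)) ↔ ∀ᵐ z ∂(volume.restrict (region lam)), p z := by
  have h1 : ae (mu lam) = ae (dp lam) := by
    rw [mu_eq hlam]
    refine le_antisymm (withDensity_absolutelyContinuous _ _).ae_le ?_
    refine (withDensity_absolutelyContinuous' (by have := measurable_sqNorm; fun_prop) ?_).ae_le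
    refine Eventually.of_forall fun p => ?_
    simpa using Real.exp_pos _
  have h2 : (∀ᵐ z ∂(Measure.map flat (dp lam)), p z) ↔ ∀ᵐ q ∂(dp lam), p (flat q) :=
    ae_map_iff measurable_flat.aemeasurable hp
  rw [h1, ← h2, (measurePreserving_flat hlam).map_eq]
  have h3 : ENNReal.ofReal Real.pi ≠ 0 := by simpa using Real.pi_pos
  simp only [ae_iff, Measure.smul_apply, smul_eq_mul, mul_eq_zero, h3, false_or]

/-! ### Identities of the Planckian -/

theorem pl_sub_mul {a b : ℝ} (ha : 0 < a) (hb : 0 < b) :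
    (pl b - pl (a + b)) * (1 + pl a) = (1 + pl (a + b)) * pl b := by
  have h1 := Real.one_lt_exp_iff.2 ha
  have h2 := Real.one_lt_exp_iff.2 hb
  have h3 : Real.exp a * Real.exp b - 1 ≠ 0 := by nlinarith
  have h4 : Real.exp a - 1 ≠ 0 := by linarith
  have h5 : Real.exp b - 1 ≠ 0 := by linarith
  unfold pl
  rw [Real.exp_add]
  generalize Real.exp a = x at *
  generalize Real.exp b = y at *
  have h6 : y * x - 1 ≠ 0 := by rwa [mul_comm]
  field_simp
  ring

theorem pl_add_mul {a b : ℝ} (ha : 0 < a) (hb : 0 < b) :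
    (1 + pl a + pl b) * pl (a + b) = pl a * pl b := by
  have h1 := Real.one_lt_exp_iff.2 ha
  have h2 := Real.one_lt_exp_iff.2 hb
  have h3 : Real.exp a * Real.exp b - 1 ≠ 0 := by nlinarith
  have h4 : Real.exp a - 1 ≠ 0 := by linarith
  have h5 : Real.exp b - 1 ≠ 0 := by linarith
  unfold pl
  rw [Real.exp_add]
  generalize Real.exp a = x at *
  generalize Real.exp b = y at *
  have h6 : y * x - 1 ≠ 0 := by rwa [mul_comm]
  field_simp
  ring

theorem pl_pos {E : ℝ} (hE : 0 < E) : 0 < pl E :=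
  one_div_pos.2 (by linarith [Real.one_lt_exp_iff.2 hE])

theorem exp_mul_one_add_pl {E : ℝ} (hE : 0 < E) : Real.exp (-E) * (1 + pl E) = pl E := by
  have h1 := Real.one_lt_exp_iff.2 hE
  have h4 : Real.exp E - 1 ≠ 0 := by linarith
  have h5 := (Real.exp_pos E).ne'
  unfold pl
  rw [Real.exp_neg]
  field_simp
  ring

/-! ### The collision operator in additive coordinates -/

open Classical in
/-- The symmetric weight of a collision `z + w ↔ z, w`. -/
noncomputable def bker (lam : ℝ) (z w : ℝ × ℝ) : ℝ :=
  if z ∈ region lam ∧ w ∈ region lam ∧ z + w ∈ region lam then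
    (1 + pl (z.2 + w.2)) * pl z.2 * pl w.2 else 0

/-- The kernel of `K` acting on `f / (1 + P)`, up to the factor `2 n π² / P`. -/
noncomputable def kap (lam : ℝ) (z w : ℝ × ℝ) : ℝ :=
  bker lam w (z - w) + bker lam z (w - z) - bker lam z w

/-- `P (1 + P) ν`, up to the factor `n π²`, as an integral of the collision weights. -/
noncomputable def om (lam : ℝ) (z : ℝ × ℝ) : ℝ :=
  (∫ w, bker lam w (z - w)) + 2 * ∫ w, bker lam z w

/-- `f / (1 + P)` as a function of `(p_x, |p|²)`. -/
noncomputable def red (f : ℝ × ℝ → ℝ) (z : ℝ × ℝ) : ℝ := f (unflat z) / (1 + pl z.2)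

theorem pos_of_mem_region {lam : ℝ} {z : ℝ × ℝ} (hz : z ∈ region lam) : 0 < z.2 :=
  lt_of_le_of_lt (sq_nonneg _) hz.1

theorem measurable_red {f : ℝ × ℝ → ℝ} (hf : Measurable f) : Measurable (red f) := by
  have h1 := measurable_unflat
  have h2 := measurable_pl
  unfold red
  fun_prop

theorem red_flat {lam : ℝ} (hlam : 0 < lam) (f : ℝ × ℝ → ℝ) {p : ℝ × ℝ}
    (hp : p ∈ cutDomain lam) : f p = (1 + planck p) * red f (flat p) := by
  have h0 : 0 < pl (sqNorm p) := pl_pos (pos_of_mem_region (flat_mem_region hlam hp))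
  unfold red
  rw [unflat_flat hp.1.le, planck_eq]
  simp only [flat]
  field_simp

theorem measurable_bker (lam : ℝ) : Measurable (fun z : (ℝ × ℝ) × (ℝ × ℝ) =>
    bker lam z.1 z.2) := by
  have h := measurable_pl
  have hr := measurableSet_region lam
  unfold bker
  refine Measurable.ite ?_ (by fun_prop) measurable_const
  exact (measurable_fst hr).inter ((measurable_snd hr).inter
    ((measurable_fst.add measurable_snd) hr))

theorem measurable_kap (lam : ℝ) : Measurable (fun z : (ℝ × ℝ) × (ℝ × ℝ) =>
    kap lam z.1 z.2) := by
  have h := measurable_bker lam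
  unfold kap
  exact ((h.comp (f := fun z : (ℝ × ℝ) × (ℝ × ℝ) => (z.2, z.1 - z.2)) (by fun_prop)).add
    (h.comp (f := fun z : (ℝ × ℝ) × (ℝ × ℝ) => (z.1, z.2 - z.1)) (by fun_prop))).sub h

theorem measurable_om (lam : ℝ) : Measurable (om lam) := by
  have h := measurable_bker lam
  unfold om
  have h1 : Measurable (fun z : (ℝ × ℝ) × (ℝ × ℝ) => bker lam z.2 (z.1 - z.2)) :=
    h.comp (f := fun z : (ℝ × ℝ) × (ℝ × ℝ) => (z.2, z.1 - z.2)) (by fun_prop)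
  exact (h1.stronglyMeasurable.integral_prod_right').measurable.add
    ((h.stronglyMeasurable.integral_prod_right').measurable.const_mul 2)

theorem bker_symm (lam : ℝ) (z w : ℝ × ℝ) : bker lam z w = bker lam w z := by
  unfold bker
  rw [add_comm w z]
  split_ifs with h1 h2 h2
  · rw [add_comm z.2]; ring
  · exact absurd ⟨h1.2.1, h1.1, h1.2.2⟩ h2
  · exact absurd ⟨h2.2.1, h2.1, h2.2.2⟩ h1
  · rfl

theorem kap_symm (lam : ℝ) (z w : ℝ × ℝ) : kap lam z w = kap lam w z := by
  unfold kap
  rw [bker_symm lam z w]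
  ring

theorem bker_nonneg (lam : ℝ) (z w : ℝ × ℝ) : 0 ≤ bker lam z w := by
  unfold bker
  split_ifs with h
  · have h1 := pl_pos (pos_of_mem_region h.1)
    have h2 := pl_pos (pos_of_mem_region h.2.1)
    have h3 := pl_pos (pos_of_mem_region h.2.2)
    simp only [Prod.snd_add] at h3
    positivity
  · exact le_rfl

theorem deltaInt_unflat (lam a b : ℝ) (H : ℝ × ℝ → ℝ) :
    deltaInt lam a b H =
      open Classical in if (a, b) ∈ region lam then Real.pi * H (unflat (a, b)) else 0 := by
  unfold deltaInt
  by_cases h : (a, b) ∈ region lam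
  · rw [if_pos h, if_pos (by exact h)]
    rfl
  · rw [if_neg h, if_neg (by exact h)]

theorem kernelAux_mul {lam : ℝ} (hlam : 0 < lam) {p q : ℝ × ℝ} (hp : p ∈ cutDomain lam)
    (hq : q ∈ cutDomain lam) :
    Real.exp (-sqNorm q) * (kernelAux lam p q * (1 + planck q)) =
      Real.pi * kap lam (flat p) (flat q) := by
  have hpr := flat_mem_region hlam hp
  have hqr := flat_mem_region hlam hq
  have hp0 : 0 < sqNorm p := pos_of_mem_region hpr
  have hq0 : 0 < sqNorm q := pos_of_mem_region hqr
  have e : Real.exp (-sqNorm q) * (kernelAux lam p q * (1 + planck q)) =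
      kernelAux lam p q * pl (sqNorm q) := by
    rw [planck_eq, mul_left_comm, exp_mul_one_add_pl hq0]
  rw [e]
  have s1 : (flat p).2 = sqNorm p := rfl
  have s2 : (flat q).2 = sqNorm q := rfl
  have t1 : deltaInt lam (p.1 - q.1) (sqNorm p - sqNorm q) (fun r => planck r - planck p)
      * (1 + planck q) * pl (sqNorm q) = Real.pi * bker lam (flat q) (flat p - flat q) := by
    rw [deltaInt_unflat]
    unfold bker
    have hm : flat p - flat q = (p.1 - q.1, sqNorm p - sqNorm q) := rfl
    rw [hm]
    by_cases h : (p.1 - q.1, sqNorm p - sqNorm q) ∈ region lam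
    · have h0 : 0 < sqNorm p - sqNorm q := pos_of_mem_region h
      have := pl_sub_mul hq0 h0
      rw [if_pos h, if_pos ⟨hqr, h, by rw [← hm, add_sub_cancel]; exact hpr⟩, planck_eq,
        sqNorm_unflat h.1.le, planck_eq, planck_eq, s2]
      rw [add_sub_cancel] at this ⊢
      linear_combination Real.pi * pl (sqNorm q) * this
    · rw [if_neg h, if_neg fun h' => h h'.2.1]
      ring
  have t2 : deltaInt lam (q.1 - p.1) (sqNorm q - sqNorm p) (fun r => 1 + planck p + planck r)
      * (1 + planck q) * pl (sqNorm q) = Real.pi * bker lam (flat p) (flat q - flat p) := by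
    rw [deltaInt_unflat]
    unfold bker
    have hm : flat q - flat p = (q.1 - p.1, sqNorm q - sqNorm p) := rfl
    rw [hm]
    by_cases h : (q.1 - p.1, sqNorm q - sqNorm p) ∈ region lam
    · have h0 : 0 < sqNorm q - sqNorm p := pos_of_mem_region h
      have := pl_add_mul hp0 h0
      rw [if_pos h, if_pos ⟨hpr, h, by rw [← hm, add_sub_cancel]; exact hqr⟩]
      simp only [planck_eq]
      rw [sqNorm_unflat h.1.le, s1]
      rw [add_sub_cancel] at this ⊢
      linear_combination Real.pi * (1 + pl (sqNorm q)) * this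
    · rw [if_neg h, if_neg fun h' => h h'.2.1]
      ring
  have t3 : deltaInt lam (p.1 + q.1) (sqNorm p + sqNorm q) (fun r => planck r - planck p)
      * (1 + planck q) * pl (sqNorm q) = -(Real.pi * bker lam (flat p) (flat q)) := by
    rw [deltaInt_unflat]
    unfold bker
    have hm : flat p + flat q = (p.1 + q.1, sqNorm p + sqNorm q) := rfl
    rw [hm]
    by_cases h : (p.1 + q.1, sqNorm p + sqNorm q) ∈ region lam
    · have := pl_sub_mul hq0 hp0
      rw [if_pos h, if_pos ⟨hpr, hqr, h⟩]
      simp only [planck_eq]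
      rw [sqNorm_unflat h.1.le, s1, s2]
      rw [add_comm (sqNorm q)] at this
      linear_combination (-Real.pi) * pl (sqNorm q) * this
    · rw [if_neg h, if_neg fun h' => h h'.2.2]
      ring
  unfold kernelAux kap
  linear_combination t1 + t2 + t3

theorem kap_eq_zero {lam : ℝ} {z w : ℝ × ℝ} (hw : w ∉ region lam) : kap lam z w = 0 := by
  unfold kap bker
  rw [if_neg fun h => hw h.1, if_neg fun h => hw (by simpa using h.2.2),
    if_neg fun h => hw h.2.1]
  ring

theorem opK_flat {lam : ℝ} (hlam : 0 < lam) (n : ℝ) {f : ℝ × ℝ → ℝ} (hfm : Measurable f)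
    (hf : Integrable f (mu lam)) {p : ℝ × ℝ} (hp : p ∈ cutDomain lam) :
    opK n lam f p = 2 * n * Real.pi ^ 2 / planck p *
      ∫ w, kap lam (flat p) w * red f w := by
  have hpl := measurable_pl
  have hk : Measurable fun w => kap lam (flat p) w :=
    (measurable_kap lam).comp measurable_prodMk_left
  have hr := measurable_red hfm
  rw [(opK_eq hlam p).2 n f hf,
    integral_mu hlam (G := fun w => Real.exp w.2 * (Real.pi * (kap lam (flat p) w * red f w)))]
  · have e : ∀ w : ℝ × ℝ, Real.exp (-w.2) * (Real.exp w.2 *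
        (Real.pi * (kap lam (flat p) w * red f w))) =
        Real.pi * (kap lam (flat p) w * red f w) := by
      intro w
      rw [← mul_assoc, ← Real.exp_add]
      simp
    simp only [e]
    rw [integral_const_mul, setIntegral_eq_integral_of_forall_compl_eq_zero]
    · ring
    · intro w hw
      rw [kap_eq_zero hw, zero_mul]
  · intro q hq
    have h := kernelAux_mul hlam hp hq
    have h2 : Real.exp (flat q).2 * Real.exp (-sqNorm q) = 1 := by
      rw [← Real.exp_add]
      simp [flat]
    rw [red_flat hlam f hq]
    linear_combination (-(kernelAux lam p q * (1 + planck q) * red f (flat q))) * h2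
      + Real.exp (flat q).2 * red f (flat q) * h
  · exact Measurable.aestronglyMeasurable (by fun_prop)

open Classical in
/-- `ν` in the coordinates `(p_x, |p|²)`, up to the factor `n π²`. -/
noncomputable def freq (lam : ℝ) (z : ℝ × ℝ) : ℝ :=
  (∫ w in region lam, if z - w ∈ region lam then 1 + pl w.2 + pl (z.2 - w.2) else 0)
    + 2 * ∫ w in region lam, if z + w ∈ region lam then pl w.2 - pl (z.2 + w.2) else 0

theorem nu_flat {lam : ℝ} (hlam : 0 < lam) (n : ℝ) (p : ℝ × ℝ) :
    nu n lam p = n * Real.pi ^ 2 * freq lam (flat p) := by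
  classical
  have hpl := measurable_pl
  have hr := measurableSet_region lam
  have h1 : decayInt lam p (fun p2 p3 => 1 + planck p2 + planck p3) = Real.pi *
      ∫ w in region lam, Real.pi * if flat p - w ∈ region lam then
        1 + pl w.2 + pl ((flat p).2 - w.2) else 0 := by
    refine integral_dp hlam (fun q hq => ?_) ?_
    · rw [deltaInt_unflat]
      have hm : flat p - flat q = (p.1 - q.1, sqNorm p - sqNorm q) := rfl
      rw [hm]
      by_cases h : (p.1 - q.1, sqNorm p - sqNorm q) ∈ region lam
      · simp only [if_pos h, planck_eq, sqNorm_unflat h.1.le]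
        rfl
      · rw [if_neg h, if_neg h, mul_zero]
    · refine Measurable.aestronglyMeasurable (Measurable.const_mul ?_ _)
      exact Measurable.ite ((measurable_id.const_sub _) hr) (by fun_prop) measurable_const
  have h2 : mergeInt₃ lam p (fun p1 p3 => planck p3 - planck p1) = Real.pi *
      ∫ w in region lam, Real.pi * if flat p + w ∈ region lam then
        pl w.2 - pl ((flat p).2 + w.2) else 0 := by
    refine integral_dp hlam (fun q hq => ?_) ?_
    · rw [deltaInt_unflat]
      have hm : flat p + flat q = (p.1 + q.1, sqNorm p + sqNorm q) := rfl
      rw [hm]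
      by_cases h : (p.1 + q.1, sqNorm p + sqNorm q) ∈ region lam
      · simp only [if_pos h, planck_eq, sqNorm_unflat h.1.le]
        rfl
      · rw [if_neg h, if_neg h, mul_zero]
    · refine Measurable.aestronglyMeasurable (Measurable.const_mul ?_ _)
      exact Measurable.ite ((measurable_id.const_add _) hr) (by fun_prop) measurable_const
  unfold nu freq
  rw [h1, h2, integral_const_mul, integral_const_mul]
  ring

theorem om_eq {lam : ℝ} {z : ℝ × ℝ} (hz : z ∈ region lam) :
    om lam z = pl z.2 * (1 + pl z.2) * freq lam z := by
  classical
  have hr := measurableSet_region lam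
  have hz0 := pos_of_mem_region hz
  have h1 : ∀ w, bker lam w (z - w) = pl z.2 * (1 + pl z.2) * (region lam).indicator
      (fun w => if z - w ∈ region lam then 1 + pl w.2 + pl (z.2 - w.2) else 0) w := by
    intro w
    unfold bker
    by_cases hw : w ∈ region lam
    · rw [Set.indicator_of_mem hw]
      by_cases h : z - w ∈ region lam
      · have := pl_add_mul (pos_of_mem_region hw) (pos_of_mem_region h)
        rw [if_pos h, if_pos ⟨hw, h, by rwa [add_sub_cancel]⟩]
        simp only [Prod.snd_sub, add_sub_cancel] at this ⊢
        linear_combination (-(1 + pl z.2)) * this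
      · rw [if_neg h, if_neg fun h' => h h'.2.1, mul_zero]
    · rw [Set.indicator_of_notMem hw, if_neg fun h' => hw h'.1, mul_zero]
  have h2 : ∀ w, bker lam z w = pl z.2 * (1 + pl z.2) * (region lam).indicator
      (fun w => if z + w ∈ region lam then pl w.2 - pl (z.2 + w.2) else 0) w := by
    intro w
    unfold bker
    by_cases hw : w ∈ region lam
    · rw [Set.indicator_of_mem hw]
      by_cases h : z + w ∈ region lam
      · have := pl_sub_mul hz0 (pos_of_mem_region hw)
        rw [if_pos h, if_pos ⟨hz, hw, h⟩]
        linear_combination (-pl z.2) * this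
      · rw [if_neg h, if_neg fun h' => h h'.2.2, mul_zero]
    · rw [Set.indicator_of_notMem hw, if_neg fun h' => hw h'.2.1, mul_zero]
  unfold om freq
  simp only [h1, h2]
  rw [integral_const_mul, integral_const_mul, integral_indicator hr, integral_indicator hr]
  ring

/-! ### Size of the weights -/

/-- `exp(-a E)` on `region lam`, extended by zero. -/
noncomputable def expW (lam a : ℝ) : ℝ × ℝ → ℝ :=
  (region lam).indicator fun z => Real.exp (-(a * z.2))

/-- The growth `(1 + |p|)³` of the collision frequency, as a function of `(p_x, |p|²)`. -/
noncomputable def wt (z : ℝ × ℝ) : ℝ := (1 + Real.sqrt z.2) ^ 3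

theorem one_le_wt (z : ℝ × ℝ) : 1 ≤ wt z :=
  one_le_pow₀ (by linarith [Real.sqrt_nonneg z.2])

theorem measurable_wt : Measurable wt := by
  unfold wt; fun_prop

theorem expW_nonneg (lam a : ℝ) (z : ℝ × ℝ) : 0 ≤ expW lam a z :=
  Set.indicator_nonneg (fun _ _ => (Real.exp_pos _).le) z

theorem expW_of_mem {lam : ℝ} (a : ℝ) {z : ℝ × ℝ} (hz : z ∈ region lam) :
    expW lam a z = Real.exp (-(a * z.2)) := Set.indicator_of_mem hz _

theorem expW_of_notMem {lam : ℝ} (a : ℝ) {z : ℝ × ℝ} (hz : z ∉ region lam) :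
    expW lam a z = 0 := Set.indicator_of_notMem hz _

theorem measurable_expW (lam a : ℝ) : Measurable (expW lam a) :=
  Measurable.indicator (by fun_prop) (measurableSet_region lam)

theorem integrable_expW (lam : ℝ) {a : ℝ} (ha : 0 < a) : Integrable (expW lam a) := by
  have hx : Integrable (fun x : ℝ => Real.exp (-(a / 2) * x ^ 2)) :=
    integrable_exp_neg_mul_sq (half_pos ha)
  have hE : Integrable ((Set.Ioi (0 : ℝ)).indicator fun E : ℝ => Real.exp (-(a / 2) * E)) :=
    (integrable_indicator_iff measurableSet_Ioi).2
      (integrableOn_exp_mul_Ioi (by linarith) 0)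
  refine (hx.mul_prod hE).mono' (measurable_expW lam a).aestronglyMeasurable
    (Eventually.of_forall fun z => ?_)
  rw [Real.norm_eq_abs, abs_of_nonneg (expW_nonneg lam a z)]
  by_cases hz : z ∈ region lam
  · have h0 : z.2 ∈ Set.Ioi (0 : ℝ) := pos_of_mem_region hz
    rw [expW_of_mem a hz, Set.indicator_of_mem h0, ← Real.exp_add]
    refine Real.exp_le_exp.2 ?_
    have := mul_le_mul_of_nonneg_left hz.1.le (half_pos ha).le
    linarith
  · rw [expW_of_notMem a hz]
    exact mul_nonneg (Real.exp_pos _).le (Set.indicator_nonneg (fun _ _ => (Real.exp_pos _).le) _)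

/-- An upper bound of `1 + P` on `|p| ≥ lam`. -/
noncomputable def plBound (lam : ℝ) : ℝ := 1 + pl (lam ^ 2)

theorem pl_anti {E F : ℝ} (hE : 0 < E) (hEF : E ≤ F) : pl F ≤ pl E := by
  have h1 := Real.one_lt_exp_iff.2 hE
  have h2 := Real.exp_le_exp.2 hEF
  exact one_div_le_one_div_of_le (by linarith) (by linarith)

theorem one_add_pl_le {lam : ℝ} (hlam : 0 < lam) {E : ℝ} (hE : lam ^ 2 ≤ E) :
    1 + pl E ≤ plBound lam := by
  have := pl_anti (by positivity) hE
  unfold plBound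
  linarith

theorem one_le_plBound {lam : ℝ} (hlam : 0 < lam) : 1 ≤ plBound lam := by
  have := pl_pos (E := lam ^ 2) (by positivity)
  unfold plBound
  linarith

theorem pl_le_exp {lam : ℝ} (hlam : 0 < lam) {E : ℝ} (hE : lam ^ 2 ≤ E) :
    pl E ≤ plBound lam * Real.exp (-E) := by
  have h0 : 0 < E := lt_of_lt_of_le (by positivity) hE
  rw [← exp_mul_one_add_pl h0, mul_comm]
  exact mul_le_mul_of_nonneg_right (one_add_pl_le hlam hE) (Real.exp_pos _).le

theorem exp_le_pl {E : ℝ} (hE : 0 < E) : Real.exp (-E) ≤ pl E := by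
  rw [← exp_mul_one_add_pl hE]
  exact le_mul_of_one_le_right (Real.exp_pos _).le (by linarith [pl_pos hE])

theorem bker_le {lam : ℝ} (hlam : 0 < lam) (z w : ℝ × ℝ) :
    bker lam z w ≤ plBound lam ^ 3 * (expW lam 1 z * expW lam 1 w) := by
  have hB := one_le_plBound hlam
  unfold bker
  split_ifs with h
  · have h1 := pl_le_exp hlam h.1.2
    have h2 := pl_le_exp hlam h.2.1.2
    have h3 := one_add_pl_le hlam h.2.2.2
    have p1 := (pl_pos (pos_of_mem_region h.1)).le
    have p2 := (pl_pos (pos_of_mem_region h.2.1)).le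
    rw [expW_of_mem _ h.1, expW_of_mem _ h.2.1, one_mul, one_mul]
    calc (1 + pl (z.2 + w.2)) * pl z.2 * pl w.2
        ≤ plBound lam * (plBound lam * Real.exp (-z.2)) * (plBound lam * Real.exp (-w.2)) := by
          gcongr
          exact h3
      _ = _ := by ring
  · have := expW_nonneg lam 1 z
    have := expW_nonneg lam 1 w
    positivity

theorem bker_eq_zero_left {lam : ℝ} {z : ℝ × ℝ} (w : ℝ × ℝ) (hz : z ∉ region lam) :
    bker lam z w = 0 := if_neg fun h => hz h.1

theorem bker_eq_zero_right {lam : ℝ} (z : ℝ × ℝ) {w : ℝ × ℝ} (hw : w ∉ region lam) :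
    bker lam z w = 0 := if_neg fun h => hw h.2.1

theorem bker_eq_zero_sum {lam : ℝ} {z w : ℝ × ℝ} (hw : z + w ∉ region lam) :
    bker lam z w = 0 := if_neg fun h => hw h.2.2

theorem integrable_bker {lam : ℝ} (hlam : 0 < lam) (z : ℝ × ℝ) :
    Integrable (fun w => bker lam z w) := by
  refine ((integrable_expW lam one_pos).const_mul (plBound lam ^ 3 * expW lam 1 z)).mono'
    ((measurable_bker lam).comp measurable_prodMk_left).aestronglyMeasurable
    (Eventually.of_forall fun w => ?_)
  rw [Real.norm_eq_abs, abs_of_nonneg (bker_nonneg lam z w), mul_assoc]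
  exact bker_le hlam z w

/-- The factor `exp(-E₂)` of the weight `b(p₂, p - p₂)` suffices for the integrability in `p₂`. -/
theorem integrable_bker_sub {lam : ℝ} (hlam : 0 < lam) (z : ℝ × ℝ) :
    Integrable (fun w => bker lam w (z - w)) := by
  refine ((integrable_expW lam one_pos).const_mul (plBound lam ^ 3)).mono'
    ((measurable_bker lam).comp (f := fun w => (w, z - w))
      (by fun_prop)).aestronglyMeasurable
    (Eventually.of_forall fun w => ?_)
  rw [Real.norm_eq_abs, abs_of_nonneg (bker_nonneg lam _ _)]
  refine (bker_le hlam _ _).trans (mul_le_mul_of_nonneg_left ?_ ?_)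
  · refine mul_le_of_le_one_right (expW_nonneg _ _ _) ?_
    by_cases h : z - w ∈ region lam
    · rw [expW_of_mem _ h, Real.exp_le_one_iff]
      linarith [pos_of_mem_region h]
    · rw [expW_of_notMem _ h]
      exact zero_le_one
  · have := one_le_plBound hlam
    positivity

/-! ### Two-sided bounds of the collision frequency -/

theorem mul_area_le_integral {F : ℝ × ℝ → ℝ} (hF : Integrable F) (h0 : ∀ z, 0 ≤ F z)
    {a b c d k : ℝ} (hab : a ≤ b) (hcd : c ≤ d)
    (hk : ∀ z : ℝ × ℝ, z.1 ∈ Set.Icc a b → z.2 ∈ Set.Icc c d → k ≤ F z) :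
    k * ((b - a) * (d - c)) ≤ ∫ z, F z := by
  have hm : MeasurableSet (Set.Icc a b ×ˢ Set.Icc c d) := measurableSet_Icc.prod measurableSet_Icc
  have hv : (volume : Measure (ℝ × ℝ)).real (Set.Icc a b ×ˢ Set.Icc c d)
      = (b - a) * (d - c) := by
    rw [Measure.volume_eq_prod, measureReal_prod_prod, Real.volume_real_Icc_of_le hab,
      Real.volume_real_Icc_of_le hcd]
  have hfin : volume (Set.Icc a b ×ˢ Set.Icc c d) ≠ ⊤ := by
    rw [Measure.volume_eq_prod, Measure.prod_prod, Real.volume_Icc, Real.volume_Icc]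
    exact ENNReal.mul_ne_top ENNReal.ofReal_ne_top ENNReal.ofReal_ne_top
  calc k * ((b - a) * (d - c)) = ∫ z in Set.Icc a b ×ˢ Set.Icc c d, k := by
        rw [setIntegral_const, hv, smul_eq_mul, mul_comm]
    _ ≤ ∫ z in Set.Icc a b ×ˢ Set.Icc c d, F z :=
        setIntegral_mono_on (integrableOn_const hfin) hF.integrableOn hm
          fun z hz => hk z hz.1 hz.2
    _ ≤ ∫ z, F z := setIntegral_le_integral hF (Eventually.of_forall h0)

theorem integral_le_mul_area {F : ℝ × ℝ → ℝ} {a b c d k : ℝ} (hab : a ≤ b) (hcd : c ≤ d)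
    (hk0 : 0 ≤ k) (h0 : ∀ z, 0 ≤ F z) (hFm : Measurable F)
    (hk : ∀ z, F z ≤ k) (hsupp : ∀ z, F z ≠ 0 → z.1 ∈ Set.Icc a b ∧ z.2 ∈ Set.Icc c d) :
    Integrable F ∧ ∫ z, F z ≤ k * ((b - a) * (d - c)) := by
  have hm : MeasurableSet (Set.Icc a b ×ˢ Set.Icc c d) := measurableSet_Icc.prod measurableSet_Icc
  have hv : (volume : Measure (ℝ × ℝ)).real (Set.Icc a b ×ˢ Set.Icc c d)
      = (b - a) * (d - c) := by
    rw [Measure.volume_eq_prod, measureReal_prod_prod, Real.volume_real_Icc_of_le hab,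
      Real.volume_real_Icc_of_le hcd]
  have hfin : volume (Set.Icc a b ×ˢ Set.Icc c d) ≠ ⊤ := by
    rw [Measure.volume_eq_prod, Measure.prod_prod, Real.volume_Icc, Real.volume_Icc]
    exact ENNReal.mul_ne_top ENNReal.ofReal_ne_top ENNReal.ofReal_ne_top
  have hdom : Integrable ((Set.Icc a b ×ˢ Set.Icc c d).indicator fun _ : ℝ × ℝ => k) :=
    (integrable_indicator_iff hm).2 (integrableOn_const hfin)
  have hle : ∀ z, F z ≤ (Set.Icc a b ×ˢ Set.Icc c d).indicator (fun _ => k) z := by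
    intro z
    by_cases hz : F z = 0
    · rw [hz]
      exact Set.indicator_nonneg (fun _ _ => hk0) z
    · rw [Set.indicator_of_mem (Set.mem_prod.2 (hsupp z hz))]
      exact hk z
  have hint : Integrable F := hdom.mono' hFm.aestronglyMeasurable
    (Eventually.of_forall fun z => by
      rw [Real.norm_eq_abs, abs_of_nonneg (h0 z)]
      exact hle z)
  refine ⟨hint, (integral_mono hint hdom hle).trans (le_of_eq ?_)⟩
  rw [integral_indicator hm, setIntegral_const, hv, smul_eq_mul, mul_comm]

open Classical in
/-- The rate of decays `p → p₂ + p₃`. -/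
noncomputable def decayFun (lam : ℝ) (z w : ℝ × ℝ) : ℝ :=
  if w ∈ region lam ∧ z - w ∈ region lam then 1 + pl w.2 + pl (z.2 - w.2) else 0

open Classical in
/-- The rate of mergers `p + p₃ → p₁`. -/
noncomputable def mergeFun (lam : ℝ) (z w : ℝ × ℝ) : ℝ :=
  if w ∈ region lam ∧ z + w ∈ region lam then pl w.2 - pl (z.2 + w.2) else 0

theorem freq_eq (lam : ℝ) (z : ℝ × ℝ) :
    freq lam z = (∫ w, decayFun lam z w) + 2 * ∫ w, mergeFun lam z w := by
  classical
  have hr := measurableSet_region lam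
  unfold freq decayFun mergeFun
  rw [← integral_indicator hr, ← integral_indicator hr]
  congr 3 <;>
  · funext w
    by_cases hw : w ∈ region lam
    · rw [Set.indicator_of_mem hw]
      simp only [hw, true_and]
    · rw [Set.indicator_of_notMem hw]
      simp only [hw, false_and, if_false]

theorem measurable_decayFun (lam : ℝ) (z : ℝ × ℝ) : Measurable (decayFun lam z) := by
  have h := measurable_pl
  have hr := measurableSet_region lam
  exact Measurable.ite (hr.inter ((measurable_id.const_sub z) hr)) (by fun_prop)
    measurable_const

theorem measurable_mergeFun (lam : ℝ) (z : ℝ × ℝ) : Measurable (mergeFun lam z) := by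
  have h := measurable_pl
  have hr := measurableSet_region lam
  exact Measurable.ite (hr.inter ((measurable_id.const_add z) hr)) (by fun_prop)
    measurable_const

theorem decayFun_nonneg (lam : ℝ) (z w : ℝ × ℝ) : 0 ≤ decayFun lam z w := by
  unfold decayFun
  split_ifs with h
  · have h1 := pl_pos (pos_of_mem_region h.1)
    have h2 := pl_pos (pos_of_mem_region h.2)
    simp only [Prod.snd_sub] at h2
    linarith
  · exact le_rfl

theorem mergeFun_nonneg {lam : ℝ} {z : ℝ × ℝ} (hz : 0 ≤ z.2) (w : ℝ × ℝ) :
    0 ≤ mergeFun lam z w := by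
  unfold mergeFun
  split_ifs with h
  · have := pl_anti (pos_of_mem_region h.1) (by linarith : w.2 ≤ z.2 + w.2)
    linarith
  · exact le_rfl

theorem decayFun_bounds {lam : ℝ} (hlam : 0 < lam) {z : ℝ × ℝ} (hz : 0 ≤ z.2) :
    Integrable (decayFun lam z) ∧
      ∫ w, decayFun lam z w ≤ 4 * plBound lam * (Real.sqrt z.2 * z.2) := by
  have hB := one_le_plBound hlam
  have hs := Real.sqrt_nonneg z.2
  have h := integral_le_mul_area (F := decayFun lam z) (a := -Real.sqrt z.2)
    (b := Real.sqrt z.2) (c := 0) (d := z.2) (k := 2 * plBound lam) (by linarith) hz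
    (by linarith) (decayFun_nonneg lam z) (measurable_decayFun lam z) ?_ ?_
  · refine ⟨h.1, h.2.trans (le_of_eq ?_)⟩
    ring
  · intro w
    unfold decayFun
    split_ifs with h
    · have h1 := one_add_pl_le hlam h.1.2
      have h2 := one_add_pl_le hlam h.2.2
      simp only [Prod.snd_sub] at h2
      linarith
    · linarith
  · intro w hw
    unfold decayFun at hw
    split_ifs at hw with h
    · have h1 := pos_of_mem_region h.1
      have h2 := pos_of_mem_region h.2
      simp only [Prod.snd_sub] at h2
      refine ⟨abs_le.1 (Real.abs_le_sqrt ?_), h1.le, by linarith⟩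
      linarith [h.1.1]
    · exact absurd rfl hw

theorem mergeFun_bounds {lam : ℝ} (hlam : 0 < lam) {z : ℝ × ℝ} (hz : 0 ≤ z.2) :
    Integrable (mergeFun lam z) ∧
      ∫ w, mergeFun lam z w ≤ plBound lam * ∫ w, expW lam 1 w := by
  have hB := one_le_plBound hlam
  have hle : ∀ w, mergeFun lam z w ≤ plBound lam * expW lam 1 w := by
    intro w
    unfold mergeFun
    split_ifs with h
    · have h1 := pl_le_exp hlam h.1.2
      have h2 := pl_pos (pos_of_mem_region h.2)
      simp only [Prod.snd_add] at h2
      rw [expW_of_mem _ h.1, one_mul]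
      linarith
    · exact mul_nonneg (by linarith) (expW_nonneg _ _ _)
  have hd := (integrable_expW lam one_pos).const_mul (plBound lam)
  have hint : Integrable (mergeFun lam z) := hd.mono'
    (measurable_mergeFun lam z).aestronglyMeasurable (Eventually.of_forall fun w => by
      rw [Real.norm_eq_abs, abs_of_nonneg (mergeFun_nonneg hz w)]
      exact hle w)
  refine ⟨hint, ?_⟩
  rw [← integral_const_mul]
  exact integral_mono hint hd hle

theorem exists_freq_le {lam : ℝ} (hlam : 0 < lam) :
    ∃ C : ℝ, 0 < C ∧ ∀ z : ℝ × ℝ, 0 ≤ z.2 → freq lam z ≤ C * wt z := by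
  have hB := one_le_plBound hlam
  have hI : 0 ≤ ∫ w, expW lam 1 w := integral_nonneg (expW_nonneg lam 1)
  refine ⟨4 * plBound lam + 2 * (plBound lam * ∫ w, expW lam 1 w), by positivity,
    fun z hz => ?_⟩
  have h1 := (decayFun_bounds hlam hz).2
  have h2 := (mergeFun_bounds hlam hz).2
  have hs := Real.sqrt_nonneg z.2
  have h3 : Real.sqrt z.2 * z.2 ≤ wt z := by
    unfold wt
    nth_rewrite 2 [← Real.sq_sqrt hz]
    nlinarith [mul_nonneg hs hs]
  have h4 := one_le_wt z
  rw [freq_eq, add_mul]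
  refine add_le_add (h1.trans (mul_le_mul_of_nonneg_left h3 (by linarith))) ?_
  refine (mul_le_mul_of_nonneg_left h2 (by norm_num)).trans ?_
  exact le_mul_of_one_le_right (by positivity) h4

/-- For large energies decays give `ν ≥ c |p|³`: the momenta near `(p_x/2, |p|²/2)` form a box of
area `|p|³/25` of admissible decay products. -/
theorem le_integral_decayFun {lam : ℝ} (hlam : 0 < lam) {z : ℝ × ℝ} (hz : z.1 ^ 2 ≤ z.2)
    (hE : 5 / 2 * lam ^ 2 ≤ z.2) :
    Real.sqrt z.2 ^ 3 / 25 ≤ ∫ w, decayFun lam z w := by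
  have h0 : 0 < z.2 := lt_of_lt_of_le (by positivity) hE
  have hint := (decayFun_bounds hlam h0.le).1
  have hs := Real.sqrt_nonneg z.2
  have hss := Real.sq_sqrt h0.le
  have hx := abs_le.1 (Real.abs_le_sqrt hz)
  set s := Real.sqrt z.2 with hsdef
  have h := mul_area_le_integral (k := 1) hint (decayFun_nonneg lam z)
    (a := z.1 / 2 - s / 10) (b := z.1 / 2 + s / 10) (c := z.2 / 2 - z.2 / 10)
    (d := z.2 / 2 + z.2 / 10) (by linarith) (by linarith) ?_
  · refine le_trans (le_of_eq ?_) h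
    rw [← hss]
    ring
  · intro w h1 h2
    have key : ∀ v : ℝ × ℝ, |v.1| ≤ 6 / 10 * s → z.2 / 2 - z.2 / 10 ≤ v.2 → v ∈ region lam := by
      intro v hv1 hv2
      refine ⟨?_, by linarith⟩
      have h5 : |v.1| ^ 2 ≤ (6 / 10 * s) ^ 2 := pow_le_pow_left₀ (abs_nonneg _) hv1 2
      rw [sq_abs] at h5
      nlinarith
    have h3 : w ∈ region lam :=
      key w (abs_le.2 ⟨by linarith [h1.1], by linarith [h1.2]⟩) h2.1
    have h4 : z - w ∈ region lam := by
      refine key (z - w) (abs_le.2 ⟨?_, ?_⟩) ?_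
      · rw [Prod.fst_sub]; linarith [h1.2]
      · rw [Prod.fst_sub]; linarith [h1.1]
      · rw [Prod.snd_sub]; linarith [h2.2]
    unfold decayFun
    rw [if_pos ⟨h3, h4⟩]
    have h5 := pl_pos (pos_of_mem_region h3)
    have h6 := pl_pos (pos_of_mem_region h4)
    simp only [Prod.snd_sub] at h6
    linarith

/-- For bounded energies mergers with a momentum from a fixed box give a positive lower bound
of `ν`. -/
theorem exists_le_integral_mergeFun {lam : ℝ} (hlam : 0 < lam) :
    ∃ c : ℝ, 0 < c ∧ ∀ z : ℝ × ℝ, z.1 ^ 2 ≤ z.2 → lam ^ 2 ≤ z.2 → z.2 ≤ 5 / 2 * lam ^ 2 →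
      c ≤ ∫ w, mergeFun lam z w := by
  have hl2 : 0 < lam ^ 2 := by positivity
  have hB := one_le_plBound hlam
  have hp := pl_pos (E := 21 / 2 * lam ^ 2) (by positivity)
  refine ⟨pl (21 / 2 * lam ^ 2) / plBound lam * ((lam - -lam) * (8 * lam ^ 2 - 7 * lam ^ 2)),
    by
      have : 0 < (lam - -lam) * (8 * lam ^ 2 - 7 * lam ^ 2) := by nlinarith
      positivity, fun z hz1 hz2 hz3 => ?_⟩
  have h0 : 0 < z.2 := lt_of_lt_of_le hl2 hz2
  have hx : |z.1| ≤ 8 / 5 * lam := by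
    refine abs_le_of_sq_le_sq (hz1.trans (hz3.trans ?_)) (by positivity)
    nlinarith
  have hx' := abs_le.1 hx
  refine mul_area_le_integral (mergeFun_bounds hlam h0.le).1 (mergeFun_nonneg h0.le)
    (by linarith) (by linarith) fun w h1 h2 => ?_
  have h3 : w ∈ region lam := by
    refine ⟨?_, by linarith [h2.1]⟩
    have : w.1 ^ 2 ≤ lam ^ 2 := sq_le_sq' h1.1 h1.2
    linarith [h2.1]
  have h4 : z + w ∈ region lam := by
    refine ⟨?_, by rw [Prod.snd_add]; linarith [h2.1]⟩
    rw [Prod.fst_add, Prod.snd_add]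
    have : (z.1 + w.1) ^ 2 ≤ (13 / 5 * lam) ^ 2 :=
      sq_le_sq' (by linarith [h1.1]) (by linarith [h1.2])
    nlinarith [h2.1]
  unfold mergeFun
  rw [if_pos ⟨h3, h4⟩, div_le_iff₀ (by linarith)]
  have hw0 := pos_of_mem_region h3
  have e := pl_sub_mul h0 hw0
  have h5 := one_add_pl_le hlam hz2
  have h6 : 0 ≤ pl w.2 - pl (z.2 + w.2) := by
    have := pl_anti hw0 (by linarith : w.2 ≤ z.2 + w.2)
    linarith
  have h7 : pl (21 / 2 * lam ^ 2) ≤ pl w.2 := pl_anti hw0 (by linarith [h2.2])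
  have h8 := pl_pos (add_pos h0 hw0)
  have h9 := pl_pos hw0
  calc pl (21 / 2 * lam ^ 2) ≤ (1 + pl (z.2 + w.2)) * pl w.2 := by nlinarith
    _ = (pl w.2 - pl (z.2 + w.2)) * (1 + pl z.2) := e.symm
    _ ≤ (pl w.2 - pl (z.2 + w.2)) * plBound lam := mul_le_mul_of_nonneg_left h5 h6

theorem exists_le_freq {lam : ℝ} (hlam : 0 < lam) :
    ∃ c : ℝ, 0 < c ∧ ∀ z : ℝ × ℝ, z.1 ^ 2 ≤ z.2 → lam ^ 2 ≤ z.2 → c * wt z ≤ freq lam z := by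
  obtain ⟨c₁, hc₁, h₁⟩ := exists_le_integral_mergeFun hlam
  refine ⟨min (1 / (25 * (1 / lam + 1) ^ 3)) (2 * c₁ / (1 + 2 * lam) ^ 3), by positivity,
    fun z hz1 hz2 => ?_⟩
  have h0 : 0 < z.2 := lt_of_lt_of_le (by positivity) hz2
  have hs : lam ≤ Real.sqrt z.2 := Real.le_sqrt_of_sq_le hz2
  have hw0 : 0 ≤ wt z := zero_le_one.trans (one_le_wt z)
  have hd : 0 ≤ ∫ w, decayFun lam z w := integral_nonneg (decayFun_nonneg lam z)
  have hm : 0 ≤ ∫ w, mergeFun lam z w := integral_nonneg (mergeFun_nonneg h0.le)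
  rw [freq_eq]
  rcases le_total (5 / 2 * lam ^ 2) z.2 with hE | hE
  · have h := le_integral_decayFun hlam hz1 hE
    have h2 : wt z ≤ ((1 / lam + 1) * Real.sqrt z.2) ^ 3 := by
      unfold wt
      refine pow_le_pow_left₀ (by positivity) ?_ 3
      have : 1 ≤ 1 / lam * Real.sqrt z.2 := by
        rw [one_div, inv_mul_eq_div, one_le_div hlam]
        exact hs
      linarith
    calc min (1 / (25 * (1 / lam + 1) ^ 3)) (2 * c₁ / (1 + 2 * lam) ^ 3) * wt z
        ≤ 1 / (25 * (1 / lam + 1) ^ 3) * ((1 / lam + 1) * Real.sqrt z.2) ^ 3 :=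
          mul_le_mul (min_le_left _ _) h2 hw0 (by positivity)
      _ = Real.sqrt z.2 ^ 3 / 25 := by
          have : (1 / lam + 1) ≠ 0 := by positivity
          rw [mul_pow]
          field_simp
      _ ≤ _ := by linarith
  · have h := h₁ z hz1 hz2 hE
    have h2 : wt z ≤ (1 + 2 * lam) ^ 3 := by
      unfold wt
      refine pow_le_pow_left₀ (by positivity) ?_ 3
      have : Real.sqrt z.2 ≤ 2 * lam := Real.sqrt_le_iff.2 ⟨by positivity, by nlinarith⟩
      linarith
    calc min (1 / (25 * (1 / lam + 1) ^ 3)) (2 * c₁ / (1 + 2 * lam) ^ 3) * wt z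
        ≤ 2 * c₁ / (1 + 2 * lam) ^ 3 * (1 + 2 * lam) ^ 3 :=
          mul_le_mul (min_le_right _ _) h2 hw0 (by positivity)
      _ = 2 * c₁ := by
          have : (1 + 2 * lam) ^ 3 ≠ 0 := by positivity
          field_simp
      _ ≤ _ := by linarith

theorem exists_om_bounds {lam : ℝ} (hlam : 0 < lam) :
    ∃ c C : ℝ, 0 < c ∧ 0 < C ∧ ∀ z ∈ region lam,
      c * (Real.exp (-z.2) * wt z) ≤ om lam z ∧ om lam z ≤ C * (Real.exp (-z.2) * wt z) := by
  obtain ⟨c, hc, h1⟩ := exists_le_freq hlam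
  obtain ⟨C, hC, h2⟩ := exists_freq_le hlam
  have hB := one_le_plBound hlam
  refine ⟨c, plBound lam ^ 2 * C, hc, by positivity, fun z hz => ?_⟩
  have h0 := pos_of_mem_region hz
  have hp := pl_pos h0
  have e1 := exp_le_pl h0
  have e2 := pl_le_exp hlam hz.2
  have e3 := one_add_pl_le hlam hz.2
  have hw := zero_le_one.trans (one_le_wt z)
  have hf := h1 z hz.1.le hz.2
  have hf0 : 0 ≤ freq lam z := le_trans (by positivity) hf
  have hexp := Real.exp_pos (-z.2)
  rw [om_eq hz]
  constructor
  · calc c * (Real.exp (-z.2) * wt z) = Real.exp (-z.2) * 1 * (c * wt z) := by ring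
      _ ≤ pl z.2 * (1 + pl z.2) * freq lam z := by
          gcongr
          linarith
  · calc pl z.2 * (1 + pl z.2) * freq lam z
        ≤ plBound lam * Real.exp (-z.2) * plBound lam * (C * wt z) := by
          gcongr
          exact h2 z h0.le
      _ = _ := by ring

theorem om_pos {lam : ℝ} (hlam : 0 < lam) {z : ℝ × ℝ} (hz : z ∈ region lam) : 0 < om lam z := by
  obtain ⟨c, C, hc, -, h⟩ := exists_om_bounds hlam
  have := one_le_wt z
  exact lt_of_lt_of_le (by positivity) (h z hz).1

theorem om_eq_zero {lam : ℝ} {z : ℝ × ℝ} (hz : z ∉ region lam) : om lam z = 0 := by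
  unfold om
  have h1 : ∀ w, bker lam w (z - w) = 0 := fun w =>
    bker_eq_zero_sum (by rwa [add_sub_cancel])
  simp [h1, bker_eq_zero_left _ hz]

theorem om_nonneg (lam : ℝ) (z : ℝ × ℝ) : 0 ≤ om lam z := by
  have h1 : 0 ≤ ∫ w, bker lam w (z - w) := integral_nonneg fun w => bker_nonneg _ _ _
  have h2 : 0 ≤ ∫ w, bker lam z w := integral_nonneg fun w => bker_nonneg _ _ _
  unfold om
  linarith

/-- Polynomial factors are absorbed by half of the exponential decay. -/
theorem one_add_pow_four_le {E : ℝ} (hE : 0 ≤ E) :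
    (1 + E) ^ 4 * Real.exp (-E) ≤ 8 ^ 4 * Real.exp (-(1 / 2 * E)) := by
  have h1 : 1 + E ≤ 8 * Real.exp (E / 8) := by linarith [Real.add_one_le_exp (E / 8)]
  have h2 := pow_le_pow_left₀ (by linarith) h1 4
  have h3 : (8 * Real.exp (E / 8)) ^ 4 = 8 ^ 4 * Real.exp (E / 2) := by
    rw [mul_pow, ← Real.exp_nat_mul]
    congr 2
    push_cast
    ring
  calc (1 + E) ^ 4 * Real.exp (-E) ≤ 8 ^ 4 * Real.exp (E / 2) * Real.exp (-E) := by
        rw [← h3]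
        exact mul_le_mul_of_nonneg_right h2 (Real.exp_pos _).le
    _ = 8 ^ 4 * Real.exp (-(1 / 2 * E)) := by
        rw [mul_assoc, ← Real.exp_add]
        congr 2
        ring

theorem wt_le {z : ℝ × ℝ} (hz : 0 ≤ z.2) : wt z ≤ 4 * (1 + z.2) ^ 2 := by
  have hs := Real.sqrt_nonneg z.2
  have hss := Real.sq_sqrt hz
  have h1 : (1 + Real.sqrt z.2) ^ 2 ≤ 2 * (1 + z.2) := by
    nlinarith [sq_nonneg (1 - Real.sqrt z.2)]
  have h2 : 1 + Real.sqrt z.2 ≤ 2 * (1 + z.2) := by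
    nlinarith [sq_nonneg (1 - Real.sqrt z.2)]
  calc wt z = (1 + Real.sqrt z.2) ^ 2 * (1 + Real.sqrt z.2) := by unfold wt; ring
    _ ≤ 2 * (1 + z.2) * (2 * (1 + z.2)) := mul_le_mul h1 h2 (by positivity) (by linarith)
    _ = _ := by ring

/-- Collision invariants have finite norm, even with the weight `(1 + |p|)³`. -/
theorem integrable_invariant (lam a b : ℝ) : IntegrableOn
    (fun z : ℝ × ℝ => Real.exp (-z.2) * (wt z * (a * z.2 + b * z.1) ^ 2)) (region lam) := by
  have hm := measurable_wt
  refine ((integrable_expW lam (a := 1 / 2) (by norm_num)).const_mul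
    (4 * (2 * a ^ 2 + 2 * b ^ 2) * 8 ^ 4)).integrableOn.mono'
    (Measurable.aestronglyMeasurable (by fun_prop)) ?_
  refine (ae_restrict_mem (measurableSet_region lam)).mono fun z hz => ?_
  have h0 := pos_of_mem_region hz
  have hw := zero_le_one.trans (one_le_wt z)
  rw [Real.norm_eq_abs, abs_of_nonneg (by positivity), expW_of_mem _ hz]
  have h1 : (a * z.2 + b * z.1) ^ 2 ≤ (2 * a ^ 2 + 2 * b ^ 2) * (1 + z.2) ^ 2 := by
    have h2 : z.1 ^ 2 ≤ (1 + z.2) ^ 2 := by nlinarith [hz.1]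
    have h3 : z.2 ^ 2 ≤ (1 + z.2) ^ 2 := by nlinarith
    nlinarith [sq_nonneg (a * z.2 - b * z.1), mul_le_mul_of_nonneg_left h2 (sq_nonneg b),
      mul_le_mul_of_nonneg_left h3 (sq_nonneg a)]
  calc Real.exp (-z.2) * (wt z * (a * z.2 + b * z.1) ^ 2)
      ≤ Real.exp (-z.2) * (4 * (1 + z.2) ^ 2 * ((2 * a ^ 2 + 2 * b ^ 2) * (1 + z.2) ^ 2)) := by
        gcongr
        exact wt_le h0.le
    _ = 4 * (2 * a ^ 2 + 2 * b ^ 2) * ((1 + z.2) ^ 4 * Real.exp (-z.2)) := by ring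
    _ ≤ 4 * (2 * a ^ 2 + 2 * b ^ 2) * (8 ^ 4 * Real.exp (-(1 / 2 * z.2))) :=
        mul_le_mul_of_nonneg_left (one_add_pow_four_le h0.le) (by positivity)
    _ = _ := by ring

/-! ### The quadratic form of the linearized operator -/

/-- The entropy dissipation `∫∫ b (g(p₂+p₃) - g(p₂) - g(p₃))²`. -/
noncomputable def collForm (lam : ℝ) (g : ℝ × ℝ → ℝ) : ℝ :=
  ∫ v : (ℝ × ℝ) × (ℝ × ℝ), bker lam v.1 v.2 * (g (v.1 + v.2) - g v.1 - g v.2) ^ 2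
    ∂(volume.prod volume)

theorem collForm_nonneg (lam : ℝ) (g : ℝ × ℝ → ℝ) : 0 ≤ collForm lam g :=
  integral_nonneg fun _ => mul_nonneg (bker_nonneg _ _ _) (sq_nonneg _)

theorem integral_shear {G : (ℝ × ℝ) × (ℝ × ℝ) → ℝ} (hG : Measurable G) :
    (Integrable (fun v : (ℝ × ℝ) × (ℝ × ℝ) => G (v.1 - v.2, v.2)) (volume.prod volume) ↔
      Integrable G (volume.prod volume)) ∧
    ∫ v : (ℝ × ℝ) × (ℝ × ℝ), G (v.1 - v.2, v.2) ∂(volume.prod volume) =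
      ∫ v, G v ∂(volume.prod volume) := by
  have hS := measurePreserving_sub_prod (volume : Measure (ℝ × ℝ)) (volume : Measure (ℝ × ℝ))
  refine ⟨hS.integrable_comp hG.aestronglyMeasurable, ?_⟩
  have h := integral_map (f := G) hS.measurable.aemeasurable (by
    rw [hS.map_eq]; exact hG.aestronglyMeasurable)
  rw [← h, hS.map_eq]

theorem measurable_bker_comp (lam : ℝ) {φ ψ : (ℝ × ℝ) × (ℝ × ℝ) → ℝ × ℝ} (hφ : Measurable φ)
    (hψ : Measurable ψ) : Measurable fun v => bker lam (φ v) (ψ v) :=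
  (measurable_bker lam).comp (hφ.prodMk hψ)

theorem integrable_mul_sub_right {k H : ℝ × ℝ → ℝ} (hk : Integrable k) (hH : Integrable H)
    (hkm : Measurable k) (hHm : Measurable H) :
    Integrable (fun v : (ℝ × ℝ) × (ℝ × ℝ) => k (v.1 - v.2) * H v.2) (volume.prod volume) :=
  (integral_shear (G := fun v => k v.1 * H v.2) (by fun_prop)).1.2 (hk.mul_prod hH)

theorem integrable_mul_sub_left {k H : ℝ × ℝ → ℝ} (hk : Integrable k) (hH : Integrable H)
    (hkm : Measurable k) (hHm : Measurable H) :
    Integrable (fun v : (ℝ × ℝ) × (ℝ × ℝ) => k (v.1 - v.2) * H v.1) (volume.prod volume) := by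
  have h1 : Integrable (fun v : (ℝ × ℝ) × (ℝ × ℝ) => k v.1 * H (v.1 + v.2))
      (volume.prod volume) :=
    ((measurePreserving_prod_add (volume : Measure (ℝ × ℝ))
      (volume : Measure (ℝ × ℝ))).integrable_comp
      (g := fun v : (ℝ × ℝ) × (ℝ × ℝ) => k v.1 * H v.2)
      (Measurable.aestronglyMeasurable (by fun_prop))).2 (hk.mul_prod hH)
  have h2 := (integral_shear (G := fun v => k v.1 * H (v.1 + v.2)) (by fun_prop)).1.2 h1
  simpa using h2

/-- `∫∫ b(w, z-w) |g(z) g(w)| < ∞` for `g ∈ L²`, because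
`exp(-E) = exp(-(E-E')/2) exp(-E/2) exp(-E'/2)`: the kernel is dominated by a convolution. -/
theorem integrable_bker_sub_mul {lam : ℝ} (hlam : 0 < lam) {g : ℝ × ℝ → ℝ} (hg : Measurable g)
    (hi : Integrable fun z => expW lam 1 z * g z ^ 2) :
    Integrable (fun v : (ℝ × ℝ) × (ℝ × ℝ) => bker lam v.2 (v.1 - v.2) * (g v.1 * g v.2))
      (volume.prod volume) := by
  have hB := one_le_plBound hlam
  have hk := integrable_expW lam (a := 1 / 2) (by norm_num)
  have hkm := measurable_expW lam (1 / 2)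
  have hem := measurable_expW lam 1
  have hHm : Measurable fun z => expW lam 1 z * g z ^ 2 := by fun_prop
  have h1 := (integrable_mul_sub_left hk hi hkm hHm).add (integrable_mul_sub_right hk hi hkm hHm)
  refine (h1.const_mul (plBound lam ^ 3)).mono'
    (((measurable_bker_comp lam measurable_snd (measurable_fst.sub measurable_snd)).mul
      (by fun_prop)).aestronglyMeasurable) (Eventually.of_forall fun v => ?_)
  rw [norm_mul, Real.norm_eq_abs, abs_of_nonneg (bker_nonneg _ _ _), Real.norm_eq_abs]
  have e0 := expW_nonneg lam (1 / 2) (v.1 - v.2)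
  have e1 := expW_nonneg lam 1 v.1
  have e2 := expW_nonneg lam 1 v.2
  have hb := bker_le hlam v.2 (v.1 - v.2)
  simp only [Pi.add_apply]
  by_cases h : v.2 ∈ region lam ∧ v.1 - v.2 ∈ region lam ∧ v.1 ∈ region lam
  · obtain ⟨h2, h3, h1⟩ := h
    rw [expW_of_mem _ h2, expW_of_mem _ h3] at hb
    rw [expW_of_mem _ h1, expW_of_mem _ h2, expW_of_mem _ h3]
    set a := Real.exp (-(1 / 2 * v.1.2))
    set b := Real.exp (-(1 / 2 * v.2.2))
    have ha : Real.exp (-(1 * v.1.2)) = a ^ 2 := by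
      rw [← Real.exp_nat_mul]; congr 1; push_cast; ring
    have hb' : Real.exp (-(1 * v.2.2)) = b ^ 2 := by
      rw [← Real.exp_nat_mul]; congr 1; push_cast; ring
    have hc : Real.exp (-(1 * v.2.2)) * Real.exp (-(1 * (v.1 - v.2).2)) =
        Real.exp (-(1 / 2 * (v.1 - v.2).2)) * (a * b) := by
      rw [← Real.exp_add, ← Real.exp_add, ← Real.exp_add]
      congr 1
      rw [Prod.snd_sub]
      ring
    rw [hc] at hb
    rw [ha, hb']
    have hab : a * b * |g v.1 * g v.2| ≤ a ^ 2 * g v.1 ^ 2 + b ^ 2 * g v.2 ^ 2 := by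
      rw [abs_mul, ← sq_abs (g v.1), ← sq_abs (g v.2)]
      nlinarith [sq_nonneg (a * |g v.1| - b * |g v.2|), sq_nonneg (a * |g v.1|),
        sq_nonneg (b * |g v.2|)]
    calc bker lam v.2 (v.1 - v.2) * |g v.1 * g v.2|
        ≤ plBound lam ^ 3 * (Real.exp (-(1 / 2 * (v.1 - v.2).2)) * (a * b)) *
            |g v.1 * g v.2| := mul_le_mul_of_nonneg_right hb (abs_nonneg _)
      _ = plBound lam ^ 3 * (Real.exp (-(1 / 2 * (v.1 - v.2).2)) *
            (a * b * |g v.1 * g v.2|)) := by ring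
      _ ≤ plBound lam ^ 3 * (Real.exp (-(1 / 2 * (v.1 - v.2).2)) *
            (a ^ 2 * g v.1 ^ 2 + b ^ 2 * g v.2 ^ 2)) := by gcongr
      _ = _ := by ring
  · have hz : bker lam v.2 (v.1 - v.2) = 0 :=
      if_neg fun h' => h ⟨h'.1, h'.2.1, by simpa using h'.2.2⟩
    rw [hz, zero_mul]
    positivity

theorem integrable_bker_mul {lam : ℝ} (hlam : 0 < lam) {g : ℝ × ℝ → ℝ} (hg : Measurable g)
    (hi : Integrable fun z => expW lam 1 z * g z ^ 2) :
    Integrable (fun v : (ℝ × ℝ) × (ℝ × ℝ) => bker lam v.1 v.2 * (g v.1 * g v.2))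
      (volume.prod volume) := by
  have hB := one_le_plBound hlam
  have hem := measurable_expW lam 1
  have h1 : Integrable fun z => expW lam 1 z * |g z| := by
    refine ((integrable_expW lam one_pos).add hi).mono'
      (Measurable.aestronglyMeasurable (by fun_prop)) (Eventually.of_forall fun z => ?_)
    have e := expW_nonneg lam 1 z
    rw [Real.norm_eq_abs, abs_of_nonneg (mul_nonneg e (abs_nonneg _))]
    simp only [Pi.add_apply]
    have : |g z| ≤ 1 + g z ^ 2 := by
      rw [← sq_abs]
      nlinarith [sq_nonneg (|g z| - 1), abs_nonneg (g z)]
    nlinarith [mul_le_mul_of_nonneg_left this e]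
  refine ((h1.mul_prod h1).const_mul (plBound lam ^ 3)).mono'
    (((measurable_bker lam).mul (by fun_prop)).aestronglyMeasurable)
    (Eventually.of_forall fun v => ?_)
  rw [norm_mul, Real.norm_eq_abs, abs_of_nonneg (bker_nonneg _ _ _), Real.norm_eq_abs, abs_mul]
  calc bker lam v.1 v.2 * (|g v.1| * |g v.2|)
      ≤ plBound lam ^ 3 * (expW lam 1 v.1 * expW lam 1 v.2) * (|g v.1| * |g v.2|) :=
        mul_le_mul_of_nonneg_right (bker_le hlam _ _) (by positivity)
    _ = _ := by ring

/-- `∫∫ κ g g` as an integral over collisions; the two decay parts of `κ` are transposes of each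
other and contribute equally. -/
theorem integrable_kap_mul {lam : ℝ} (hlam : 0 < lam) {g : ℝ × ℝ → ℝ} (hg : Measurable g)
    (hi : Integrable fun z => expW lam 1 z * g z ^ 2) :
    Integrable (fun v : (ℝ × ℝ) × (ℝ × ℝ) => kap lam v.1 v.2 * (g v.1 * g v.2))
      (volume.prod volume) ∧
    kernelForm volume (fun v => kap lam v.1 v.2) g =
      2 * (∫ v : (ℝ × ℝ) × (ℝ × ℝ), bker lam v.1 v.2 * (g (v.1 + v.2) * g v.2)
        ∂(volume.prod volume))
      - ∫ v : (ℝ × ℝ) × (ℝ × ℝ), bker lam v.1 v.2 * (g v.1 * g v.2) ∂(volume.prod volume) := by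
  have h1 := integrable_bker_sub_mul hlam hg hi
  have h2 := integrable_bker_mul hlam hg hi
  have h3 : Integrable (fun v : (ℝ × ℝ) × (ℝ × ℝ) => bker lam v.1 (v.2 - v.1) * (g v.1 * g v.2))
      (volume.prod volume) := by
    refine h1.swap.congr (Eventually.of_forall fun v => ?_)
    simp only [Function.comp, Prod.fst_swap, Prod.snd_swap]
    ring
  have e13 : ∫ v : (ℝ × ℝ) × (ℝ × ℝ), bker lam v.1 (v.2 - v.1) * (g v.1 * g v.2)
      ∂(volume.prod volume) = ∫ v : (ℝ × ℝ) × (ℝ × ℝ), bker lam v.2 (v.1 - v.2) * (g v.1 * g v.2)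
      ∂(volume.prod volume) := by
    rw [← integral_prod_swap]
    congr 1
    funext v
    simp only [Prod.fst_swap, Prod.snd_swap]
    ring
  have e1 := (integral_shear (G := fun v => bker lam v.1 v.2 * (g (v.1 + v.2) * g v.2))
    ((measurable_bker lam).mul (by fun_prop))).2
  simp only [sub_add_cancel] at e1
  have e1' : ∫ v : (ℝ × ℝ) × (ℝ × ℝ), bker lam v.2 (v.1 - v.2) * (g v.1 * g v.2)
      ∂(volume.prod volume) = ∫ v : (ℝ × ℝ) × (ℝ × ℝ), bker lam v.1 v.2 * (g (v.1 + v.2) * g v.2)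
        ∂(volume.prod volume) := by
    rw [← e1]
    congr 1
    funext v
    rw [bker_symm]
  have hk : ∀ v : (ℝ × ℝ) × (ℝ × ℝ), kap lam v.1 v.2 * (g v.1 * g v.2) =
      bker lam v.2 (v.1 - v.2) * (g v.1 * g v.2) + bker lam v.1 (v.2 - v.1) * (g v.1 * g v.2)
        - bker lam v.1 v.2 * (g v.1 * g v.2) := fun v => by unfold kap; ring
  unfold kernelForm
  simp only [hk]
  refine ⟨(h1.add h3).sub h2, ?_⟩
  have := integral_sub (h1.add h3) h2
  simp only [Pi.add_apply] at this
  rw [this, integral_add h1 h3, e13, e1']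
  ring

theorem expW_le_om {lam : ℝ} (hlam : 0 < lam) : ∃ C : ℝ, 0 < C ∧ ∀ z,
    expW lam 1 z ≤ C * om lam z := by
  obtain ⟨c, C, hc, -, h⟩ := exists_om_bounds hlam
  refine ⟨c⁻¹, inv_pos.2 hc, fun z => ?_⟩
  by_cases hz : z ∈ region lam
  · rw [expW_of_mem _ hz, inv_mul_eq_div, le_div_iff₀ hc, one_mul]
    have h1 := (h z hz).1
    have h2 := one_le_wt z
    have h3 := Real.exp_pos (-z.2)
    have h4 : c * (Real.exp (-z.2) * 1) ≤ c * (Real.exp (-z.2) * wt z) := by gcongr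
    linarith
  · rw [expW_of_notMem _ hz, om_eq_zero hz, mul_zero]

theorem integrable_expW_mul_sq {lam : ℝ} (hlam : 0 < lam) {g : ℝ × ℝ → ℝ} (hg : Measurable g)
    (hi : Integrable fun z => om lam z * g z ^ 2) :
    Integrable fun z => expW lam 1 z * g z ^ 2 := by
  obtain ⟨C, hC, h⟩ := expW_le_om hlam
  have hem := measurable_expW lam 1
  refine (hi.const_mul C).mono' (Measurable.aestronglyMeasurable (by fun_prop))
    (Eventually.of_forall fun z => ?_)
  rw [Real.norm_eq_abs, abs_of_nonneg (mul_nonneg (expW_nonneg _ _ _) (sq_nonneg _)), ← mul_assoc]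
  exact mul_le_mul_of_nonneg_right (h z) (sq_nonneg _)

/-- The form of `ν - K` is the entropy dissipation. Each collision contributes with the weight
`b` the three diagonal terms, which make up `ν`, and the three products, which make up `K`. -/
theorem collForm_eq {lam : ℝ} (hlam : 0 < lam) {g : ℝ × ℝ → ℝ} (hg : Measurable g)
    (hi : Integrable fun z => om lam z * g z ^ 2) :
    Integrable (fun v : (ℝ × ℝ) × (ℝ × ℝ) =>
      bker lam v.1 v.2 * (g (v.1 + v.2) - g v.1 - g v.2) ^ 2) (volume.prod volume) ∧
    collForm lam g = (∫ z, om lam z * g z ^ 2) -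
      2 * kernelForm volume (fun v => kap lam v.1 v.2) g := by
  have hw := integrable_expW_mul_sq hlam hg hi
  have hbm := measurable_bker lam
  have hbm' := measurable_bker_comp lam measurable_snd
    ((measurable_fst (α := ℝ × ℝ) (β := ℝ × ℝ)).sub measurable_snd)
  have n1 : ∀ z, 0 ≤ ∫ w, bker lam w (z - w) := fun z => integral_nonneg fun w => bker_nonneg _ _ _
  have n2 : ∀ z, 0 ≤ ∫ w, bker lam z w := fun z => integral_nonneg fun w => bker_nonneg _ _ _
  have m1 : Measurable fun z => ∫ w, bker lam w (z - w) :=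
    (hbm'.stronglyMeasurable.integral_prod_right').measurable
  have m2 : Measurable fun z => ∫ w, bker lam z w :=
    (hbm.stronglyMeasurable.integral_prod_right').measurable
  have i1 : Integrable fun z => (∫ w, bker lam w (z - w)) * g z ^ 2 := by
    refine hi.mono' (Measurable.aestronglyMeasurable (by fun_prop))
      (Eventually.of_forall fun z => ?_)
    rw [Real.norm_eq_abs, abs_of_nonneg (mul_nonneg (n1 z) (sq_nonneg _))]
    refine mul_le_mul_of_nonneg_right ?_ (sq_nonneg _)
    unfold om
    linarith [n2 z]
  have i2 : Integrable fun z => (∫ w, bker lam z w) * g z ^ 2 := by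
    refine hi.mono' (Measurable.aestronglyMeasurable (by fun_prop))
      (Eventually.of_forall fun z => ?_)
    rw [Real.norm_eq_abs, abs_of_nonneg (mul_nonneg (n2 z) (sq_nonneg _))]
    refine mul_le_mul_of_nonneg_right ?_ (sq_nonneg _)
    unfold om
    linarith [n1 z, n2 z]
  have A1 : Integrable (fun v : (ℝ × ℝ) × (ℝ × ℝ) => bker lam v.2 (v.1 - v.2) * g v.1 ^ 2)
      (volume.prod volume) := by
    refine (integrable_prod_iff (hbm'.mul (by fun_prop)).aestronglyMeasurable).2
      ⟨Eventually.of_forall fun z => (integrable_bker_sub hlam z).mul_const (g z ^ 2), ?_⟩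
    refine i1.congr (Eventually.of_forall fun z => ?_)
    simp only
    rw [← integral_mul_const]
    congr 1
    funext w
    exact (abs_of_nonneg (mul_nonneg (bker_nonneg _ _ _) (sq_nonneg _))).symm
  have A2 : Integrable (fun v : (ℝ × ℝ) × (ℝ × ℝ) => bker lam v.1 v.2 * g v.1 ^ 2)
      (volume.prod volume) := by
    refine (integrable_prod_iff (hbm.mul (by fun_prop)).aestronglyMeasurable).2
      ⟨Eventually.of_forall fun z => (integrable_bker hlam z).mul_const (g z ^ 2), ?_⟩
    refine i2.congr (Eventually.of_forall fun z => ?_)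
    simp only
    rw [← integral_mul_const]
    congr 1
    funext w
    exact (abs_of_nonneg (mul_nonneg (bker_nonneg _ _ _) (sq_nonneg _))).symm
  have E1 : ∫ v : (ℝ × ℝ) × (ℝ × ℝ), bker lam v.2 (v.1 - v.2) * g v.1 ^ 2 ∂(volume.prod volume)
      = ∫ z, (∫ w, bker lam w (z - w)) * g z ^ 2 := by
    rw [integral_prod _ A1]
    simp only [integral_mul_const]
  have E2 : ∫ v : (ℝ × ℝ) × (ℝ × ℝ), bker lam v.1 v.2 * g v.1 ^ 2 ∂(volume.prod volume)
      = ∫ z, (∫ w, bker lam z w) * g z ^ 2 := by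
    rw [integral_prod _ A2]
    simp only [integral_mul_const]
  have S1 := integral_shear (G := fun v => bker lam v.1 v.2 * g (v.1 + v.2) ^ 2)
    (hbm.mul (by fun_prop))
  simp only [sub_add_cancel, bker_symm lam (_ - _)] at S1
  have I1 := S1.1.1 A1
  have I3 : Integrable (fun v : (ℝ × ℝ) × (ℝ × ℝ) => bker lam v.1 v.2 * g v.2 ^ 2)
      (volume.prod volume) := by
    refine A2.swap.congr (Eventually.of_forall fun v => ?_)
    simp only [Function.comp, Prod.fst_swap, Prod.snd_swap]
    rw [bker_symm]
  have E3 : ∫ v : (ℝ × ℝ) × (ℝ × ℝ), bker lam v.1 v.2 * g v.2 ^ 2 ∂(volume.prod volume)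
      = ∫ v : (ℝ × ℝ) × (ℝ × ℝ), bker lam v.1 v.2 * g v.1 ^ 2 ∂(volume.prod volume) := by
    rw [← integral_prod_swap]
    congr 1
    funext v
    simp only [Prod.fst_swap, Prod.snd_swap]
    rw [bker_symm]
  have SX := integral_shear (G := fun v => bker lam v.1 v.2 * (g (v.1 + v.2) * g v.2))
    (hbm.mul (by fun_prop))
  simp only [sub_add_cancel, bker_symm lam (_ - _)] at SX
  have X1 := SX.1.1 (integrable_bker_sub_mul hlam hg hw)
  have X2 : Integrable (fun v : (ℝ × ℝ) × (ℝ × ℝ) => bker lam v.1 v.2 * (g (v.1 + v.2) * g v.1))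
      (volume.prod volume) := by
    refine X1.swap.congr (Eventually.of_forall fun v => ?_)
    simp only [Function.comp, Prod.fst_swap, Prod.snd_swap]
    rw [bker_symm, add_comm]
  have EX2 : ∫ v : (ℝ × ℝ) × (ℝ × ℝ), bker lam v.1 v.2 * (g (v.1 + v.2) * g v.1)
      ∂(volume.prod volume) = ∫ v : (ℝ × ℝ) × (ℝ × ℝ), bker lam v.1 v.2 * (g (v.1 + v.2) * g v.2)
      ∂(volume.prod volume) := by
    rw [← integral_prod_swap]
    congr 1
    funext v
    simp only [Prod.fst_swap, Prod.snd_swap]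
    rw [bker_symm, add_comm]
  have X3 := integrable_bker_mul hlam hg hw
  have hexp : ∀ v : (ℝ × ℝ) × (ℝ × ℝ),
      bker lam v.1 v.2 * (g (v.1 + v.2) - g v.1 - g v.2) ^ 2 =
      (bker lam v.1 v.2 * g (v.1 + v.2) ^ 2 + bker lam v.1 v.2 * g v.1 ^ 2
        + bker lam v.1 v.2 * g v.2 ^ 2) - 2 * ((bker lam v.1 v.2 * (g (v.1 + v.2) * g v.2)
        + bker lam v.1 v.2 * (g (v.1 + v.2) * g v.1)) - bker lam v.1 v.2 * (g v.1 * g v.2)) :=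
    fun v => by ring
  unfold collForm
  simp only [hexp]
  have P := (I1.add A2).add I3
  have R := ((X1.add X2).sub X3).const_mul 2
  refine ⟨P.sub R, ?_⟩
  have q1 := integral_sub P R
  have q2 := integral_add (I1.add A2) I3
  have q3 := integral_add I1 A2
  have q4 := integral_sub (X1.add X2) X3
  have q5 := integral_add X1 X2
  simp only [Pi.add_apply, Pi.sub_apply] at q1 q2 q3 q4 q5
  rw [q1, integral_const_mul, q2, q3, q4, q5, EX2, E3, E2, ← S1.2, E1,
    (integrable_kap_mul hlam hg hw).2]
  have hom : ∫ z, om lam z * g z ^ 2 = (∫ z, (∫ w, bker lam w (z - w)) * g z ^ 2)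
      + 2 * ∫ z, (∫ w, bker lam z w) * g z ^ 2 := by
    rw [← integral_const_mul, ← integral_add i1 (i2.const_mul 2)]
    congr 1
    funext z
    unfold om
    ring
  rw [hom]
  ring

/-! ### The symmetrized kernel is square integrable -/

/-- The kernel of `K` in the symmetric normalization in which `ν` becomes the identity. -/
noncomputable def symKernel (lam : ℝ) (v : (ℝ × ℝ) × (ℝ × ℝ)) : ℝ :=
  2 * kap lam v.1 v.2 / (Real.sqrt (om lam v.1) * Real.sqrt (om lam v.2))

theorem measurable_symKernel (lam : ℝ) : Measurable (symKernel lam) := by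
  have h1 := measurable_kap lam
  have h2 := measurable_om lam
  unfold symKernel
  exact (h1.const_mul 2).div (by fun_prop)

theorem one_add_mul_le_wt_sq {z : ℝ × ℝ} (hz : z.1 ^ 2 ≤ z.2) :
    (1 + z.1 ^ 2) * (1 + z.2 ^ 2) ≤ wt z ^ 2 := by
  have h0 : 0 ≤ z.2 := (sq_nonneg _).trans hz
  have hs := Real.sqrt_nonneg z.2
  have hss := Real.sq_sqrt h0
  have h1 : 1 + z.2 ≤ (1 + Real.sqrt z.2) ^ 2 := by nlinarith
  have h2 : (1 + z.2) ^ 3 ≤ wt z ^ 2 := by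
    have := pow_le_pow_left₀ (by linarith) h1 3
    calc (1 + z.2) ^ 3 ≤ ((1 + Real.sqrt z.2) ^ 2) ^ 3 := this
      _ = wt z ^ 2 := by unfold wt; ring
  refine le_trans ?_ h2
  calc (1 + z.1 ^ 2) * (1 + z.2 ^ 2) ≤ (1 + z.2) * (1 + z.2) ^ 2 := by gcongr; nlinarith
    _ = (1 + z.2) ^ 3 := by ring

theorem integrable_inv_wt_sq (lam : ℝ) :
    Integrable ((region lam).indicator fun z => (wt z ^ 2)⁻¹) := by
  have hm := measurable_wt
  refine (integrable_inv_one_add_sq.mul_prod integrable_inv_one_add_sq).mono'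
    ((Measurable.indicator (by fun_prop) (measurableSet_region lam)).aestronglyMeasurable)
    (Eventually.of_forall fun z => ?_)
  rw [Real.norm_eq_abs, abs_of_nonneg (Set.indicator_nonneg (fun _ _ => by positivity) z)]
  by_cases hz : z ∈ region lam
  · rw [Set.indicator_of_mem hz, ← mul_inv]
    exact inv_anti₀ (by positivity) (one_add_mul_le_wt_sq hz.1.le)
  · rw [Set.indicator_of_notMem hz]
    positivity

/-- The bound of one of the two decay kernels: `exp(-2E) / (exp(-E) exp(-E')) = exp(-(E-E'))`
is a convolution kernel, and `ν(p)⁻¹ ν(q)⁻¹` supplies the decay in the remaining variable. -/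
theorem bker_sub_sq_le {lam : ℝ} (hlam : 0 < lam) {c : ℝ} (hc : 0 < c)
    (h : ∀ z ∈ region lam, c * (Real.exp (-z.2) * wt z) ≤ om lam z) {z w : ℝ × ℝ}
    (hz : z ∈ region lam) (hw : w ∈ region lam) :
    bker lam w (z - w) ^ 2 ≤ (plBound lam ^ 3 / c) ^ 2 *
      (expW lam 1 (z - w) * (region lam).indicator (fun z => (wt z ^ 2)⁻¹) w) *
      (om lam z * om lam w) := by
  have hB := one_le_plBound hlam
  by_cases hzw : z - w ∈ region lam
  · have hb := bker_le hlam w (z - w)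
    rw [expW_of_mem _ hw, expW_of_mem _ hzw] at hb
    rw [expW_of_mem _ hzw, Set.indicator_of_mem hw]
    have h1 := h z hz
    have h2 := h w hw
    have w1 := one_le_wt w
    have w2 : wt w ≤ wt z := by
      have := pos_of_mem_region hzw
      rw [Prod.snd_sub] at this
      unfold wt
      gcongr
      linarith
    have hwz : wt w ^ 2 ≤ wt z * wt w := by nlinarith
    have hom : c ^ 2 * (Real.exp (-z.2) * Real.exp (-w.2)) * wt w ^ 2 ≤ om lam z * om lam w := by
      calc c ^ 2 * (Real.exp (-z.2) * Real.exp (-w.2)) * wt w ^ 2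
          ≤ c ^ 2 * (Real.exp (-z.2) * Real.exp (-w.2)) * (wt z * wt w) := by gcongr
        _ = c * (Real.exp (-z.2) * wt z) * (c * (Real.exp (-w.2) * wt w)) := by ring
        _ ≤ om lam z * om lam w :=
            mul_le_mul h1 h2 (by positivity) (om_nonneg _ _)
    calc bker lam w (z - w) ^ 2
        ≤ (plBound lam ^ 3 * (Real.exp (-(1 * w.2)) * Real.exp (-(1 * (z - w).2)))) ^ 2 :=
          pow_le_pow_left₀ (bker_nonneg _ _ _) hb 2
      _ = (plBound lam ^ 3 / c) ^ 2 * (Real.exp (-(1 * (z - w).2)) * (wt w ^ 2)⁻¹) *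
          (c ^ 2 * (Real.exp (-z.2) * Real.exp (-w.2)) * wt w ^ 2) := by
          have e : Real.exp (-(1 * w.2)) * Real.exp (-(1 * (z - w).2)) = Real.exp (-z.2) := by
            rw [← Real.exp_add, Prod.snd_sub]; congr 1; ring
          have e2 : Real.exp (-(1 * (z - w).2)) * Real.exp (-w.2) = Real.exp (-z.2) := by
            rw [← Real.exp_add, Prod.snd_sub]; congr 1; ring
          have hwne : wt w ≠ 0 := by positivity
          rw [e]
          field_simp
          rw [← e2]
          ring_nf
      _ ≤ _ := by gcongr
  · rw [bker_eq_zero_right _ hzw, zero_pow two_ne_zero]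
    have := expW_nonneg lam 1 (z - w)
    have h1 := om_nonneg lam z
    have h2 := om_nonneg lam w
    have h3 : 0 ≤ (region lam).indicator (fun z => (wt z ^ 2)⁻¹) w :=
      Set.indicator_nonneg (fun _ _ => by positivity) w
    positivity

theorem bker_sq_le {lam : ℝ} (hlam : 0 < lam) {c : ℝ} (hc : 0 < c)
    (h : ∀ z ∈ region lam, c * (Real.exp (-z.2) * wt z) ≤ om lam z) {z w : ℝ × ℝ}
    (hz : z ∈ region lam) (hw : w ∈ region lam) :
    bker lam z w ^ 2 ≤ (plBound lam ^ 3 / c) ^ 2 * (expW lam 1 z * expW lam 1 w) *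
      (om lam z * om lam w) := by
  have hB := one_le_plBound hlam
  have hb := bker_le hlam z w
  have key : ∀ z ∈ region lam, c * expW lam 1 z ≤ om lam z := by
    intro z hz
    refine le_trans ?_ (h z hz)
    rw [expW_of_mem _ hz, one_mul]
    exact mul_le_mul_of_nonneg_left
      (le_mul_of_one_le_right (Real.exp_pos _).le (one_le_wt z)) hc.le
  have e1 := expW_nonneg lam 1 z
  have e2 := expW_nonneg lam 1 w
  calc bker lam z w ^ 2 ≤ (plBound lam ^ 3 * (expW lam 1 z * expW lam 1 w)) ^ 2 :=
        pow_le_pow_left₀ (bker_nonneg _ _ _) hb 2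
    _ = (plBound lam ^ 3 / c) ^ 2 * (expW lam 1 z * expW lam 1 w) *
        (c * expW lam 1 z * (c * expW lam 1 w)) := by field_simp
    _ ≤ _ := by
        gcongr
        · exact om_nonneg _ _
        · exact key z hz
        · exact key w hw

theorem integrable_symKernel_sq {lam : ℝ} (hlam : 0 < lam) :
    Integrable (fun v => symKernel lam v ^ 2)
      ((volume.restrict (region lam)).prod (volume.restrict (region lam))) := by
  obtain ⟨c, C, hc, -, h⟩ := exists_om_bounds hlam
  have h' := fun z hz => (h z hz).1
  have hr := measurableSet_region lam
  have hm := measurable_wt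
  have hem := measurable_expW lam 1
  have hI : Measurable ((region lam).indicator fun z => (wt z ^ 2)⁻¹) :=
    Measurable.indicator (by fun_prop) hr
  have he := integrable_expW lam one_pos
  have i1 := integrable_mul_sub_right he (integrable_inv_wt_sq lam) hem hI
  have i2 := i1.swap
  have i3 := he.mul_prod he
  have hd := (((i1.add i2).add i3).const_mul (12 * (plBound lam ^ 3 / c) ^ 2))
  rw [Measure.prod_restrict]
  refine hd.integrableOn.mono' ((measurable_symKernel lam).pow_const 2).aestronglyMeasurable ?_
  refine (ae_restrict_mem (hr.prod hr)).mono fun v hv => ?_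
  obtain ⟨hv1, hv2⟩ := hv
  have o1 := om_pos hlam hv1
  have o2 := om_pos hlam hv2
  have b1 := bker_sub_sq_le hlam hc h' hv1 hv2
  have b2 := bker_sub_sq_le hlam hc h' hv2 hv1
  have b3 := bker_sq_le hlam hc h' hv1 hv2
  rw [Real.norm_eq_abs, abs_of_nonneg (sq_nonneg _)]
  simp only [Pi.add_apply, Function.comp, Prod.fst_swap, Prod.snd_swap]
  unfold symKernel
  rw [div_pow, mul_pow, mul_pow, Real.sq_sqrt o1.le, Real.sq_sqrt o2.le,
    div_le_iff₀ (mul_pos o1 o2)]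
  unfold kap
  generalize bker lam v.2 (v.1 - v.2) = x at *
  generalize bker lam v.1 (v.2 - v.1) = y at *
  generalize bker lam v.1 v.2 = z at *
  have hxyz : (x + y - z) ^ 2 ≤ 3 * (x ^ 2 + y ^ 2 + z ^ 2) := by
    nlinarith [sq_nonneg (x - y), sq_nonneg (x + z), sq_nonneg (y + z)]
  nlinarith

/-! ### Measurable collision invariants -/

/-- The bounded open part `|p| > lam`, `|p|² < N` of `region lam`. -/
def openReg (lam N : ℝ) : Set (ℝ × ℝ) := {z | z.1 ^ 2 < z.2 ∧ lam ^ 2 < z.2 ∧ z.2 < N}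

theorem openReg_subset (lam N : ℝ) : openReg lam N ⊆ region lam :=
  fun _ hz => ⟨hz.1, hz.2.1.le⟩

theorem isOpen_openReg (lam N : ℝ) : IsOpen (openReg lam N) :=
  have h1 : IsOpen {z : ℝ × ℝ | z.1 ^ 2 < z.2} := isOpen_lt (by fun_prop) (by fun_prop)
  have h2 : IsOpen {z : ℝ × ℝ | lam ^ 2 < z.2} := isOpen_lt (by fun_prop) (by fun_prop)
  have h3 : IsOpen {z : ℝ × ℝ | z.2 < N} := isOpen_lt (by fun_prop) (by fun_prop)
  h1.inter (h2.inter h3)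

theorem convex_openReg (lam N : ℝ) : Convex ℝ (openReg lam N) := by
  intro z hz w hw a b ha hb hab
  have hb' : b = 1 - a := by linarith
  obtain ⟨h1, h2, h3⟩ := hz
  obtain ⟨k1, k2, k3⟩ := hw
  have key : ∀ {s t u v : ℝ}, s < t → u < v → a * s + b * u < a * t + b * v := by
    intro s t u v hst huv
    rcases ha.eq_or_lt with h | h
    · have : b = 1 := by linarith
      rw [← h, this]
      linarith
    · nlinarith [mul_lt_mul_of_pos_left hst h, mul_le_mul_of_nonneg_left huv.le hb]
  refine ⟨?_, ?_, ?_⟩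
  · have e : (a * z.1 + b * w.1) ^ 2 ≤ a * z.1 ^ 2 + b * w.1 ^ 2 := by
      subst hb'
      nlinarith [mul_nonneg (mul_nonneg ha hb) (sq_nonneg (z.1 - w.1))]
    simpa using lt_of_le_of_lt e (key h1 k1)
  · have := key h2 k2
    have e : a * lam ^ 2 + b * lam ^ 2 = lam ^ 2 := by rw [← add_mul, hab, one_mul]
    rw [e] at this
    simpa using this
  · have := key h3 k3
    have e : a * N + b * N = N := by rw [← add_mul, hab, one_mul]
    rw [e] at this
    simpa using this

/-- A collision partner of large energy is admissible for all momenta of bounded energy. -/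
theorem openReg_add {lam N : ℝ} {z w : ℝ × ℝ} (hz : z ∈ openReg lam N)
    (hw : w ∈ Metric.ball ((0 : ℝ), 2 * N + 3 + lam ^ 2) 1) :
    w ∈ openReg lam (3 * N + 4 + lam ^ 2) ∧ z + w ∈ openReg lam (3 * N + 4 + lam ^ 2) := by
  rw [Metric.mem_ball, Prod.dist_eq, max_lt_iff, Real.dist_eq, Real.dist_eq, abs_lt, abs_lt] at hw
  obtain ⟨⟨w1, w2⟩, w3, w4⟩ := hw
  obtain ⟨h1, h2, h3⟩ := hz
  have hl := sq_nonneg lam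
  have hN : 0 < N := by linarith
  have hw2 : w.1 ^ 2 < 1 := by nlinarith
  refine ⟨⟨by linarith, by linarith, by linarith⟩, ?_, ?_, ?_⟩
  · rw [Prod.fst_add, Prod.snd_add]
    nlinarith [sq_nonneg (z.1 - w.1)]
  · rw [Prod.snd_add]; linarith
  · rw [Prod.snd_add]; linarith

/-- `g` is additive under almost every collision. -/
def AEAdditive (lam : ℝ) (g : ℝ × ℝ → ℝ) : Prop :=
  ∀ᵐ v : (ℝ × ℝ) × (ℝ × ℝ) ∂(volume.prod volume), v.1 ∈ region lam → v.2 ∈ region lam →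
    v.1 + v.2 ∈ region lam → g (v.1 + v.2) = g v.1 + g v.2

/-- Averaging `g(z) = g(z + w) - g(w)` over `w` with a smooth weight shows that a collision
invariant is almost everywhere equal to a smooth function. -/
theorem AEAdditive.exists_smooth {lam : ℝ} {g : ℝ × ℝ → ℝ} (h : AEAdditive lam g)
    (hloc : LocallyIntegrable ((region lam).indicator g)) (N : ℝ) :
    ∃ S : ℝ × ℝ → ℝ, ContDiff ℝ 1 S ∧ ∀ᵐ z, z ∈ openReg lam N → g z = S z := by
  set c : ℝ × ℝ := -((0 : ℝ), 2 * N + 3 + lam ^ 2) with hc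
  let φ : ContDiffBump c := ⟨1 / 2, 1, by norm_num, by norm_num⟩
  set ψ := φ.normed volume with hψ
  set G := (region lam).indicator g with hG
  have hS : ContDiff ℝ 1 (convolution ψ G (ContinuousLinearMap.lsmul ℝ ℝ) volume) :=
    φ.hasCompactSupport_normed.contDiff_convolution_left (n := 1) _ φ.contDiff_normed hloc
  have hex := (φ.hasCompactSupport_normed (μ := volume)).convolutionExists_left
    (ContinuousLinearMap.lsmul ℝ ℝ) φ.continuous_normed hloc 0
  have hex' : Integrable fun t => ψ t * G (0 - t) := hex
  refine ⟨fun z => convolution ψ G (ContinuousLinearMap.lsmul ℝ ℝ) volume z -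
    ∫ t, ψ t * G (0 - t), hS.sub contDiff_const, ?_⟩
  filter_upwards [Measure.ae_ae_of_ae_prod h] with z hz hzN
  have hz' : ∀ᵐ t, z ∈ region lam → -t ∈ region lam → z + -t ∈ region lam →
      g (z + -t) = g z + g (-t) :=
    (Measure.measurePreserving_neg (volume : Measure (ℝ × ℝ))).quasiMeasurePreserving.ae hz
  have e : convolution ψ G (ContinuousLinearMap.lsmul ℝ ℝ) volume z =
      ∫ t, (ψ t * g z + ψ t * G (0 - t)) := by
    refine integral_congr_ae ?_
    filter_upwards [hz'] with t ht
    simp only [ContinuousLinearMap.lsmul_apply, smul_eq_mul]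
    by_cases h0 : ψ t = 0
    · rw [h0]; ring
    · have hmem : t ∈ Metric.ball c 1 := by
        have : t ∈ Function.support ψ := h0
        rwa [hψ, φ.support_normed_eq] at this
      have hmem' : -t ∈ Metric.ball ((0 : ℝ), 2 * N + 3 + lam ^ 2) 1 := by
        rw [Metric.mem_ball, dist_eq_norm] at hmem ⊢
        rw [← norm_neg]
        convert! hmem using 2
        rw [hc]
        abel
      obtain ⟨h1, h2⟩ := openReg_add hzN hmem'
      have k1 := openReg_subset _ _ h1
      have k2 := openReg_subset _ _ h2
      have := ht (openReg_subset _ _ hzN) k1 k2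
      rw [hG, zero_sub, Set.indicator_of_mem k1, sub_eq_add_neg, Set.indicator_of_mem k2, this]
      ring
  rw [e, integral_add ((φ.integrable_normed).mul_const _) hex', integral_mul_const,
    φ.integral_normed]
  ring

theorem ae_add_pair {p : ℝ × ℝ → Prop} (hp : ∀ᵐ z, p z) :
    ∀ᵐ v : (ℝ × ℝ) × (ℝ × ℝ) ∂(volume.prod volume), p v.1 ∧ p v.2 ∧ p (v.1 + v.2) := by
  have h3 : ∀ᵐ v : (ℝ × ℝ) × (ℝ × ℝ) ∂(volume.prod volume), p (v.1 + v.2) :=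
    (measurePreserving_prod_add (volume : Measure (ℝ × ℝ))
      (volume : Measure (ℝ × ℝ))).quasiMeasurePreserving.ae
      (Measure.quasiMeasurePreserving_snd.ae hp)
  filter_upwards [Measure.quasiMeasurePreserving_fst.ae hp,
    Measure.quasiMeasurePreserving_snd.ae hp, h3] with v h1 h2 h3
  exact ⟨h1, h2, h3⟩

/-- The pairs of momenta which merge within `openReg lam N`. -/
def pairReg (lam N : ℝ) : Set ((ℝ × ℝ) × (ℝ × ℝ)) :=
  {v | v.1 ∈ openReg lam N ∧ v.2 ∈ openReg lam N ∧ v.1 + v.2 ∈ openReg lam N}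

theorem isOpen_pairReg (lam N : ℝ) : IsOpen (pairReg lam N) :=
  ((isOpen_openReg lam N).preimage continuous_fst).inter
    (((isOpen_openReg lam N).preimage continuous_snd).inter
      ((isOpen_openReg lam N).preimage (continuous_fst.add continuous_snd)))

theorem AEAdditive.additive_of_continuous {lam N : ℝ} {g S : ℝ × ℝ → ℝ} (h : AEAdditive lam g)
    (hS : Continuous S) (hgS : ∀ᵐ z, z ∈ openReg lam N → g z = S z) :
    ∀ v ∈ pairReg lam N, S (v.1 + v.2) = S v.1 + S v.2 := by
  have hO := isOpen_pairReg lam N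
  refine Measure.eqOn_open_of_ae_eq (μ := (volume : Measure (ℝ × ℝ)).prod volume)
    (f := fun v : (ℝ × ℝ) × (ℝ × ℝ) => S (v.1 + v.2)) (g := fun v => S v.1 + S v.2)
    ?_ hO (by fun_prop) (by fun_prop)
  refine (ae_restrict_iff' hO.measurableSet).2 ?_
  filter_upwards [h, ae_add_pair hgS] with v h1 h2 hv
  obtain ⟨v1, v2, v3⟩ := hv
  rw [← h2.1 v1, ← h2.2.1 v2, ← h2.2.2 v3]
  exact h1 (openReg_subset _ _ v1) (openReg_subset _ _ v2) (openReg_subset _ _ v3)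

theorem fderiv_of_additive {lam N : ℝ} {S : ℝ × ℝ → ℝ}
    (hadd : ∀ v ∈ pairReg lam N, S (v.1 + v.2) = S v.1 + S v.2) {z w : ℝ × ℝ}
    (hv : (z, w) ∈ pairReg lam N) : fderiv ℝ S (z + w) = fderiv ℝ S z := by
  have hO := isOpen_pairReg lam N
  have hc : ContinuousAt (fun y : ℝ × ℝ => (y, w)) z := by fun_prop
  have hev : (fun y => S (y + w)) =ᶠ[𝓝 z] fun y => S y + S w := by
    filter_upwards [hc.preimage_mem_nhds (hO.mem_nhds hv)] with y hy
    exact hadd (y, w) hy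
  have := hev.fderiv_eq (𝕜 := ℝ)
  rwa [fderiv_comp_add_right, fderiv_add_const] at this

theorem pairReg_symm {lam N : ℝ} {z w : ℝ × ℝ} (hv : (z, w) ∈ pairReg lam N) :
    (w, z) ∈ pairReg lam N := by
  obtain ⟨h1, h2, h3⟩ := hv
  exact ⟨h2, h1, by simpa [add_comm] using h3⟩

theorem AEAdditive.exists_linear_openReg {lam : ℝ} {g : ℝ × ℝ → ℝ} (h : AEAdditive lam g)
    (hloc : LocallyIntegrable ((region lam).indicator g)) {N : ℝ} (hN : 2 * lam ^ 2 + 2 < N) :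
    ∃ A : ℝ × ℝ →L[ℝ] ℝ, ∀ᵐ z, z ∈ openReg lam N → g z = A z := by
  set M := 3 * N + 4 + lam ^ 2 with hM
  obtain ⟨S, hS, hgS⟩ := h.exists_smooth hloc M
  have hadd := h.additive_of_continuous hS.continuous hgS
  have hl := sq_nonneg lam
  have hsub : openReg lam N ⊆ openReg lam M := fun z hz => ⟨hz.1, hz.2.1, by linarith [hz.2.2]⟩
  set w₀ : ℝ × ℝ := (0, 2 * N + 3 + lam ^ 2) with hw₀
  have hpair : ∀ z ∈ openReg lam N, (z, w₀) ∈ pairReg lam M := fun z hz =>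
    have := openReg_add hz (Metric.mem_ball_self one_pos)
    ⟨hsub hz, this.1, this.2⟩
  set A := fderiv ℝ S w₀ with hA
  have hd : ∀ z ∈ openReg lam N, fderiv ℝ S z = A := by
    intro z hz
    have h1 := fderiv_of_additive hadd (hpair z hz)
    have h2 := fderiv_of_additive hadd (pairReg_symm (hpair z hz))
    rw [← h1, add_comm, h2]
  have hSd : Differentiable ℝ S := hS.differentiable one_ne_zero
  obtain ⟨c, hc⟩ := (isOpen_openReg lam N).exists_is_const_of_fderiv_eq_zero (𝕜 := ℝ)
    (f := fun z => S z - A z)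
    (convex_openReg lam N).isPreconnected (by fun_prop) (fun z hz => by
      rw [fderiv_fun_sub (hSd z) A.differentiableAt, hd z hz, A.fderiv, sub_self]
      rfl)
  set z₁ : ℝ × ℝ := (0, lam ^ 2 + 1) with hz₁
  have m1 : z₁ ∈ openReg lam N := by
    refine ⟨?_, ?_, ?_⟩ <;> simp only [hz₁] <;> nlinarith
  have m2 : z₁ + z₁ ∈ openReg lam N := by
    refine ⟨?_, ?_, ?_⟩ <;> simp only [hz₁, Prod.fst_add, Prod.snd_add] <;> nlinarith
  have c0 : c = 0 := by
    have e1 := hc _ m1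
    have e2 := hc _ m2
    have e3 := hadd (z₁, z₁) ⟨hsub m1, hsub m1, hsub m2⟩
    simp only [map_add] at e2 e3
    linarith
  refine ⟨A, ?_⟩
  filter_upwards [hgS] with z hz hzN
  have := hc z hzN
  rw [hz (hsub hzN)]
  linarith

/-- Measurable collision invariants are combinations of energy and momentum. -/
theorem AEAdditive.exists_eq_linear {lam : ℝ} {g : ℝ × ℝ → ℝ} (h : AEAdditive lam g)
    (hloc : LocallyIntegrable ((region lam).indicator g)) :
    ∃ a b : ℝ, ∀ᵐ z, z ∈ region lam → g z = a * z.2 + b * z.1 := by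
  set N₀ := 2 * lam ^ 2 + 3 with hN₀
  have hl := sq_nonneg lam
  have hex : ∀ k : ℕ, ∃ A : ℝ × ℝ →L[ℝ] ℝ, ∀ᵐ z, z ∈ openReg lam (N₀ + k) → g z = A z :=
    fun k => h.exists_linear_openReg hloc (by
      have : (0 : ℝ) ≤ k := Nat.cast_nonneg k
      linarith)
  choose A hA using hex
  set z₁ : ℝ × ℝ := (0, lam ^ 2 + 1) with hz₁
  have m1 : z₁ ∈ openReg lam N₀ := by
    refine ⟨?_, ?_, ?_⟩ <;> simp only [hz₁] <;> nlinarith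
  have hconst : ∀ k, A k = A 0 := by
    intro k
    have hO := isOpen_openReg lam N₀
    have hsub : ∀ j : ℕ, openReg lam N₀ ⊆ openReg lam (N₀ + j) := fun j z hz =>
      ⟨hz.1, hz.2.1, by
        have : (0 : ℝ) ≤ j := Nat.cast_nonneg j
        linarith [hz.2.2]⟩
    have heq : Set.EqOn (A k) (A 0) (openReg lam N₀) := by
      refine Measure.eqOn_open_of_ae_eq (μ := (volume : Measure (ℝ × ℝ))) ?_ hO
        (A k).continuous.continuousOn (A 0).continuous.continuousOn
      refine (ae_restrict_iff' hO.measurableSet).2 ?_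
      filter_upwards [hA k, hA 0] with z h1 h2 hz
      rw [← h1 (hsub k hz), ← h2 (hsub 0 hz)]
    have hev : (A k : ℝ × ℝ → ℝ) =ᶠ[𝓝 z₁] A 0 := heq.eventuallyEq_of_mem (hO.mem_nhds m1)
    have := hev.fderiv_eq (𝕜 := ℝ)
    rwa [(A k).fderiv, (A 0).fderiv] at this
  have hline : ∀ᵐ z : ℝ × ℝ, z.2 ≠ lam ^ 2 := by
    have h1 : ∀ᵐ y : ℝ, y ≠ lam ^ 2 := by
      simp [ae_iff]
    exact Measure.quasiMeasurePreserving_snd.ae h1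
  refine ⟨A 0 (0, 1), A 0 (1, 0), ?_⟩
  filter_upwards [ae_all_iff.2 hA, hline] with z hz hzl hzr
  obtain ⟨k, hk⟩ := exists_nat_gt z.2
  rw [hz k ⟨hzr.1, lt_of_le_of_ne hzr.2 (Ne.symm hzl), by linarith⟩, hconst k]
  have e : z = z.2 • ((0 : ℝ), (1 : ℝ)) + z.1 • ((1 : ℝ), (0 : ℝ)) := by ext <;> simp
  conv_lhs => rw [e, map_add, map_smul, map_smul, smul_eq_mul, smul_eq_mul, mul_comm z.2,
    mul_comm z.1]

/-- A function in `L²` with the weight `exp(-E)` is locally integrable. -/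
theorem locallyIntegrable_of_expW {lam : ℝ} {g : ℝ × ℝ → ℝ} (hg : Measurable g)
    (hi : Integrable fun z => expW lam 1 z * g z ^ 2) :
    LocallyIntegrable ((region lam).indicator g) := by
  have hem := measurable_expW lam 1
  have h1 : Integrable fun z => expW lam 1 z * g z := by
    refine ((integrable_expW lam one_pos).add hi).mono'
      (Measurable.aestronglyMeasurable (by fun_prop)) (Eventually.of_forall fun z => ?_)
    have e := expW_nonneg lam 1 z
    rw [norm_mul, Real.norm_eq_abs, abs_of_nonneg e, Real.norm_eq_abs]
    simp only [Pi.add_apply]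
    have : |g z| ≤ 1 + g z ^ 2 := by
      rw [← sq_abs]
      nlinarith [sq_nonneg (|g z| - 1), abs_nonneg (g z)]
    nlinarith [mul_le_mul_of_nonneg_left this e]
  have h2 := h1.locallyIntegrable.continuous_mul
    (g := fun z : ℝ × ℝ => Real.exp z.2) (by fun_prop)
  refine h2.congr (Eventually.of_forall fun z => ?_)
  simp only
  by_cases hz : z ∈ region lam
  · rw [expW_of_mem _ hz, Set.indicator_of_mem hz, ← mul_assoc, ← Real.exp_add]
    simp
  · rw [expW_of_notMem _ hz, Set.indicator_of_notMem hz]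
    simp

/-! ### The spectral gap in additive coordinates -/

theorem bker_pos {lam : ℝ} {z w : ℝ × ℝ} (hz : z ∈ region lam) (hw : w ∈ region lam)
    (hzw : z + w ∈ region lam) : 0 < bker lam z w := by
  unfold bker
  rw [if_pos ⟨hz, hw, hzw⟩]
  have h1 := pl_pos (pos_of_mem_region hz)
  have h2 := pl_pos (pos_of_mem_region hw)
  have h3 := pl_pos (pos_of_mem_region hzw)
  simp only [Prod.snd_add] at h3
  positivity

/-- The null space of the entropy dissipation. -/
theorem exists_linear_of_collForm_eq_zero {lam : ℝ} (hlam : 0 < lam) {g : ℝ × ℝ → ℝ}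
    (hg : Measurable g) (hi : Integrable fun z => om lam z * g z ^ 2)
    (h0 : collForm lam g = 0) :
    ∃ a b : ℝ, ∀ᵐ z, z ∈ region lam → g z = a * z.2 + b * z.1 := by
  have hadd : AEAdditive lam g := by
    have h := (integral_eq_zero_iff_of_nonneg
      (fun v : (ℝ × ℝ) × (ℝ × ℝ) => mul_nonneg (bker_nonneg lam v.1 v.2)
        (sq_nonneg (g (v.1 + v.2) - g v.1 - g v.2))) (collForm_eq hlam hg hi).1).1 h0
    filter_upwards [h] with v hv h1 h2 h3
    have := bker_pos h1 h2 h3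
    simp only [Pi.zero_apply, mul_eq_zero, this.ne', false_or, ne_eq, OfNat.ofNat_ne_zero,
      not_false_eq_true, pow_eq_zero_iff] at hv
    linarith
  exact hadd.exists_eq_linear
    (locallyIntegrable_of_expW hg (integrable_expW_mul_sq hlam hg hi))

/-- Passage to the symmetric normalization `u = √ω g`. -/
theorem symmetrize {lam : ℝ} (hlam : 0 < lam) {u g : ℝ × ℝ → ℝ}
    (hug : ∀ z ∈ region lam, u z = Real.sqrt (om lam z) * g z) :
    (IntegrableOn (fun z => u z ^ 2) (region lam) ↔ Integrable fun z => om lam z * g z ^ 2) ∧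
    ∫ z in region lam, u z ^ 2 = ∫ z, om lam z * g z ^ 2 ∧
    kernelForm (volume.restrict (region lam)) (symKernel lam) u =
      2 * kernelForm volume (fun v => kap lam v.1 v.2) g := by
  have hr := measurableSet_region lam
  have e : ∀ z ∈ region lam, u z ^ 2 = om lam z * g z ^ 2 := by
    intro z hz
    rw [hug z hz, mul_pow, Real.sq_sqrt (om_nonneg lam z)]
  refine ⟨?_, ?_, ?_⟩
  · rw [integrableOn_congr_fun e hr, integrableOn_iff_integrable_of_support_subset]
    intro z hz
    by_contra h
    exact hz (by simp [om_eq_zero h])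
  · rw [setIntegral_congr_fun hr e, setIntegral_eq_integral_of_forall_compl_eq_zero]
    intro z hz
    rw [om_eq_zero hz, zero_mul]
  · have h0 : ∀ v ∉ region lam ×ˢ region lam, 2 * (kap lam v.1 v.2 * (g v.1 * g v.2)) = 0 := by
      intro v hv
      have : kap lam v.1 v.2 = 0 := by
        by_cases h : v.2 ∈ region lam
        · rw [kap_symm]
          exact kap_eq_zero fun h' => hv ⟨h', h⟩
        · exact kap_eq_zero h
      rw [this]
      ring
    unfold kernelForm
    rw [Measure.prod_restrict, ← integral_const_mul,
      ← setIntegral_eq_integral_of_forall_compl_eq_zero h0]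
    refine setIntegral_congr_fun (hr.prod hr) fun v hv => ?_
    have h1 := (Real.sqrt_pos.2 (om_pos hlam hv.1)).ne'
    have h2 := (Real.sqrt_pos.2 (om_pos hlam hv.2)).ne'
    unfold symKernel
    rw [hug _ hv.1, hug _ hv.2]
    field_simp

/-- The collision invariants `|p|²` and `p_x`. -/
def invariant (i : Bool) (z : ℝ × ℝ) : ℝ := if i then z.2 else z.1

theorem measurable_invariant (i : Bool) : Measurable (invariant i) := by
  cases i
  · exact measurable_fst
  · exact measurable_snd

theorem memLp_invariant {lam : ℝ} (hlam : 0 < lam) (i : Bool) :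
    MemLp (fun z => invariant i z * (pl z.2 * (1 + pl z.2)) / Real.sqrt (om lam z)) 2
      (volume.restrict (region lam)) := by
  have h1 := measurable_invariant i
  have h2 := measurable_pl
  have h3 := measurable_om lam
  obtain ⟨c, C, hc, -, h⟩ := exists_om_bounds hlam
  have hB := one_le_plBound hlam
  have hint : IntegrableOn (fun z : ℝ × ℝ => Real.exp (-z.2) * (wt z * invariant i z ^ 2))
      (region lam) := by
    cases i
    · simpa [invariant] using integrable_invariant lam 0 1
    · simpa [invariant] using integrable_invariant lam 1 0
  refine (memLp_two_iff_integrable_sq (Measurable.aestronglyMeasurable (by fun_prop))).2 ?_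
  refine (hint.const_mul (plBound lam ^ 4 / c)).mono'
    (Measurable.aestronglyMeasurable (by fun_prop)) ?_
  refine (ae_restrict_mem (measurableSet_region lam)).mono fun z hz => ?_
  have ho := om_pos hlam hz
  have p0 := pl_pos (pos_of_mem_region hz)
  have p1 := pl_le_exp hlam hz.2
  have p2 := one_add_pl_le hlam hz.2
  have hw := one_le_wt z
  have hexp := Real.exp_pos (-z.2)
  rw [Real.norm_eq_abs, abs_of_nonneg (sq_nonneg _), div_pow, Real.sq_sqrt ho.le,
    div_le_iff₀ ho]
  have q : pl z.2 * (1 + pl z.2) ≤ plBound lam * Real.exp (-z.2) * plBound lam :=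
    mul_le_mul p1 p2 (by linarith) (by positivity)
  calc (invariant i z * (pl z.2 * (1 + pl z.2))) ^ 2
      = invariant i z ^ 2 * (pl z.2 * (1 + pl z.2)) ^ 2 := by ring
    _ ≤ invariant i z ^ 2 * (plBound lam * Real.exp (-z.2) * plBound lam) ^ 2 := by gcongr
    _ = plBound lam ^ 4 / c * (Real.exp (-z.2) * invariant i z ^ 2) *
        (c * (Real.exp (-z.2) * 1)) := by field_simp
    _ ≤ plBound lam ^ 4 / c * (Real.exp (-z.2) * (wt z * invariant i z ^ 2)) *
        (c * (Real.exp (-z.2) * wt z)) := by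
        gcongr
        exact le_mul_of_one_le_left (sq_nonneg _) hw
    _ ≤ _ := mul_le_mul_of_nonneg_left (h z hz).1 (by positivity)

theorem exists_gap {lam : ℝ} (hlam : 0 < lam) :
    ∃ c : ℝ, 0 < c ∧ ∀ g : ℝ × ℝ → ℝ, Measurable g →
      Integrable (fun z => om lam z * g z ^ 2) →
      (∀ i, ∫ z in region lam, invariant i z * (pl z.2 * (1 + pl z.2)) * g z = 0) →
      c * ∫ z, om lam z * g z ^ 2 ≤ collForm lam g := by
  have hom := measurable_om lam
  have hr := measurableSet_region lam
  have hmem : ∀ {u : ℝ × ℝ → ℝ}, Measurable u → (MemLp u 2 (volume.restrict (region lam)) ↔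
      IntegrableOn (fun z => u z ^ 2) (region lam)) := fun hu =>
    memLp_two_iff_integrable_sq hu.aestronglyMeasurable
  have hdiv : ∀ u : ℝ × ℝ → ℝ, ∀ z ∈ region lam,
      u z = Real.sqrt (om lam z) * (u z / Real.sqrt (om lam z)) := fun u z hz => by
    have := (Real.sqrt_pos.2 (om_pos hlam hz)).ne'
    field_simp
  have horth : ∀ {u g : ℝ × ℝ → ℝ}, (∀ z ∈ region lam, u z = Real.sqrt (om lam z) * g z) → ∀ i,
      ∫ z in region lam, invariant i z * (pl z.2 * (1 + pl z.2)) / Real.sqrt (om lam z) * u z =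
      ∫ z in region lam, invariant i z * (pl z.2 * (1 + pl z.2)) * g z := by
    intro u g hug i
    refine setIntegral_congr_fun hr fun z hz => ?_
    have := (Real.sqrt_pos.2 (om_pos hlam hz)).ne'
    rw [hug z hz]
    field_simp
  have hgap := exists_gap_of_sq_integrable_kernel (m := volume.restrict (region lam))
    (measurable_symKernel lam) (integrable_symKernel_sq hlam) (memLp_invariant hlam) ?_ ?_
  · obtain ⟨c, hc, h⟩ := hgap
    refine ⟨c, hc, fun g hg hi hig => ?_⟩
    have hs := symmetrize hlam (u := fun z => Real.sqrt (om lam z) * g z) (g := g)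
      fun z _ => rfl
    have := h _ ((hmem (by fun_prop)).2 (hs.1.2 hi)) (fun i => by
      rw [horth (g := g) (fun z _ => rfl) i, hig i])
    rw [hs.2.1, hs.2.2] at this
    rw [(collForm_eq hlam hg hi).2]
    exact this
  · intro u hu hu2
    have hs := symmetrize hlam (hdiv u)
    have hi := hs.1.1 ((hmem hu).1 hu2)
    have h1 := collForm_nonneg lam fun z => u z / Real.sqrt (om lam z)
    rw [(collForm_eq hlam (by fun_prop) hi).2] at h1
    rw [hs.2.1, hs.2.2]
    linarith
  · intro u hu hu2 huo hq
    have hs := symmetrize hlam (hdiv u)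
    have hi := hs.1.1 ((hmem hu).1 hu2)
    have hgm : Measurable fun z => u z / Real.sqrt (om lam z) := by fun_prop
    set g := fun z => u z / Real.sqrt (om lam z) with hgdef
    have h0 : collForm lam g = 0 := by
      rw [(collForm_eq hlam hgm hi).2, ← hs.2.1, ← hs.2.2, hq, sub_self]
    obtain ⟨a, b, hab⟩ := exists_linear_of_collForm_eq_zero hlam hgm hi h0
    have hab' : ∀ᵐ z ∂(volume.restrict (region lam)), g z = a * z.2 + b * z.1 :=
      (ae_restrict_iff' hr).2 hab
    -- Orthogonality to both invariants makes the weighted square integral of `a E + b x` vanish.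
    have hint : ∀ i, IntegrableOn (fun z => invariant i z * (pl z.2 * (1 + pl z.2)) * g z)
        (region lam) := by
      intro i
      have h1 := (memLp_invariant hlam i).integrable_mul hu2
      refine h1.congr ((ae_restrict_mem hr).mono fun z hz => ?_)
      have := (Real.sqrt_pos.2 (om_pos hlam hz)).ne'
      simp only [Pi.mul_apply, hgdef]
      field_simp
    have hz : ∫ z in region lam, pl z.2 * (1 + pl z.2) * g z ^ 2 = 0 := by
      have e : ∫ z in region lam, pl z.2 * (1 + pl z.2) * g z ^ 2 = ∫ z in region lam,
          (a * (invariant true z * (pl z.2 * (1 + pl z.2)) * g z) +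
            b * (invariant false z * (pl z.2 * (1 + pl z.2)) * g z)) := by
        refine integral_congr_ae (hab'.mono fun z hz => ?_)
        have e2 : g z ^ 2 = (a * z.2 + b * z.1) * g z := by rw [sq]; nth_rewrite 1 [hz]; rfl
        simp only [invariant, e2]
        simp only [if_true, Bool.false_eq_true, if_false]
        ring
      rw [e, integral_add ((hint true).const_mul a) ((hint false).const_mul b),
        integral_const_mul, integral_const_mul]
      have o1 := horth (hdiv u) true
      have o2 := horth (hdiv u) false
      rw [huo] at o1 o2
      rw [← o1, ← o2]
      ring
    have hint2 : IntegrableOn (fun z => pl z.2 * (1 + pl z.2) * g z ^ 2) (region lam) := by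
      refine ((hint true).const_mul a |>.add ((hint false).const_mul b)).congr
        (hab'.mono fun z hz => ?_)
      have e2 : g z ^ 2 = (a * z.2 + b * z.1) * g z := by rw [sq]; nth_rewrite 1 [hz]; rfl
      simp only [Pi.add_apply, invariant, e2]
      simp only [if_true, Bool.false_eq_true, if_false]
      ring
    have hpos : ∀ᵐ z ∂(volume.restrict (region lam)),
        0 ≤ pl z.2 * (1 + pl z.2) * g z ^ 2 :=
      (ae_restrict_mem hr).mono fun z hz => by
        have := pl_pos (pos_of_mem_region hz)
        positivity
    have hg0 := (integral_eq_zero_iff_of_nonneg_ae hpos hint2).1 hz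
    have hu0 : (fun z => u z ^ 2) =ᵐ[volume.restrict (region lam)] 0 := by
      filter_upwards [hg0, ae_restrict_mem hr] with z h1 h2
      have := pl_pos (pos_of_mem_region h2)
      have h3 : pl z.2 * (1 + pl z.2) ≠ 0 := by positivity
      have h4 : g z = 0 := by simpa [h3] using h1
      rw [hdiv u z h2, show u z / Real.sqrt (om lam z) = g z from rfl, h4]
      simp
    rw [integral_congr_ae hu0]
    simp

/-! ### The kernel of the operator -/

theorem opL_flat {n lam : ℝ} (hlam : 0 < lam) {f : ℝ × ℝ → ℝ} (hfm : Measurable f)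
    (hf : Integrable f (mu lam)) {p : ℝ × ℝ} (hp : p ∈ cutDomain lam) :
    opL n lam f p = n * Real.pi ^ 2 / planck p *
      (2 * (∫ w, kap lam (flat p) w * red f w) - om lam (flat p) * red f (flat p)) := by
  have hr := flat_mem_region hlam hp
  have h0 : planck p ≠ 0 := (pl_pos (pos_of_mem_region hr)).ne'
  have e : pl (flat p).2 = planck p := rfl
  unfold opL
  rw [opK_flat hlam n hfm hf hp, nu_flat hlam, om_eq hr, e]
  rw [red_flat hlam f hp]
  field_simp

/-- `(L f) f P/(1+P)` in the coordinates `(p_x, |p|²)`, for `f = (1 + P) g` and up to the factor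
`n π²`. -/
noncomputable def dissFun (lam : ℝ) (g : ℝ × ℝ → ℝ) (z : ℝ × ℝ) : ℝ :=
  2 * ((∫ w, kap lam z w * g w) * g z) - om lam z * g z ^ 2

theorem measurable_dissFun (lam : ℝ) {g : ℝ × ℝ → ℝ} (hg : Measurable g) :
    Measurable (dissFun lam g) := by
  have h1 := measurable_om lam
  have h2 : Measurable fun z => ∫ w, kap lam z w * g w :=
    (((measurable_kap lam).mul (hg.comp measurable_snd)).stronglyMeasurable
      |>.integral_prod_right').measurable
  unfold dissFun
  fun_prop

theorem opL_mul_flat {n lam : ℝ} (hlam : 0 < lam) {f : ℝ × ℝ → ℝ} (hfm : Measurable f)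
    (hf : Integrable f (mu lam)) {p : ℝ × ℝ} (hp : p ∈ cutDomain lam) :
    opL n lam f p * f p =
      Real.exp (flat p).2 * (n * Real.pi ^ 2 * dissFun lam (red f) (flat p)) := by
  have hr := flat_mem_region hlam hp
  have h0 : planck p ≠ 0 := (pl_pos (pos_of_mem_region hr)).ne'
  have h1 : 1 + planck p = Real.exp (flat p).2 * planck p := by
    have := exp_mul_one_add_pl (pos_of_mem_region hr)
    have e : pl (flat p).2 = planck p := rfl
    rw [e] at this
    have e1 : Real.exp (flat p).2 * Real.exp (-(flat p).2) = 1 := by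
      rw [← Real.exp_add]
      simp
    linear_combination Real.exp (flat p).2 * this - (1 + planck p) * e1
  rw [opL_flat hlam hfm hf hp]
  rw [red_flat hlam f hp]
  rw [h1]
  unfold dissFun
  field_simp

/-- `∫ (L f) f P/(1+P) dp` is a multiple of the entropy dissipation. -/
theorem integral_opL_mul {n lam : ℝ} (hlam : 0 < lam) {f : ℝ × ℝ → ℝ}
    (hfm : Measurable f) (hf : Integrable f (mu lam))
    (hi : Integrable fun z => om lam z * red f z ^ 2) :
    Integrable (fun p => opL n lam f p * f p) (mu lam) ∧
      -∫ p, opL n lam f p * f p ∂(mu lam) = n * Real.pi ^ 3 * collForm lam (red f) := by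
  have hgm := measurable_red hfm
  have hk := integrable_kap_mul hlam hgm (integrable_expW_mul_sq hlam hgm hi)
  have e1 : (fun z => ∫ w, kap lam z w * (red f z * red f w)) =
      fun z => (∫ w, kap lam z w * red f w) * red f z := by
    funext z
    rw [← integral_mul_const]
    congr 1
    funext w
    ring
  have i1 : Integrable fun z => (∫ w, kap lam z w * red f w) * red f z := by
    rw [← e1]
    exact hk.1.integral_prod_left
  have e2 : ∫ z, (∫ w, kap lam z w * red f w) * red f z =
      kernelForm volume (fun v => kap lam v.1 v.2) (red f) := by
    unfold kernelForm
    rw [integral_prod _ hk.1, e1]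
  have i2 : Integrable (dissFun lam (red f)) := (i1.const_mul 2).sub hi
  have e3 : ∫ z, dissFun lam (red f) z = -collForm lam (red f) := by
    unfold dissFun
    rw [integral_sub (i1.const_mul 2) hi, integral_const_mul, e2, (collForm_eq hlam hgm hi).2]
    ring
  have hdm := measurable_dissFun lam hgm
  have hcancel : ∀ z : ℝ × ℝ, Real.exp (-z.2) *
      (Real.exp z.2 * (n * Real.pi ^ 2 * dissFun lam (red f) z)) =
      n * Real.pi ^ 2 * dissFun lam (red f) z := by
    intro z
    rw [← mul_assoc, ← Real.exp_add]
    simp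
  have hG : AEStronglyMeasurable (fun z : ℝ × ℝ => Real.exp z.2 *
      (n * Real.pi ^ 2 * dissFun lam (red f) z)) (volume.restrict (region lam)) :=
    Measurable.aestronglyMeasurable (by fun_prop)
  have hHG := fun p hp => opL_mul_flat (n := n) hlam hfm hf (p := p) hp
  constructor
  · refine (integrable_mu hlam hHG hG).2 ?_
    simp only [hcancel]
    exact (i2.const_mul _).integrableOn
  · rw [integral_mu hlam hHG hG]
    simp only [hcancel]
    rw [integral_const_mul, setIntegral_eq_integral_of_forall_compl_eq_zero, e3]
    · ring
    · intro z hz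
      have : ∀ w, kap lam z w = 0 := fun w => by rw [kap_symm]; exact kap_eq_zero hz
      unfold dissFun
      simp [this, om_eq_zero hz]

/-- `L` annihilates `(1 + P) g` for a collision invariant `g`: a reflection in the decay integral
and a translation in the merger integral turn `K` into `ν`. -/
theorem kap_invariant {lam : ℝ} (hlam : 0 < lam) (a b : ℝ) (z : ℝ × ℝ) :
    2 * ∫ w, kap lam z w * (a * w.2 + b * w.1) = om lam z * (a * z.2 + b * z.1) := by
  set l : ℝ × ℝ → ℝ := fun w => a * w.2 + b * w.1 with hl
  have hlm : Measurable l := by fun_prop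
  have hadd : ∀ z w, l (z + w) = l z + l w := fun z w => by
    simp only [hl, Prod.fst_add, Prod.snd_add]; ring
  have hsub : ∀ z w, l (z - w) = l z - l w := fun z w => by
    simp only [hl, Prod.fst_sub, Prod.snd_sub]; ring
  have hem := measurable_expW lam 1
  have hB := one_le_plBound hlam
  have hli : Integrable fun w => expW lam 1 w * |l w| := by
    have h1 : Integrable ((region lam).indicator fun w : ℝ × ℝ =>
        Real.exp (-w.2) * (wt w * l w ^ 2)) :=
      (integrable_indicator_iff (measurableSet_region lam)).2 (integrable_invariant lam a b)
    refine ((integrable_expW lam one_pos).add h1).mono'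
      (Measurable.aestronglyMeasurable (by fun_prop)) (Eventually.of_forall fun w => ?_)
    rw [Real.norm_eq_abs, abs_of_nonneg (mul_nonneg (expW_nonneg _ _ _) (abs_nonneg _))]
    simp only [Pi.add_apply]
    by_cases hw : w ∈ region lam
    · rw [expW_of_mem _ hw, Set.indicator_of_mem hw, one_mul]
      have h2 : |l w| ≤ 1 + wt w * l w ^ 2 := by
        have := one_le_wt w
        rw [← sq_abs (l w)]
        nlinarith [sq_nonneg (|l w| - 1), abs_nonneg (l w), sq_nonneg (|l w|)]
      nlinarith [mul_le_mul_of_nonneg_left h2 (Real.exp_pos (-w.2)).le]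
    · rw [expW_of_notMem _ hw, Set.indicator_of_notMem hw]
      simp
  have hdom : ∀ {β : ℝ × ℝ → ℝ}, Measurable β → (∀ w, 0 ≤ β w) →
      (∀ w, β w ≤ plBound lam ^ 3 * expW lam 1 w) → Integrable fun w => β w * l w := by
    intro β hm h0 hβ
    refine (hli.const_mul (plBound lam ^ 3)).mono'
      (Measurable.aestronglyMeasurable (by fun_prop)) (Eventually.of_forall fun w => ?_)
    rw [norm_mul, Real.norm_eq_abs, abs_of_nonneg (h0 w), Real.norm_eq_abs, ← mul_assoc]
    exact mul_le_mul_of_nonneg_right (hβ w) (abs_nonneg _)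
  have hle1 : ∀ v, expW lam 1 v ≤ 1 := by
    intro v
    by_cases h : v ∈ region lam
    · rw [expW_of_mem _ h, Real.exp_le_one_iff]
      linarith [pos_of_mem_region h]
    · rw [expW_of_notMem _ h]
      exact zero_le_one
  have m1 : Measurable fun w => bker lam w (z - w) :=
    (measurable_bker lam).comp (f := fun w => (w, z - w)) (by fun_prop)
  have m2 : Measurable fun w => bker lam z w :=
    (measurable_bker lam).comp measurable_prodMk_left
  have i1 : Integrable fun w => bker lam w (z - w) * l w :=
    hdom m1 (fun w => bker_nonneg _ _ _) fun w => (bker_le hlam _ _).trans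
      (mul_le_mul_of_nonneg_left (mul_le_of_le_one_right (expW_nonneg _ _ _) (hle1 _))
        (by positivity))
  have i2 : Integrable fun w => bker lam z w * l w :=
    hdom m2 (fun w => bker_nonneg _ _ _) fun w => (bker_le hlam _ _).trans
      (mul_le_mul_of_nonneg_left (mul_le_of_le_one_left (expW_nonneg _ _ _) (hle1 _))
        (by positivity))
  have j1 := (integrable_bker_sub hlam z).mul_const (l z)
  have j2 := (integrable_bker hlam z).mul_const (l z)
  -- The decay products `w` and `z - w` are exchanged.
  have r1 : ∫ w, bker lam w (z - w) * l w = ∫ w, bker lam w (z - w) * l (z - w) := by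
    rw [← integral_sub_left_eq_self (fun w => bker lam w (z - w) * l w) volume z]
    congr 1
    funext w
    rw [sub_sub_cancel, bker_symm]
  have r1' : 2 * ∫ w, bker lam w (z - w) * l w = (∫ w, bker lam w (z - w)) * l z := by
    have h : ∫ w, bker lam w (z - w) * l (z - w) =
        (∫ w, bker lam w (z - w)) * l z - ∫ w, bker lam w (z - w) * l w := by
      rw [← integral_mul_const, ← integral_sub j1 i1]
      congr 1
      funext w
      rw [hsub]
      ring
    linarith
  -- The merged momentum `w` is written as `w' + z`.
  have k2 : Integrable fun w => bker lam z (w - z) * l w := by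
    have h : Integrable fun w => bker lam z w * l (w + z) := by
      refine (i2.add j2).congr (Eventually.of_forall fun w => ?_)
      simp only [Pi.add_apply, hadd]
      ring
    simpa using h.comp_sub_right z
  have r2 : ∫ w, bker lam z (w - z) * l w =
      (∫ w, bker lam z w * l w) + (∫ w, bker lam z w) * l z := by
    rw [← integral_add_right_eq_self (fun w => bker lam z (w - z) * l w) z,
      ← integral_mul_const, ← integral_add i2 j2]
    congr 1
    funext w
    rw [add_sub_cancel_right, hadd]
    ring
  have hk : ∫ w, kap lam z w * l w = (∫ w, bker lam w (z - w) * l w) +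
      (∫ w, bker lam z (w - z) * l w) - ∫ w, bker lam z w * l w := by
    have h := integral_sub (i1.add k2) i2
    simp only [Pi.add_apply] at h
    rw [← integral_add i1 k2, ← h]
    congr 1
    funext w
    unfold kap
    ring
  change 2 * ∫ w, kap lam z w * l w = om lam z * l z
  rw [hk, r2]
  unfold om
  linear_combination r1'

/-- `(1 + P)(a |p|² + b p_x)`. -/
noncomputable def kerFun (a b : ℝ) (p : ℝ × ℝ) : ℝ :=
  a * (modulus p ^ 2 * (1 + planck p)) + b * (p.1 * (1 + planck p))

theorem modulus_sq (p : ℝ × ℝ) : modulus p ^ 2 = sqNorm p :=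
  Real.sq_sqrt (by unfold sqNorm; positivity)

theorem kerFun_eq (a b : ℝ) (p : ℝ × ℝ) :
    kerFun a b p = (1 + planck p) * (a * (flat p).2 + b * (flat p).1) := by
  unfold kerFun flat
  rw [modulus_sq]
  ring

theorem measurable_kerFun (a b : ℝ) : Measurable (kerFun a b) := by
  have h1 := measurable_planck
  have h2 := measurable_sqNorm
  have h3 : Measurable modulus := by unfold modulus; fun_prop
  unfold kerFun
  fun_prop

theorem red_kerFun (lam a b : ℝ) {z : ℝ × ℝ} (hz : z ∈ region lam) :
    red (kerFun a b) z = a * z.2 + b * z.1 := by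
  have h0 := pl_pos (pos_of_mem_region hz)
  unfold red
  rw [kerFun_eq, planck_eq, sqNorm_unflat hz.1.le]
  unfold flat
  rw [sqNorm_unflat hz.1.le]
  unfold unflat
  field_simp

theorem integrable_wt_kerFun {lam : ℝ} (hlam : 0 < lam) (a b : ℝ) :
    Integrable (fun p => (1 + modulus p) ^ 3 * kerFun a b p ^ 2) (mu lam) := by
  have h1 := measurable_pl
  have h2 := measurable_wt
  have hB := one_le_plBound hlam
  refine (integrable_mu hlam
    (G := fun z => wt z * ((1 + pl z.2) * (a * z.2 + b * z.1)) ^ 2) (fun p _ => ?_)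
    (Measurable.aestronglyMeasurable (by fun_prop))).2 ?_
  · rw [kerFun_eq]
    rfl
  · refine ((integrable_invariant lam a b).const_mul (plBound lam ^ 2)).mono'
      (Measurable.aestronglyMeasurable (by fun_prop)) ?_
    refine (ae_restrict_mem (measurableSet_region lam)).mono fun z hz => ?_
    have p0 := pl_pos (pos_of_mem_region hz)
    have p2 := one_add_pl_le hlam hz.2
    have hw := zero_le_one.trans (one_le_wt z)
    rw [Real.norm_eq_abs, abs_of_nonneg (by positivity)]
    calc Real.exp (-z.2) * (wt z * ((1 + pl z.2) * (a * z.2 + b * z.1)) ^ 2)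
        = (1 + pl z.2) ^ 2 * (Real.exp (-z.2) * (wt z * (a * z.2 + b * z.1) ^ 2)) := by ring
      _ ≤ _ := by gcongr

theorem memLp_kerFun {lam : ℝ} (hlam : 0 < lam) (a b : ℝ) : MemLp (kerFun a b) 2 (mu lam) := by
  have hm := measurable_kerFun a b
  refine (memLp_two_iff_integrable_sq hm.aestronglyMeasurable).2 ?_
  refine (integrable_wt_kerFun hlam a b).mono' (hm.pow_const 2).aestronglyMeasurable
    (Eventually.of_forall fun p => ?_)
  rw [Real.norm_eq_abs, abs_of_nonneg (sq_nonneg _)]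
  exact le_mul_of_one_le_left (sq_nonneg _)
    (one_le_pow₀ (by have : 0 ≤ modulus p := Real.sqrt_nonneg _; linarith))

theorem opL_kerFun {n lam : ℝ} (hlam : 0 < lam) (a b : ℝ) {p : ℝ × ℝ} (hp : p ∈ cutDomain lam) :
    opL n lam (kerFun a b) p = 0 := by
  have := isFiniteMeasure_mu hlam
  have hr := flat_mem_region hlam hp
  rw [opL_flat hlam (measurable_kerFun a b)
    ((memLp_kerFun hlam a b).integrable (by norm_num)) hp]
  have e : ∫ w, kap lam (flat p) w * red (kerFun a b) w =
      ∫ w, kap lam (flat p) w * (a * w.2 + b * w.1) := by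
    congr 1
    funext w
    by_cases hw : w ∈ region lam
    · rw [red_kerFun lam a b hw]
    · rw [kap_eq_zero hw, zero_mul, zero_mul]
  rw [e, kap_invariant hlam, red_kerFun lam a b hr, sub_self, mul_zero]

theorem integrable_expW_red {lam : ℝ} (hlam : 0 < lam) (f : Lp ℝ 2 (mu lam)) :
    Integrable fun z => expW lam 1 z * red f z ^ 2 := by
  have hfm : Measurable f := (Lp.stronglyMeasurable f).measurable
  have hgm := measurable_red hfm
  have hem := measurable_expW lam 1
  have hpl := measurable_pl
  have h := (integrable_mu hlam (H := fun p => f p ^ 2)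
    (G := fun z => ((1 + pl z.2) * red f z) ^ 2) (fun p hp => by
      rw [red_flat hlam f hp]; rfl) (Measurable.aestronglyMeasurable (by fun_prop))).1
    (Lp.memLp f).integrable_sq
  have h' := (integrable_indicator_iff (measurableSet_region lam)).2 h
  refine h'.mono' (Measurable.aestronglyMeasurable (by fun_prop))
    (Eventually.of_forall fun z => ?_)
  rw [Real.norm_eq_abs, abs_of_nonneg (mul_nonneg (expW_nonneg _ _ _) (sq_nonneg _))]
  by_cases hz : z ∈ region lam
  · have h0 := pl_pos (pos_of_mem_region hz)
    rw [expW_of_mem _ hz, Set.indicator_of_mem hz, one_mul, mul_pow]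
    gcongr
    exact le_mul_of_one_le_left (sq_nonneg _) (one_le_pow₀ (by linarith))
  · rw [expW_of_notMem _ hz, Set.indicator_of_notMem hz, zero_mul]

theorem mem_kerL_iff {n lam : ℝ} (hn : 0 < n) (hlam : 0 < lam) (f : Lp ℝ 2 (mu lam)) :
    f ∈ kerL n lam hlam ↔ ∃ a b : ℝ, f =ᵐ[mu lam] kerFun a b := by
  have := isFiniteMeasure_mu hlam
  have hfm : Measurable f := (Lp.stronglyMeasurable f).measurable
  have hgm := measurable_red hfm
  constructor
  · intro hf
    have hf' : ∀ᵐ p ∂(mu lam), opL n lam f p = 0 := hf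
    have hi := integrable_expW_red hlam f
    have hk := integrable_kap_mul hlam hgm hi
    have hom := measurable_om lam
    have hkm : Measurable fun z => ∫ w, kap lam z w * red f w :=
      (((measurable_kap lam).mul (hgm.comp measurable_snd)).stronglyMeasurable
        |>.integral_prod_right').measurable
    have hms : MeasurableSet {z : ℝ × ℝ |
        2 * (∫ w, kap lam z w * red f w) = om lam z * red f z} :=
      measurableSet_eq_fun (by fun_prop) (by fun_prop)
    have hz : ∀ᵐ z ∂(volume.restrict (region lam)),
        2 * (∫ w, kap lam z w * red f w) = om lam z * red f z := by
      refine (ae_mu_iff hlam hms).1 ?_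
      filter_upwards [hf', ae_mu] with p h1 hp
      rw [opL_flat hlam hfm (integrable_Lp hlam f) hp] at h1
      have h0 : 0 < planck p := pl_pos (pos_of_mem_region (flat_mem_region hlam hp))
      have h2 : n * Real.pi ^ 2 / planck p ≠ 0 := by
        have := Real.pi_pos
        positivity
      have := (mul_eq_zero.1 h1).resolve_left h2
      linarith
    have hz' : ∀ᵐ z : ℝ × ℝ, 2 * ∫ w, kap lam z w * (red f z * red f w) =
        om lam z * red f z ^ 2 := by
      filter_upwards [(ae_restrict_iff' (measurableSet_region lam)).1 hz] with z h
      by_cases hzr : z ∈ region lam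
      · have e : ∫ w, kap lam z w * (red f z * red f w) =
            red f z * ∫ w, kap lam z w * red f w := by
          rw [← integral_const_mul]
          congr 1
          funext w
          ring
        rw [e]
        linear_combination red f z * h hzr
      · have : ∀ w, kap lam z w = 0 := fun w => by rw [kap_symm]; exact kap_eq_zero hzr
        simp [this, om_eq_zero hzr]
    -- `ν f = K f` makes `ν f²` integrable, since `(K f) f` is.
    have hio : Integrable fun z => om lam z * red f z ^ 2 :=
      (hk.1.integral_prod_left.const_mul 2).congr hz'
    have h0 : collForm lam (red f) = 0 := by
      rw [(collForm_eq hlam hgm hio).2, ← integral_congr_ae hz', integral_const_mul]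
      unfold kernelForm
      rw [integral_prod _ hk.1, sub_self]
    obtain ⟨a, b, hab⟩ := exists_linear_of_collForm_eq_zero hlam hgm hio h0
    refine ⟨a, b, ?_⟩
    have hms2 : MeasurableSet {z : ℝ × ℝ | red f z = a * z.2 + b * z.1} :=
      measurableSet_eq_fun hgm (by fun_prop)
    have h1 := (ae_mu_iff hlam hms2).2 ((ae_restrict_iff' (measurableSet_region lam)).2 hab)
    filter_upwards [h1, ae_mu] with p h2 hp
    rw [red_flat hlam f hp, h2, kerFun_eq]
  · rintro ⟨a, b, hab⟩
    change ∀ᵐ p ∂(mu lam), opL n lam f p = 0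
    filter_upwards [opL_congr (n := n) hlam (integrable_Lp hlam f)
      ((memLp_kerFun hlam a b).integrable (by norm_num)) hab, ae_mu] with p h1 hp
    rw [h1, opL_kerFun hlam a b hp]

/-! ### Return to the momentum variables -/

theorem integrable_om_red {lam : ℝ} (hlam : 0 < lam) {f : ℝ × ℝ → ℝ} (hfm : Measurable f)
    (hi : Integrable (fun p => (1 + modulus p) ^ 3 * f p ^ 2) (mu lam)) :
    Integrable fun z => om lam z * red f z ^ 2 := by
  have hgm := measurable_red hfm
  have hom := measurable_om lam
  have hpl := measurable_pl
  have hw := measurable_wt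
  obtain ⟨c, C, -, hC, h⟩ := exists_om_bounds hlam
  have h1 := (integrable_mu hlam (G := fun z => wt z * ((1 + pl z.2) * red f z) ^ 2)
    (fun p hp => by rw [red_flat hlam f hp]; rfl)
    (Measurable.aestronglyMeasurable (by fun_prop))).1 hi
  have h2 := ((integrable_indicator_iff (measurableSet_region lam)).2 h1).const_mul C
  refine h2.mono' (Measurable.aestronglyMeasurable (by fun_prop))
    (Eventually.of_forall fun z => ?_)
  rw [Real.norm_eq_abs, abs_of_nonneg (mul_nonneg (om_nonneg _ _) (sq_nonneg _))]
  by_cases hz : z ∈ region lam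
  · have h0 := pl_pos (pos_of_mem_region hz)
    have hw0 := zero_le_one.trans (one_le_wt z)
    rw [Set.indicator_of_mem hz]
    calc om lam z * red f z ^ 2 ≤ C * (Real.exp (-z.2) * wt z) * red f z ^ 2 :=
          mul_le_mul_of_nonneg_right (h z hz).2 (sq_nonneg _)
      _ = C * (Real.exp (-z.2) * (wt z * (1 * red f z ^ 2))) := by ring
      _ ≤ C * (Real.exp (-z.2) * (wt z * ((1 + pl z.2) ^ 2 * red f z ^ 2))) := by
          gcongr
          exact one_le_pow₀ (by linarith)
      _ = _ := by ring
  · rw [om_eq_zero hz, Set.indicator_of_notMem hz]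
    simp

theorem exists_integral_wt_le {lam : ℝ} (hlam : 0 < lam) :
    ∃ C : ℝ, 0 < C ∧ ∀ f : ℝ × ℝ → ℝ, Measurable f →
      Integrable (fun p => (1 + modulus p) ^ 3 * f p ^ 2) (mu lam) →
      ∫ p, (1 + modulus p) ^ 3 * f p ^ 2 ∂(mu lam) ≤ C * ∫ z, om lam z * red f z ^ 2 := by
  have hpl := measurable_pl
  have hw := measurable_wt
  have hB := one_le_plBound hlam
  obtain ⟨c, C, hc, -, h⟩ := exists_om_bounds hlam
  refine ⟨Real.pi * (plBound lam ^ 2 / c), by have := Real.pi_pos; positivity,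
    fun f hfm hi => ?_⟩
  have hgm := measurable_red hfm
  have hio := integrable_om_red hlam hfm hi
  have hHG : ∀ p ∈ cutDomain lam, (1 + modulus p) ^ 3 * f p ^ 2 =
      (fun z => wt z * ((1 + pl z.2) * red f z) ^ 2) (flat p) :=
    fun p hp => by rw [red_flat hlam f hp]; rfl
  have hG : AEStronglyMeasurable (fun z => wt z * ((1 + pl z.2) * red f z) ^ 2)
      (volume.restrict (region lam)) := Measurable.aestronglyMeasurable (by fun_prop)
  rw [integral_mu hlam hHG hG, mul_assoc]
  refine mul_le_mul_of_nonneg_left ?_ Real.pi_pos.le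
  rw [← integral_const_mul, ← setIntegral_eq_integral_of_forall_compl_eq_zero
    (s := region lam) (f := fun z => plBound lam ^ 2 / c * (om lam z * red f z ^ 2))
    (fun z hz => by simp [om_eq_zero hz])]
  refine setIntegral_mono_on ((integrable_mu hlam hHG hG).1 hi)
    (hio.const_mul _).integrableOn (measurableSet_region lam) fun z hz => ?_
  have h0 := pl_pos (pos_of_mem_region hz)
  have p2 := one_add_pl_le hlam hz.2
  have hw0 := zero_le_one.trans (one_le_wt z)
  calc Real.exp (-z.2) * (wt z * ((1 + pl z.2) * red f z) ^ 2)
      = (1 + pl z.2) ^ 2 / c * (c * (Real.exp (-z.2) * wt z) * red f z ^ 2) := by field_simp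
    _ ≤ plBound lam ^ 2 / c * (om lam z * red f z ^ 2) := by
        gcongr
        exact (h z hz).1

/-- Adding a collision invariant does not change the entropy dissipation. -/
theorem collForm_congr {lam : ℝ} {g h : ℝ × ℝ → ℝ} {a b : ℝ}
    (hgh : ∀ᵐ z, z ∈ region lam → g z = h z + (a * z.2 + b * z.1)) :
    collForm lam g = collForm lam h := by
  refine integral_congr_ae ?_
  filter_upwards [ae_add_pair hgh] with v hv
  by_cases hr : v.1 ∈ region lam ∧ v.2 ∈ region lam ∧ v.1 + v.2 ∈ region lam
  · rw [hv.1 hr.1, hv.2.1 hr.2.1, hv.2.2 hr.2.2, Prod.fst_add, Prod.snd_add]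
    ring
  · have : bker lam v.1 v.2 = 0 := if_neg hr
    rw [this, zero_mul, zero_mul]

theorem integral_invariant_of_orthogonal {lam : ℝ} (hlam : 0 < lam) (w : Lp ℝ 2 (mu lam))
    (h : ∀ a b, ∫ p, kerFun a b p * w p ∂(mu lam) = 0) (i : Bool) :
    ∫ z in region lam, invariant i z * (pl z.2 * (1 + pl z.2)) * red w z = 0 := by
  have hwm : Measurable w := (Lp.stronglyMeasurable w).measurable
  have hgm := measurable_red hwm
  have hpl := measurable_pl
  have him := measurable_invariant i
  have e : ∃ a b : ℝ, ∀ z, a * z.2 + b * z.1 = invariant i z := by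
    cases i
    · exact ⟨0, 1, fun z => by simp [invariant]⟩
    · exact ⟨1, 0, fun z => by simp [invariant]⟩
  obtain ⟨a, b, hab⟩ := e
  have h1 := h a b
  rw [integral_mu hlam (G := fun z => (1 + pl z.2) * invariant i z * ((1 + pl z.2) * red w z))
    (fun p hp => by rw [kerFun_eq, hab, red_flat hlam w hp]; rfl)
    (Measurable.aestronglyMeasurable (by fun_prop))] at h1
  have h2 := (mul_eq_zero.1 h1).resolve_left Real.pi_pos.ne'
  rw [← h2]
  refine setIntegral_congr_fun (measurableSet_region lam) fun z hz => ?_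
  have := exp_mul_one_add_pl (pos_of_mem_region hz)
  linear_combination (-(invariant i z * (1 + pl z.2) * red w z)) * this

end Milne

theorem lemma2p3 (n lam : ℝ) (hn : 0 < n) (hlam : 0 < lam) :
    (∀ g : MeasureTheory.Lp ℝ 2 (Milne.mu lam),
      g ∈ Milne.kerL n lam hlam ↔
        ∃ a b : ℝ, ∀ᵐ p ∂(Milne.mu lam),
          g p = a * (Milne.modulus p ^ 2 * (1 + Milne.planck p))
            + b * (p.1 * (1 + Milne.planck p))) ∧
    ∃ ν₀ : ℝ, 0 < ν₀ ∧
      (∀ p : ℝ × ℝ, 0 ≤ p.2 → lam ≤ Milne.modulus p →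
        ν₀ * (1 + Milne.modulus p) ^ 3 ≤ Milne.nu n lam p) ∧
      ∀ f w : MeasureTheory.Lp ℝ 2 (Milne.mu lam),
        MeasureTheory.Integrable (fun p => (1 + Milne.modulus p) ^ 3 * f p ^ 2) (Milne.mu lam) →
        w = f - Milne.projKer n lam hlam f →
        MeasureTheory.Integrable (fun p => Milne.opL n lam f p * f p) (Milne.mu lam) ∧
        MeasureTheory.Integrable (fun p => (1 + Milne.modulus p) ^ 3 * w p * w p)
          (Milne.mu lam) ∧
        ν₀ * ∫ p, (1 + Milne.modulus p) ^ 3 * w p * w p ∂(Milne.mu lam)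
          ≤ -∫ p, Milne.opL n lam f p * f p ∂(Milne.mu lam) := by
  have hpi := Real.pi_pos
  refine ⟨fun g => Milne.mem_kerL_iff hn hlam g, ?_⟩
  obtain ⟨c₁, hc₁, hfreq⟩ := Milne.exists_le_freq hlam
  obtain ⟨c₂, hc₂, hgap⟩ := Milne.exists_gap hlam
  obtain ⟨C, hC, hwt⟩ := Milne.exists_integral_wt_le hlam
  refine ⟨min (n * Real.pi ^ 2 * c₁) (n * Real.pi ^ 3 * c₂ / C), by positivity, ?_, ?_⟩
  · intro p _ hp
    have h0 : 0 ≤ Milne.sqNorm p := by unfold Milne.sqNorm; positivity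
    have h1 := hfreq (Milne.flat p) (by
      simp only [Milne.flat, Milne.sqNorm]
      linarith [sq_nonneg p.2]) ((Real.le_sqrt hlam.le h0).1 hp)
    have h2 : 0 ≤ Milne.wt (Milne.flat p) := zero_le_one.trans (Milne.one_le_wt _)
    rw [Milne.nu_flat hlam]
    calc min (n * Real.pi ^ 2 * c₁) (n * Real.pi ^ 3 * c₂ / C) * (1 + Milne.modulus p) ^ 3
        ≤ n * Real.pi ^ 2 * c₁ * Milne.wt (Milne.flat p) :=
          mul_le_mul_of_nonneg_right (min_le_left _ _) h2
      _ = n * Real.pi ^ 2 * (c₁ * Milne.wt (Milne.flat p)) := by ring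
      _ ≤ _ := mul_le_mul_of_nonneg_left h1 (by positivity)
  · intro f w hf hw
    have hfm : Measurable f := (Lp.stronglyMeasurable f).measurable
    have hwm : Measurable w := (Lp.stronglyMeasurable w).measurable
    have hkmem : Milne.projKer n lam hlam f ∈ Milne.kerL n lam hlam :=
      Submodule.starProjection_apply_mem _ f
    obtain ⟨a, b, hab⟩ := (Milne.mem_kerL_iff hn hlam _).1 hkmem
    have hfw : ∀ᵐ p ∂(Milne.mu lam), f p = w p + Milne.kerFun a b p := by
      rw [hw]
      filter_upwards [Lp.coeFn_sub f (Milne.projKer n lam hlam f), hab] with p h1 h2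
      rw [h1, Pi.sub_apply, h2, sub_add_cancel]
    have hwi : Integrable (fun p => (1 + Milne.modulus p) ^ 3 * w p ^ 2) (Milne.mu lam) := by
      have hm : Measurable Milne.modulus := by
        have := Milne.measurable_sqNorm
        unfold Milne.modulus
        fun_prop
      refine ((hf.const_mul 2).add ((Milne.integrable_wt_kerFun hlam a b).const_mul 2)).mono'
        (Measurable.aestronglyMeasurable (by fun_prop)) ?_
      filter_upwards [hfw] with p hp
      have h0 : 0 ≤ Milne.modulus p := Real.sqrt_nonneg _
      rw [Real.norm_eq_abs, abs_of_nonneg (by positivity)]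
      simp only [Pi.add_apply]
      have h1 : w p ^ 2 ≤ 2 * f p ^ 2 + 2 * Milne.kerFun a b p ^ 2 := by
        rw [hp]
        nlinarith [sq_nonneg (w p + 2 * Milne.kerFun a b p)]
      calc (1 + Milne.modulus p) ^ 3 * w p ^ 2
          ≤ (1 + Milne.modulus p) ^ 3 * (2 * f p ^ 2 + 2 * Milne.kerFun a b p ^ 2) := by gcongr
        _ = _ := by ring
    have hwi' : (fun p => (1 + Milne.modulus p) ^ 3 * w p * w p) =
        fun p => (1 + Milne.modulus p) ^ 3 * w p ^ 2 := by
      funext p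
      ring
    have hof := Milne.integrable_om_red hlam hfm hf
    have how := Milne.integrable_om_red hlam hwm hwi
    obtain ⟨hLi, hLe⟩ := Milne.integral_opL_mul (n := n) hlam hfm (Milne.integrable_Lp hlam f) hof
    rw [hwi']
    refine ⟨hLi, hwi, ?_⟩
    have horth : ∀ a b, ∫ p, Milne.kerFun a b p * w p ∂(Milne.mu lam) = 0 := by
      intro a b
      have hk := Milne.memLp_kerFun hlam a b
      have hmem : hk.toLp _ ∈ Milne.kerL n lam hlam :=
        (Milne.mem_kerL_iff hn hlam _).2 ⟨a, b, hk.coeFn_toLp⟩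
      have h1 : w ∈ (Milne.kerL n lam hlam)ᗮ := by
        rw [hw]
        exact Submodule.sub_starProjection_mem_orthogonal f
      have h2 := (Submodule.mem_orthogonal' _ _).1 h1 _ hmem
      rw [Milne.inner_eq_integral] at h2
      rw [← h2]
      refine integral_congr_ae ?_
      filter_upwards [hk.coeFn_toLp] with p hp
      rw [hp]
    have hred : ∀ᵐ z, z ∈ Milne.region lam →
        Milne.red f z = Milne.red w z + (a * z.2 + b * z.1) := by
      have h1 := Milne.measurable_red hfm
      have h2 := Milne.measurable_red hwm
      refine (ae_restrict_iff' (Milne.measurableSet_region lam)).1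
        ((Milne.ae_mu_iff hlam (measurableSet_eq_fun h1 (by fun_prop))).1 ?_)
      filter_upwards [hfw, Milne.ae_mu] with p h3 hp
      have h0 : 0 < Milne.planck p :=
        Milne.pl_pos (Milne.pos_of_mem_region (Milne.flat_mem_region hlam hp))
      rw [Milne.red_flat hlam f hp, Milne.red_flat hlam w hp, Milne.kerFun_eq, ← mul_add] at h3
      exact mul_left_cancel₀ (by positivity) h3
    have hq := hgap _ (Milne.measurable_red hwm) how
      (Milne.integral_invariant_of_orthogonal hlam w horth)
    have hI : 0 ≤ ∫ p, (1 + Milne.modulus p) ^ 3 * w p ^ 2 ∂(Milne.mu lam) :=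
      integral_nonneg fun p => mul_nonneg
        (pow_nonneg (add_nonneg zero_le_one (Real.sqrt_nonneg _)) 3) (sq_nonneg _)
    rw [hLe, Milne.collForm_congr hred]
    calc min (n * Real.pi ^ 2 * c₁) (n * Real.pi ^ 3 * c₂ / C) *
          ∫ p, (1 + Milne.modulus p) ^ 3 * w p ^ 2 ∂(Milne.mu lam)
        ≤ n * Real.pi ^ 3 * c₂ / C * (C * ∫ z, Milne.om lam z * Milne.red w z ^ 2) :=
          mul_le_mul (min_le_right _ _) (hwt w hwm hwi) hI (by positivity)
      _ = n * Real.pi ^ 3 * (c₂ * ∫ z, Milne.om lam z * Milne.red w z ^ 2) := by field_simp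
      _ ≤ n * Real.pi ^ 3 * Milne.collForm lam (Milne.red w) :=
          mul_le_mul_of_nonneg_left hq (by positivity)
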